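/- Consider a content delivery network with finite sets $\mathcal I$ of demand points, $\mathcal J$ of edge servers, $\mathcal K$ of origin servers, and $\Theta$ of request types, satisfying the following assumptions. (A1) The allocation is deterministic: each demand point $i$ is assigned to exactly one edge server and each edge server to exactly one origin server. Let $\mathcal I_j$ be the set of demand points assigned to $j\in\mathcal J$. (A2) Demand point $i\in\mathcal I$ generates requests according to a Poisson process of rate $\xi_i>0$. (A3) Each request of demand point $i$ is of type $\vartheta\in\Theta$ with probability $p_i^\vartheta\in[0,1]$, where $\sum_{\vartheta\in\Theta}p_i^\vartheta=1$. (A4) At each edge server $j$, the successive service times of the requests of type $\vartheta$ are exponentially distributed with rate $\mu_j^\vartheta>0$. All request processes, request types and service times are mutually independent. The service regime is disaggregated: at each edge server, the requests of each type $\vartheta\in\Theta$ are served, in order of arrival, by a separate single-server queue with unlimited waiting room, which is empty at time $0$. For $j\in\mathcal J$ put $$\Lambda_j=\sum_{i\in\mathcal I_j}\xi_i,\qquad \Lambda_j^\vartheta=\sum_{i\in\mathcal I_j}\xi_i\,p_i^\vartheta\quad(\vartheta\in\Theta).$$ **Theorem.** Let $j\in\mathcal J$ be an edge server such that $\Lambda_j^\vartheta<\mu_j^\vartheta$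 for every $\vartheta\in\Theta$. Then the service system at $j$ decomposes into $|\Theta|$ independent $\mathrm M/\mathrm M/1$ queues: for each $\vartheta$, the queue for type $\vartheta$ has Poisson arrivals of rate $\Lambda_j^\vartheta$ (no arrivals if $\Lambda_j^\vartheta=0$) and i.i.d. exponential service times of rate $\mu_j^\vartheta$ independent of its arrivals, and the pairs (arrival process, service times) belonging to different types are independent. If moreover $\mathcal I_j\neq\emptyset$, then the sojourn time (waiting plus service) of the $n$-th request arriving at $j$ converges in distribution as $n\to\infty$, and its limit $T_j$, the steady-state sojourn time at $j$, is hyperexponential: its law is the mixture, with weights $\Lambda_j^\vartheta/\Lambda_j$, of the exponential distributions with rates $\mu_j^\vartheta-\Lambda_j^\vartheta$, $\vartheta\in\Theta$. In particular, $T_j$ is integrable and $$\mathbb E[T_j]=\sum_{\vartheta\in\Theta}\frac{\Lambda_j^\vartheta}{\Lambda_j\,(\mu_j^\vartheta-\Lambda_j^\vartheta)}.$$ -/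

import Mathlib

open MeasureTheory ProbabilityTheory Filter Topology
open scoped NNReal ENNReal

noncomputable section

namespace CDN

/-- `N` is (the counting process of) a homogeneous Poisson process of rate `r ≥ 0` on `[0, ∞)`:
almost all paths start at `0`, are nondecreasing and right-continuous, increments over disjoint
intervals are independent, and `N t - N s` is Poisson with mean `r (t - s)`.
(`r = 0` gives the process without points. The natural-number subtraction is harmless,
since the paths are nondecreasing.) -/
structure IsPoissonProcess {Ω : Type*} [MeasurableSpace Ω] (N : ℝ≥0 → Ω → ℕ) (r : ℝ)
    (P : Measure Ω) : Prop where
  rate_nonneg : 0 ≤ r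
  measurable : ∀ t, Measurable (N t)
  start : ∀ᵐ ω ∂P, N 0 ω = 0
  mono : ∀ᵐ ω ∂P, Monotone fun t => N t ω
  rightCont : ∀ᵐ ω ∂P, ∀ t, ContinuousWithinAt (fun s => N s ω) (Set.Ici t) t
  indep : HasIndepIncrements N P
  law : ∀ s t, s ≤ t →
    HasLaw (fun ω => N t ω - N s ω) (poissonMeasure (r.toNNReal * (t - s))) P

/-- Epoch of the point number `n` (numbered from `0`) of a counting process: the first time at
which the count exceeds `n`. -/
def epoch {Ω : Type*} (N : ℝ≥0 → Ω → ℕ) (n : ℕ) (ω : Ω) : ℝ≥0 :=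
  sInf {t | n < N t ω}

/-- A single-server queue with unlimited waiting room, given by the counting process of its
arrivals and by the service times of its customers in order of arrival. -/
structure Queue (Ω : Type*) where
  arrivals : ℝ≥0 → Ω → ℕ
  service : ℕ → Ω → ℝ

namespace Queue

variable {Ω : Type*}

/-- Departure epochs under first-come-first-served service by one server, starting empty: the
service of a customer starts at its arrival or at the departure of its predecessor, whichever
comes later. -/
def departure (Q : Queue Ω) : ℕ → Ω → ℝ
  | 0, ω => epoch Q.arrivals 0 ω + Q.service 0 ω
  | m + 1, ω => max (epoch Q.arrivals (m + 1) ω : ℝ) (Q.departure m ω) + Q.service (m + 1) ω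

/-- Sojourn time (waiting plus service) of customer number `m`. -/
def sojourn (Q : Queue Ω) (m : ℕ) (ω : Ω) : ℝ :=
  Q.departure m ω - epoch Q.arrivals m ω

/-- The randomness driving the queue: its arrival process and its service times. -/
def input (Q : Queue Ω) (ω : Ω) : (ℝ≥0 → ℕ) × (ℕ → ℝ) :=
  (fun t => Q.arrivals t ω, fun m => Q.service m ω)

/-- `M/M/1` with arrival rate `l` and service rate `m`: Poisson arrivals, i.i.d. exponential
service times, arrivals independent of service times. (The single server is part of `Queue`.) -/
structure IsMM1 [MeasurableSpace Ω] (Q : Queue Ω) (l m : ℝ) (P : Measure Ω) : Prop where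
  rate_pos : 0 < m
  arrivals_poisson : IsPoissonProcess Q.arrivals l P
  service_law : ∀ n, HasLaw (Q.service n) (expMeasure m) P
  service_indep : iIndepFun Q.service P
  arrivals_indep_service :
    IndepFun (fun ω t => Q.arrivals t ω) (fun ω n => Q.service n ω) P

end Queue

/-- Hyperexponential distribution: the mixture, with weights `w`, of the exponential
distributions of rates `r`. -/
def hyperexpMeasure {Θ : Type*} [Fintype Θ] (w r : Θ → ℝ) : Measure ℝ :=
  ∑ θ, ENNReal.ofReal (w θ) • expMeasure (r θ)

/-- The deterministic data of a content delivery network with demand points `I`, edge servers `J`,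
origin servers `K` and request types `Θ`. The allocation is a (deterministic) pair of maps. -/
structure Network (I J K Θ : Type*) [Fintype Θ] where
  /-- the edge server of a demand point -/
  edge : I → J
  /-- the origin server of an edge server -/
  origin : J → K
  /-- request rates -/
  ξ : I → ℝ
  ξ_pos : ∀ i, 0 < ξ i
  /-- type probabilities -/
  p : I → Θ → ℝ
  p_mem : ∀ i θ, p i θ ∈ Set.Icc (0 : ℝ) 1
  p_sum : ∀ i, ∑ θ, p i θ = 1
  /-- service rates -/
  μ : J → Θ → ℝ
  μ_pos : ∀ j θ, 0 < μ j θ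

namespace Network

variable {I J K Θ : Type*} [Fintype I] [Fintype Θ]

open Classical in
/-- Total request rate `Λ_j` at an edge server. -/
def rate (C : Network I J K Θ) (j : J) : ℝ :=
  ∑ i with C.edge i = j, C.ξ i

open Classical in
/-- Request rate `Λ_j^θ` of type `θ` at an edge server. -/
def typeRate (C : Network I J K Θ) (j : J) (θ : Θ) : ℝ :=
  ∑ i with C.edge i = j, C.ξ i * C.p i θ

end Network

/-- The random primitives of the network:
`req i t` is the number of requests generated at demand point `i` up to time `t`,
`type i n` is the type of request number `n` of demand point `i`,
`service j θ m` is the service time of the `m`-th request of type `θ` arriving at edge server `j`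
(all requests being numbered from `0`). -/
structure Primitives (I J Θ Ω : Type*) where
  req : I → ℝ≥0 → Ω → ℕ
  type : I → ℕ → Ω → Θ
  service : J → Θ → ℕ → Ω → ℝ

namespace Primitives

variable {I J K Θ Ω : Type*}

/-- The σ-algebras generated by the individual primitives: the request process of each demand
point, the type of each request, and each service time. -/
@[reducible] def sigma (X : Primitives I J Θ Ω) : I ⊕ (I × ℕ) ⊕ (J × Θ × ℕ) → MeasurableSpace Ω
  | .inl i => MeasurableSpace.comap (fun ω t => X.req i t ω) inferInstance
  | .inr (.inl (i, n)) => MeasurableSpace.comap (X.type i n) ⊤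
  | .inr (.inr (j, θ, m)) => MeasurableSpace.comap (X.service j θ m) inferInstance

/-- The arrival and service assumptions: Poisson requests, random classification, exponential
service times, all of these primitives being mutually independent. -/
structure Satisfies [Fintype Θ] [MeasurableSpace Ω] (X : Primitives I J Θ Ω)
    (C : Network I J K Θ) (P : Measure Ω) : Prop where
  req_poisson : ∀ i, IsPoissonProcess (X.req i) (C.ξ i) P
  type_measurable : ∀ i n θ, MeasurableSet {ω | X.type i n ω = θ}
  type_law : ∀ i n θ, P {ω | X.type i n ω = θ} = ENNReal.ofReal (C.p i θ)
  service_measurable : ∀ j θ m, Measurable (X.service j θ m)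
  service_law : ∀ j θ m, HasLaw (X.service j θ m) (expMeasure (C.μ j θ)) P
  indep : iIndep X.sigma P

variable [Fintype I]

open Classical in
/-- Number of requests arriving at edge server `j` up to time `t`. -/
def total [Fintype Θ] (X : Primitives I J Θ Ω) (C : Network I J K Θ) (j : J) (t : ℝ≥0) (ω : Ω) :
    ℕ :=
  ∑ i with C.edge i = j, X.req i t ω

open Classical in
/-- Number of requests of type `θ` arriving at edge server `j` up to time `t`. -/
def typeCount [Fintype Θ] (X : Primitives I J Θ Ω) (C : Network I J K Θ) (j : J) (θ : Θ)
    (t : ℝ≥0) (ω : Ω) : ℕ :=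
  ∑ i with C.edge i = j, ((Finset.range (X.req i t ω)).filter fun n => X.type i n ω = θ).card

/-- Disaggregated service regime: at edge server `j`, the requests of type `θ` are processed by a
single-server queue of their own. -/
def dsrQueue [Fintype Θ] (X : Primitives I J Θ Ω) (C : Network I J K Θ) (j : J) (θ : Θ) :
    Queue Ω where
  arrivals := X.typeCount C j θ
  service := X.service j θ

open Classical in
/-- Sojourn time of request number `n` (of any type) at edge server `j` in the disaggregated
regime. Let `e` be the arrival epoch of this request at `j`. The request has the type `θ` whose
count jumps at `e` (almost surely there is exactly one such type if `j` receives requests), it is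
the customer number `typeCount e - 1` of the queue for type `θ`, and its sojourn time is the one
in that queue. -/
def sojourn [Fintype Θ] (X : Primitives I J Θ Ω) (C : Network I J K Θ) (j : J) (n : ℕ) (ω : Ω) :
    ℝ :=
  let e := epoch (X.total C j) n ω
  ∑ θ, if ∀ s < e, X.typeCount C j θ s ω < X.typeCount C j θ e ω then
    (X.dsrQueue C j θ).sojourn (X.typeCount C j θ e ω - 1) ω else 0

/-- `T` is a steady-state sojourn time at edge server `j` in the disaggregated regime: the sojourn
time of the `n`-th request arriving at `j` converges to `T` in distribution as `n → ∞`. -/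
def IsSteadyStateSojourn [Fintype Θ] [MeasurableSpace Ω] (X : Primitives I J Θ Ω)
    (C : Network I J K Θ) (P : Measure Ω) [IsProbabilityMeasure P] (j : J)
    {Ω' : Type*} [MeasurableSpace Ω'] (T : Ω' → ℝ) (P' : Measure Ω') [IsProbabilityMeasure P'] :
    Prop :=
  TendstoInDistribution (fun n => X.sojourn C j n) atTop T (fun _ => P) P'

end Primitives

end CDN

end

/-!
The number of requests of a demand point in a time interval is Poisson, and each request is
classified independently, so the generating function of the per-type counts factorizes: the types
thin the request processes into independent Poisson processes. Adding up the demand points served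
by `j` gives the independent `M/M/1` queues.

For the sojourn times, fix a type `θ` and observe its queue at the arrivals of requests of *all*
types. By the memoryless property these arrivals are separated by i.i.d. exponential times of rate
`Λ_j`, and each is of type `θ` with probability `Λ_j^θ / Λ_j`, independently of everything else.
The workload of the queue therefore follows a recursion with i.i.d. input, which has a mixture of
the unit mass at `0` and an exponential distribution as stationary law and contracts any two
starting points towards each other because the queue is stable. A request of type `θ` spends the
workload it leaves behind, and conditionally on its type this converges to the exponential
distribution of rate `μ_j^θ - Λ_j^θ`; mixing over the type of the `n`-th request gives the
hyperexponential limit.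
-/

noncomputable section

namespace CDN

lemma integrable_of_abs_le {α : Type*} [MeasurableSpace α] {μ : Measure α} [IsFiniteMeasure μ]
    {f : α → ℝ} (hf : Measurable f) {B : ℝ} (hB : ∀ x, |f x| ≤ B) : Integrable f μ :=
  Integrable.of_bound hf.aestronglyMeasurable B (ae_of_all _ hB)

lemma measure_ext_of_Ioi {μ ν : Measure ℝ} [IsFiniteMeasure μ]
    (h : ∀ x, μ (Set.Ioi x) = ν (Set.Ioi x)) : μ = ν := by
  have hcover : ⋃ n : ℕ, Set.Ioi (-(n : ℝ)) = Set.univ :=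
    Set.eq_univ_of_forall fun x => Set.mem_iUnion.2 <| by
      simpa only [Set.mem_Ioi, neg_lt] using exists_nat_gt (-x)
  refine Measure.ext_of_generateFrom_of_iUnion _ _
    (borel_eq_generateFrom_Ioi ℝ ▸ BorelSpace.measurable_eq) isPiSystem_Ioi hcover
    (fun n => ⟨_, rfl⟩) (fun _ => measure_ne_top μ _) ?_
  rintro _ ⟨x, rfl⟩
  exact h x

/-! ### Exponential distributions and their mixtures -/

section Exponential

lemma expMeasure_eq_withDensity (r : ℝ) :
    expMeasure r = (volume.restrict (Set.Ioi (0 : ℝ))).withDensity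
      fun x => ENNReal.ofReal (r * Real.exp (-(r * x))) := by
  rw [restrict_Ioi_eq_restrict_Ici, ← withDensity_indicator measurableSet_Ici]
  change volume.withDensity (exponentialPDF r) = _
  congr 1 with x
  by_cases hx : 0 ≤ x
  · rw [exponentialPDF_of_nonneg hx, Set.indicator_of_mem (Set.mem_Ici.2 hx)]
  · rw [exponentialPDF_of_neg (not_le.1 hx), Set.indicator_of_notMem (by simpa using hx)]

lemma ae_pos_expMeasure (r : ℝ) : ∀ᵐ x ∂expMeasure r, 0 < x := by
  rw [expMeasure_eq_withDensity]
  exact (withDensity_absolutelyContinuous _ _).ae_le (ae_restrict_mem measurableSet_Ioi)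

variable {r : ℝ} (hr : 0 < r)
include hr

lemma integral_expMeasure {E : Type*} [NormedAddCommGroup E] [NormedSpace ℝ E] (f : ℝ → E) :
    ∫ x, f x ∂expMeasure r = ∫ x in Set.Ioi 0, (r * Real.exp (-(r * x))) • f x := by
  rw [expMeasure_eq_withDensity,
    integral_withDensity_eq_integral_toReal_smul (by fun_prop) (by simp)]
  exact integral_congr_ae (ae_of_all _ fun x => by
    dsimp only; rw [ENNReal.toReal_ofReal (by positivity)])

lemma integrable_expMeasure_iff {E : Type*} [NormedAddCommGroup E] [NormedSpace ℝ E] (f : ℝ → E) :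
    Integrable f (expMeasure r) ↔
      IntegrableOn (fun x => (r * Real.exp (-(r * x))) • f x) (Set.Ioi 0) := by
  rw [expMeasure_eq_withDensity, IntegrableOn,
    integrable_withDensity_iff_integrable_smul' (by fun_prop) (by simp)]
  exact integrable_congr (ae_of_all _ fun x => by
    dsimp only; rw [ENNReal.toReal_ofReal (by positivity)])

lemma integral_cexp_mul_expMeasure {z : ℂ} (hz : z.re < r) :
    ∫ x, Complex.exp (z * x) ∂expMeasure r = r / (r - z) := by
  have hne : (r : ℂ) - z ≠ 0 := fun h => by
    have := congrArg Complex.re h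
    simp only [Complex.sub_re, Complex.ofReal_re, Complex.zero_re] at this
    linarith
  have hne' : z - r ≠ 0 := by rw [← neg_sub]; exact neg_ne_zero.2 hne
  have hdensity (x : ℝ) : (r * Real.exp (-(r * x))) • Complex.exp (z * x)
      = (r : ℂ) * Complex.exp ((z - r) * x) := by
    rw [Complex.real_smul]
    push_cast
    rw [mul_assoc, ← Complex.exp_add]
    ring_nf
  simp_rw [integral_expMeasure hr, hdensity, integral_const_mul,
    integral_exp_mul_complex_Ioi (a := z - r) (by simpa using hz) 0, Complex.ofReal_zero, mul_zero,
    Complex.exp_zero]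
  field_simp
  ring

lemma charFun_expMeasure (t : ℝ) : charFun (expMeasure r) t = r / (r - t * Complex.I) := by
  rw [charFun_apply_real,
    ← integral_cexp_mul_expMeasure hr (z := t * Complex.I) (by simpa using hr)]
  exact integral_congr_ae (ae_of_all _ fun x => by ring_nf)

lemma integrable_exp_mul_expMeasure {a : ℝ} (ha : a < r) :
    Integrable (fun x => Real.exp (a * x)) (expMeasure r) := by
  rw [integrable_expMeasure_iff hr]
  refine ((integrableOn_exp_mul_Ioi (sub_neg.2 ha) 0).const_mul r).congr (ae_of_all _ fun x => ?_)
  dsimp only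
  rw [smul_eq_mul, mul_assoc, ← Real.exp_add]
  ring_nf

lemma integral_exp_mul_expMeasure {a : ℝ} (ha : a < r) :
    ∫ x, Real.exp (a * x) ∂expMeasure r = r / (r - a) := by
  have h := integral_cexp_mul_expMeasure hr (z := a) (by simpa using ha)
  simp_rw [← Complex.ofReal_mul, ← Complex.ofReal_exp, integral_complex_ofReal] at h
  exact_mod_cast h

lemma integrable_id_expMeasure : Integrable (fun x => x) (expMeasure r) := by
  have hexp := (integrable_exp_mul_expMeasure hr (a := r / 2) (by linarith)).const_mul (2 / r)
  refine hexp.mono' (by fun_prop) ?_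
  filter_upwards [ae_pos_expMeasure r] with x hx
  calc ‖x‖ = 2 / r * (r / 2 * x) := by rw [Real.norm_of_nonneg hx.le]; field_simp
    _ ≤ 2 / r * Real.exp (r / 2 * x) := by
        gcongr
        linarith [Real.add_one_le_exp (r / 2 * x)]

lemma integral_id_expMeasure : ∫ x, x ∂expMeasure r = 1 / r := by
  have hGamma := Real.integral_rpow_mul_exp_neg_mul_Ioi (a := 2) (r := r) (by norm_num) hr
  rw [setIntegral_congr_fun (g := fun x => Real.exp (-(r * x)) * x) measurableSet_Ioi
    fun x _ => by norm_num; ring] at hGamma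
  simp only [integral_expMeasure hr, smul_eq_mul, mul_assoc, integral_const_mul, hGamma]
  norm_num [Real.Gamma_two]
  field_simp

lemma expMeasure_Ioi {x : ℝ} (hx : 0 ≤ x) :
    expMeasure r (Set.Ioi x) = ENNReal.ofReal (Real.exp (-(r * x))) := by
  have := isProbabilityMeasure_expMeasure hr
  have hcdf := cdf_expMeasure_eq hr x
  rw [cdf_eq_real, if_pos hx] at hcdf
  rw [← Set.compl_Iic, ← ofReal_measureReal, probReal_compl_eq_one_sub measurableSet_Iic, hcdf,
    sub_sub_cancel]

lemma expMeasure_Ioi_of_neg {x : ℝ} (hx : x < 0) : expMeasure r (Set.Ioi x) = 1 := by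
  have := isProbabilityMeasure_expMeasure hr
  exact (prob_compl_eq_zero_iff measurableSet_Ioi).1 <| measure_mono_null
    (fun y (hy : ¬x < y) => not_lt.2 ((not_lt.1 hy).trans hx.le)) (ae_iff.1 (ae_pos_expMeasure r))

end Exponential

/-- The mixture of `μ` and `ν` with weights `w` and `1 - w`; it is only used for `0 ≤ w ≤ 1`. With
`μ` and `ν` Dirac masses it is a Bernoulli law, with `μ = δ₀` and `ν` exponential it is the law of
the stationary workload of an `M/M/1` queue. -/
def mixture {α : Type*} [MeasurableSpace α] (w : ℝ) (μ ν : Measure α) : Measure α :=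
  ENNReal.ofReal w • μ + ENNReal.ofReal (1 - w) • ν

section Mixture

variable {α β : Type*} [MeasurableSpace α] [MeasurableSpace β] {w : ℝ} {μ ν : Measure α}

lemma isProbabilityMeasure_mixture [IsProbabilityMeasure μ] [IsProbabilityMeasure ν] (hw₀ : 0 ≤ w)
    (hw₁ : w ≤ 1) : IsProbabilityMeasure (mixture w μ ν) := by
  constructor
  simp only [mixture, Measure.add_apply, Measure.smul_apply, measure_univ, smul_eq_mul, mul_one]
  rw [← ENNReal.ofReal_add hw₀ (sub_nonneg.2 hw₁), add_sub_cancel, ENNReal.ofReal_one]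

instance [IsFiniteMeasure μ] [IsFiniteMeasure ν] : IsFiniteMeasure (mixture w μ ν) where
  measure_univ_lt_top := by
    simp only [mixture, Measure.add_apply, Measure.smul_apply, smul_eq_mul, ENNReal.add_lt_top]
    exact ⟨ENNReal.mul_lt_top ENNReal.ofReal_lt_top (measure_lt_top μ _),
      ENNReal.mul_lt_top ENNReal.ofReal_lt_top (measure_lt_top ν _)⟩

lemma mixture_comm (w : ℝ) (μ ν : Measure α) : mixture w μ ν = mixture (1 - w) ν μ := by
  rw [mixture, mixture, sub_sub_cancel, add_comm]

lemma mixture_mixture_left {v : ℝ} (hv₀ : 0 ≤ v) (hw₀ : 0 ≤ w) (hw₁ : w ≤ 1) :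
    mixture w μ (mixture v μ ν) = mixture (1 - (1 - w) * (1 - v)) μ ν := by
  have hw : 0 ≤ 1 - w := sub_nonneg.2 hw₁
  rw [mixture, mixture, mixture, smul_add, ← add_assoc, smul_smul, smul_smul, ← add_smul,
    ← ENNReal.ofReal_mul hw, ← ENNReal.ofReal_mul hw,
    ← ENNReal.ofReal_add hw₀ (mul_nonneg hw hv₀), sub_sub_cancel]
  congr 3
  ring

lemma mixture_apply (w : ℝ) (μ ν : Measure α) (s : Set α) :
    mixture w μ ν s = ENNReal.ofReal w * μ s + ENNReal.ofReal (1 - w) * ν s := rfl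

lemma map_mixture {f : α → β} (hf : Measurable f) :
    (mixture w μ ν).map f = mixture w (μ.map f) (ν.map f) := by
  rw [mixture, Measure.map_add _ _ hf, Measure.map_smul, Measure.map_smul, mixture]

lemma mixture_prod [SFinite μ] [SFinite ν] (κ : Measure β) [SFinite κ] :
    (mixture w μ ν).prod κ = mixture w (μ.prod κ) (ν.prod κ) := by
  rw [mixture, Measure.add_prod, Measure.prod_smul_left, Measure.prod_smul_left, mixture]

lemma ae_mixture {p : α → Prop} (hμ : ∀ᵐ x ∂μ, p x) (hν : ∀ᵐ x ∂ν, p x) :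
    ∀ᵐ x ∂mixture w μ ν, p x :=
  ae_add_measure_iff.2 ⟨Measure.ae_smul_measure hμ _, Measure.ae_smul_measure hν _⟩

lemma lintegral_mixture (w : ℝ) (μ ν : Measure α) (f : α → ℝ≥0∞) :
    ∫⁻ x, f x ∂mixture w μ ν
      = ENNReal.ofReal w * ∫⁻ x, f x ∂μ + ENNReal.ofReal (1 - w) * ∫⁻ x, f x ∂ν := by
  rw [mixture, lintegral_add_measure, lintegral_smul_measure, lintegral_smul_measure, smul_eq_mul,
    smul_eq_mul]

variable {E : Type*} [NormedAddCommGroup E] {f : α → E}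

lemma integrable_mixture (hμ : Integrable f μ) (hν : Integrable f ν) :
    Integrable f (mixture w μ ν) :=
  (hμ.smul_measure ENNReal.ofReal_ne_top).add_measure (hν.smul_measure ENNReal.ofReal_ne_top)

lemma integral_mixture [NormedSpace ℝ E] (hw₀ : 0 ≤ w) (hw₁ : w ≤ 1) (hμ : Integrable f μ)
    (hν : Integrable f ν) :
    ∫ x, f x ∂mixture w μ ν = w • ∫ x, f x ∂μ + (1 - w) • ∫ x, f x ∂ν := by
  rw [mixture, integral_add_measure (hμ.smul_measure ENNReal.ofReal_ne_top)
    (hν.smul_measure ENNReal.ofReal_ne_top), integral_smul_measure, integral_smul_measure,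
    ENNReal.toReal_ofReal hw₀, ENNReal.toReal_ofReal (sub_nonneg.2 hw₁)]

lemma charFun_mixture {μ ν : Measure ℝ} [IsFiniteMeasure μ] [IsFiniteMeasure ν] (hw₀ : 0 ≤ w)
    (hw₁ : w ≤ 1) (t : ℝ) :
    charFun (mixture w μ ν) t = w * charFun μ t + (1 - w) * charFun ν t := by
  have hint (κ : Measure ℝ) [IsFiniteMeasure κ] :
      Integrable (fun x : ℝ => Complex.exp (t * x * Complex.I)) κ :=
    Integrable.of_bound (by fun_prop) 1 (ae_of_all _ fun x => by
      rw [← Complex.ofReal_mul, Complex.norm_exp_ofReal_mul_I])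
  simp_rw [charFun_apply_real, integral_mixture hw₀ hw₁ (hint μ) (hint ν), Complex.real_smul]
  push_cast
  rfl

end Mixture

/-- The law of `max (V - A) 0` for independent `V` and `A` with laws `ν` and `κ`: the workload that
an arrival finds, if the preceding arrival left the workload `V` and came a time `A` earlier. -/
def workloadFound (ν κ : Measure ℝ) : Measure ℝ :=
  (ν.prod κ).map fun z => max (z.1 - z.2) 0

lemma workloadFound_expMeasure {r : ℝ} (hr : 0 < r) {κ : Measure ℝ} [IsProbabilityMeasure κ]
    (hκ : ∀ᵐ a ∂κ, 0 ≤ a) :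
    workloadFound (expMeasure r) κ
      = mixture (1 - ∫ a, Real.exp (-r * a) ∂κ) (Measure.dirac 0) (expMeasure r) := by
  have := isProbabilityMeasure_expMeasure hr
  have hmax : Measurable fun z : ℝ × ℝ => max (z.1 - z.2) 0 := by fun_prop
  have hle : ∀ᵐ a ∂κ, ‖Real.exp (-r * a)‖ ≤ 1 := by
    filter_upwards [hκ] with a ha
    rw [Real.norm_of_nonneg (Real.exp_pos _).le, Real.exp_le_one_iff]
    nlinarith
  have hint : Integrable (fun a => Real.exp (-r * a)) κ := Integrable.of_bound (by fun_prop) 1 hle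
  have hw₀ : 0 ≤ ∫ a, Real.exp (-r * a) ∂κ := integral_nonneg fun a => (Real.exp_pos _).le
  have hw₁ : ∫ a, Real.exp (-r * a) ∂κ ≤ 1 :=
    (le_abs_self _).trans ((norm_integral_le_of_norm_le_const hle).trans_eq (by simp))
  have := isProbabilityMeasure_mixture (μ := Measure.dirac (0 : ℝ)) (ν := expMeasure r)
    (sub_nonneg.2 hw₁) (sub_le_self 1 hw₀)
  have : IsProbabilityMeasure (workloadFound (expMeasure r) κ) :=
    Measure.isProbabilityMeasure_map hmax.aemeasurable
  refine measure_ext_of_Ioi fun x => ?_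
  rw [workloadFound, Measure.map_apply hmax measurableSet_Ioi, mixture_apply,
    Measure.dirac_apply' _ measurableSet_Ioi, sub_sub_cancel]
  rcases lt_or_ge x 0 with hx | hx
  · have hpre : (fun z : ℝ × ℝ => max (z.1 - z.2) 0) ⁻¹' Set.Ioi x = Set.univ := by
      ext z; simp [hx]
    rw [hpre, measure_univ, expMeasure_Ioi_of_neg hr hx, Set.indicator_of_mem (by simpa using hx),
      Pi.one_apply, mul_one, mul_one, ← ENNReal.ofReal_add (sub_nonneg.2 hw₁) hw₀, sub_add_cancel,
      ENNReal.ofReal_one]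
  · have hsection : ∀ᵐ a ∂κ,
        expMeasure r ((fun v => (v, a)) ⁻¹' ((fun z : ℝ × ℝ => max (z.1 - z.2) 0) ⁻¹' Set.Ioi x))
          = ENNReal.ofReal (Real.exp (-r * a) * Real.exp (-(r * x))) := by
      filter_upwards [hκ] with a ha
      have hpre : (fun v => (v, a)) ⁻¹' ((fun z : ℝ × ℝ => max (z.1 - z.2) 0) ⁻¹' Set.Ioi x)
          = Set.Ioi (a + x) := by
        ext v; simp [not_lt.2 hx, lt_sub_iff_add_lt']
      rw [hpre, expMeasure_Ioi hr (by positivity), ← Real.exp_add]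
      ring_nf
    rw [Measure.prod_apply_symm (hmax measurableSet_Ioi), lintegral_congr_ae hsection,
      ← ofReal_integral_eq_lintegral_ofReal (hint.mul_const _)
        (ae_of_all _ fun a => by positivity), integral_mul_const, expMeasure_Ioi hr hx,
      Set.indicator_of_notMem (by simpa using hx), mul_zero, zero_add, ENNReal.ofReal_mul hw₀]

lemma workloadFound_dirac_zero {κ : Measure ℝ} [IsProbabilityMeasure κ] (hκ : ∀ᵐ a ∂κ, 0 ≤ a) :
    workloadFound (Measure.dirac 0) κ = Measure.dirac 0 := by
  rw [workloadFound, Measure.dirac_prod, Measure.map_map (by fun_prop) (by fun_prop),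
    Measure.map_congr (g := fun _ => (0 : ℝ))]
  · simp
  · filter_upwards [hκ] with a ha
    simp [ha]

lemma workloadFound_mixture_expMeasure {w r s : ℝ} (hw₀ : 0 ≤ w) (hw₁ : w ≤ 1) (hr : 0 < r)
    (hs : 0 < s) :
    workloadFound (mixture w (Measure.dirac 0) (expMeasure r)) (expMeasure s)
      = mixture (1 - (1 - w) * (s / (s + r))) (Measure.dirac 0) (expMeasure r) := by
  have := isProbabilityMeasure_expMeasure hr
  have := isProbabilityMeasure_expMeasure hs
  have hpos : ∀ᵐ a ∂expMeasure s, 0 ≤ a := (ae_pos_expMeasure s).mono fun _ => le_of_lt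
  have hle : s / (s + r) ≤ 1 := (div_le_one (by positivity)).2 (by linarith)
  have hfound := workloadFound_expMeasure hr hpos
  rw [integral_exp_mul_expMeasure hs (by linarith), sub_neg_eq_add] at hfound
  calc workloadFound (mixture w (Measure.dirac 0) (expMeasure r)) (expMeasure s)
      = mixture w (workloadFound (Measure.dirac 0) (expMeasure s))
          (workloadFound (expMeasure r) (expMeasure s)) := by
        rw [workloadFound, mixture_prod, map_mixture (by fun_prop)]; rfl
    _ = mixture w (Measure.dirac 0)
          (mixture (1 - s / (s + r)) (Measure.dirac 0) (expMeasure r)) := by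
        rw [workloadFound_dirac_zero hpos, hfound]
    _ = mixture (1 - (1 - w) * (s / (s + r))) (Measure.dirac 0) (expMeasure r) := by
        rw [mixture_mixture_left (sub_nonneg.2 hle) hw₀ hw₁,
          sub_sub_cancel]

lemma mixture_dirac_zero_conv_expMeasure {r s : ℝ} (hr : 0 < r) (hrs : r ≤ s) :
    mixture (r / s) (Measure.dirac 0) (expMeasure r) ∗ expMeasure s = expMeasure r := by
  have hs : 0 < s := hr.trans_le hrs
  have := isProbabilityMeasure_expMeasure hr
  have := isProbabilityMeasure_expMeasure hs
  have hne (a : ℝ) (ha : 0 < a) (t : ℝ) : (a : ℂ) - t * Complex.I ≠ 0 := fun h =>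
    ha.ne' (by simpa using congrArg Complex.re h)
  refine Measure.ext_of_charFun (funext fun t => ?_)
  rw [charFun_conv, charFun_mixture (by positivity) ((div_le_one hs).2 hrs), charFun_expMeasure hs,
    charFun_expMeasure hr, charFun_dirac]
  have hr' := hne r hr t
  have hs' := hne s hs t
  have hs₀ : (s : ℂ) ≠ 0 := by exact_mod_cast hs.ne'
  push_cast
  simp only [inner_zero_left, Complex.ofReal_zero, zero_mul, Complex.exp_zero, mul_one]
  field_simp
  ring

section Hyperexponential

variable {Θ : Type*} [Fintype Θ] {w r : Θ → ℝ}

lemma isProbabilityMeasure_hyperexpMeasure (hw : ∀ θ, 0 ≤ w θ) (hw_sum : ∑ θ, w θ = 1)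
    (hr : ∀ θ, 0 < r θ) : IsProbabilityMeasure (hyperexpMeasure w r) := by
  have := fun θ => isProbabilityMeasure_expMeasure (hr θ)
  constructor
  simp only [hyperexpMeasure, Measure.coe_finsetSum, Finset.sum_apply, Measure.smul_apply,
    measure_univ, smul_eq_mul, mul_one]
  rw [← ENNReal.ofReal_sum_of_nonneg fun θ _ => hw θ, hw_sum, ENNReal.ofReal_one]

lemma integrable_hyperexpMeasure {f : ℝ → ℝ} (hf : ∀ θ, Integrable f (expMeasure (r θ))) :
    Integrable f (hyperexpMeasure w r) :=
  integrable_finsetSum_measure.2 fun θ _ => (hf θ).smul_measure ENNReal.ofReal_ne_top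

lemma integral_hyperexpMeasure (hw : ∀ θ, 0 ≤ w θ) {f : ℝ → ℝ}
    (hf : ∀ θ, Integrable f (expMeasure (r θ))) :
    ∫ x, f x ∂hyperexpMeasure w r = ∑ θ, w θ * ∫ x, f x ∂expMeasure (r θ) := by
  rw [hyperexpMeasure,
    integral_finsetSum_measure fun θ _ => (hf θ).smul_measure ENNReal.ofReal_ne_top]
  simp only [integral_smul_measure, ENNReal.toReal_ofReal (hw _), smul_eq_mul]

end Hyperexponential

/-! ### Contracting Markov recursions -/

section Contraction

variable {S E : Type*} [MeasurableSpace S] [MeasurableSpace E] {κ : Measure E}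
  [IsProbabilityMeasure κ] {Ψ : S × E → S} {A : Set S} {f g : S → ℝ} {w : E → ℝ} {B C : ℝ}

lemma integral_map_prod_of_abs_le (μ : Measure S) [IsFiniteMeasure μ] (hΨ : Measurable Ψ)
    (hf : Measurable f) (hB : ∀ x, |f x| ≤ B) :
    ∫ x, f x ∂(μ.prod κ).map Ψ = ∫ x, ∫ e, f (Ψ (x, e)) ∂κ ∂μ := by
  rw [integral_map hΨ.aemeasurable hf.aestronglyMeasurable, integral_prod]
  exact integrable_of_abs_le (hf.comp hΨ) fun z => hB _

lemma abs_integral_step_sub_le (hΨ : Measurable Ψ) (hw : Integrable w κ)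
    (hmem : ∀ᵐ e ∂κ, ∀ x ∈ A, Ψ (x, e) ∈ A)
    (hcontr : ∀ᵐ e ∂κ, ∀ x ∈ A, ∀ y ∈ A, |g (Ψ (x, e)) - g (Ψ (y, e))| ≤ w e * |g x - g y|)
    (hf : Measurable f) (hB : ∀ x, |f x| ≤ B) (hC : 0 ≤ C)
    (hfg : ∀ x ∈ A, ∀ y ∈ A, |f x - f y| ≤ C * |g x - g y|) {x y : S} (hx : x ∈ A) (hy : y ∈ A) :
    |∫ e, f (Ψ (x, e)) ∂κ - ∫ e, f (Ψ (y, e)) ∂κ| ≤ (C * ∫ e, w e ∂κ) * |g x - g y| := by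
  have hsection (x : S) : Integrable (fun e => f (Ψ (x, e))) κ :=
    integrable_of_abs_le (hf.comp (hΨ.comp measurable_prodMk_left)) fun _ => hB _
  rw [← integral_sub (hsection x) (hsection y), mul_assoc, ← integral_mul_const,
    ← integral_const_mul]
  refine abs_integral_le_integral_abs.trans (integral_mono_ae
    ((hsection x).sub (hsection y)).abs ((hw.mul_const _).const_mul C) ?_)
  filter_upwards [hmem, hcontr] with e hmem hcontr
  calc |f (Ψ (x, e)) - f (Ψ (y, e))|
      ≤ C * |g (Ψ (x, e)) - g (Ψ (y, e))| := hfg _ (hmem x hx) _ (hmem y hy)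
    _ ≤ C * (w e * |g x - g y|) := mul_le_mul_of_nonneg_left (hcontr x hx y hy) hC

lemma abs_integral_iterate_sub_le (hΨ : Measurable Ψ) (hw : Integrable w κ) (hw₀ : 0 ≤ᵐ[κ] w)
    (hmem : ∀ᵐ e ∂κ, ∀ x ∈ A, Ψ (x, e) ∈ A)
    (hcontr : ∀ᵐ e ∂κ, ∀ x ∈ A, ∀ y ∈ A, |g (Ψ (x, e)) - g (Ψ (y, e))| ≤ w e * |g x - g y|)
    {ν : ℕ → Measure S} [∀ n, IsProbabilityMeasure (ν n)] {x₀ : S} (hx₀ : x₀ ∈ A)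
    (hν₀ : ν 0 = Measure.dirac x₀) (hν : ∀ n, ν (n + 1) = ((ν n).prod κ).map Ψ)
    {π : Measure S} [IsProbabilityMeasure π] (hπA : ∀ᵐ x ∂π, x ∈ A) (hgπ : Integrable g π)
    (hπ : (π.prod κ).map Ψ = π) (n : ℕ) (hf : Measurable f) (hB : ∀ x, |f x| ≤ B) (hC : 0 ≤ C)
    (hfg : ∀ x ∈ A, ∀ y ∈ A, |f x - f y| ≤ C * |g x - g y|) :
    |∫ x, f x ∂ν n - ∫ x, f x ∂π| ≤ C * (∫ e, w e ∂κ) ^ n * ∫ x, |g x₀ - g x| ∂π := by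
  induction n generalizing f C with
  | zero =>
    have hfint : Integrable f π := integrable_of_abs_le hf hB
    have hdiff : f x₀ - ∫ x, f x ∂π = ∫ x, (f x₀ - f x) ∂π := by
      rw [integral_sub (integrable_const _) hfint, integral_const, probReal_univ, one_smul]
    rw [hν₀, integral_dirac' _ _ hf.stronglyMeasurable, pow_zero, mul_one, ← integral_const_mul,
      hdiff]
    refine abs_integral_le_integral_abs.trans (integral_mono_ae
      ((integrable_const _).sub hfint).abs (((integrable_const _).sub hgπ).abs.const_mul C) ?_)
    filter_upwards [hπA] with x hx using hfg x₀ hx₀ x hx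
  | succ n ih =>
    have hsmooth_le (x : S) : |∫ e, f (Ψ (x, e)) ∂κ| ≤ B := by
      simpa using norm_integral_le_of_norm_le_const (μ := κ) (C := B)
        (f := fun e => f (Ψ (x, e))) (ae_of_all κ fun e => hB (Ψ (x, e)))
    have hbound := ih (f := fun x => ∫ e, f (Ψ (x, e)) ∂κ) (C := C * ∫ e, w e ∂κ)
      (hf.comp hΨ).stronglyMeasurable.integral_prod_right'.measurable hsmooth_le
      (mul_nonneg hC (integral_nonneg_of_ae hw₀))
      fun x hx y hy => abs_integral_step_sub_le hΨ hw hmem hcontr hf hB hC hfg hx hy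
    rw [← integral_map_prod_of_abs_le (ν n) hΨ hf hB, ← integral_map_prod_of_abs_le π hΨ hf hB,
      ← hν, hπ] at hbound
    exact hbound.trans_eq (by ring)

lemma tendsto_integral_iterate (hΨ : Measurable Ψ) (hw : Integrable w κ) (hw₀ : 0 ≤ᵐ[κ] w)
    (hw₁ : ∫ e, w e ∂κ < 1) (hmem : ∀ᵐ e ∂κ, ∀ x ∈ A, Ψ (x, e) ∈ A)
    (hcontr : ∀ᵐ e ∂κ, ∀ x ∈ A, ∀ y ∈ A, |g (Ψ (x, e)) - g (Ψ (y, e))| ≤ w e * |g x - g y|)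
    {ν : ℕ → Measure S} [∀ n, IsProbabilityMeasure (ν n)] {x₀ : S} (hx₀ : x₀ ∈ A)
    (hν₀ : ν 0 = Measure.dirac x₀) (hν : ∀ n, ν (n + 1) = ((ν n).prod κ).map Ψ)
    {π : Measure S} [IsProbabilityMeasure π] (hπA : ∀ᵐ x ∂π, x ∈ A) (hgπ : Integrable g π)
    (hπ : (π.prod κ).map Ψ = π) (hf : Measurable f) (hB : ∀ x, |f x| ≤ B) (hC : 0 ≤ C)
    (hfg : ∀ x ∈ A, ∀ y ∈ A, |f x - f y| ≤ C * |g x - g y|) :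
    Tendsto (fun n => ∫ x, f x ∂ν n) atTop (𝓝 (∫ x, f x ∂π)) := by
  rw [tendsto_iff_dist_tendsto_zero]
  refine squeeze_zero (fun n => dist_nonneg) (fun n => abs_integral_iterate_sub_le hΨ hw hw₀ hmem
    hcontr hx₀ hν₀ hν hπA hgπ hπ n hf hB hC hfg) ?_
  simpa using ((tendsto_pow_atTop_nhds_zero_of_lt_one (integral_nonneg_of_ae hw₀)
    hw₁).const_mul C).mul_const (∫ x, |g x₀ - g x| ∂π)

end Contraction

/-! ### The workload recursion -/

/-- The law of the time since the last arrival at the server, of the mark telling whether the next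
request joins the queue under consideration, and of its service time. -/
def slotMeasure (L q m : ℝ) : Measure (ℝ × Bool × ℝ) :=
  (expMeasure L).prod ((mixture q (Measure.dirac true) (Measure.dirac false)).prod (expMeasure m))

/-- The workload of a queue left behind by an arrival at the server, given the workload left
behind by the preceding one and the slot (elapsed time, mark, service time) of the arrival. -/
def workloadStep (z : ℝ × ℝ × Bool × ℝ) : ℝ :=
  max (z.1 - z.2.1) 0 + if z.2.2.1 then z.2.2.2 else 0

lemma measurableSet_mark : MeasurableSet {z : ℝ × ℝ × Bool × ℝ | z.2.2.1 = true} :=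
  (measurableSet_singleton true).preimage (by fun_prop)

@[fun_prop]
lemma measurable_workloadStep : Measurable workloadStep :=
  .add (by fun_prop) (.ite measurableSet_mark (by fun_prop) measurable_const)

/-- The expectation of `f` at the workload left behind by an arrival that joins the queue, if the
preceding arrival at the server left the workload `x`. -/
def joinedExpectation (L m : ℝ) (f : ℝ → ℝ) (x : ℝ) : ℝ :=
  ∫ e : ℝ × ℝ, f (max (x - e.1) 0 + e.2) ∂(expMeasure L).prod (expMeasure m)

lemma ae_slotMeasure_service_pos (L q : ℝ) {m : ℝ} (hm : 0 < m) :
    ∀ᵐ e ∂slotMeasure L q m, 0 < e.2.2 := by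
  have := isProbabilityMeasure_expMeasure hm
  exact (Measure.quasiMeasurePreserving_snd.comp Measure.quasiMeasurePreserving_snd).ae
    (ae_pos_expMeasure m)

lemma workloadStep_nonneg {x : ℝ} {e : ℝ × Bool × ℝ} (he : 0 < e.2.2) :
    0 ≤ workloadStep (x, e) := by
  rw [workloadStep]
  exact add_nonneg (le_max_right _ _) (by split_ifs <;> simp [he.le])

section Slot

variable {L q m : ℝ} (hL : 0 < L) (hm : 0 < m)
include hL hm

lemma isProbabilityMeasure_slotMeasure (hq₀ : 0 ≤ q) (hq₁ : q ≤ 1) :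
    IsProbabilityMeasure (slotMeasure L q m) := by
  have := isProbabilityMeasure_expMeasure hL
  have := isProbabilityMeasure_expMeasure hm
  have := isProbabilityMeasure_mixture (μ := Measure.dirac true) (ν := Measure.dirac false) hq₀ hq₁
  rw [slotMeasure]
  infer_instance

lemma map_mark_workloadStep (q : ℝ) (ν : Measure ℝ) [IsFiniteMeasure ν] :
    (ν.prod (slotMeasure L q m)).map (fun z => (z.2.2.1, workloadStep z))
      = mixture q ((workloadFound ν (expMeasure L) ∗ expMeasure m).map (Prod.mk true))
          ((workloadFound ν (expMeasure L)).map (Prod.mk false)) := by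
  have := isProbabilityMeasure_expMeasure hL
  have := isProbabilityMeasure_expMeasure hm
  have : IsFiniteMeasure (slotMeasure L q m) := by rw [slotMeasure]; infer_instance
  refine Measure.ext_of_lintegral _ fun f hf => ?_
  have hslice (x a : ℝ) : ∫⁻ y, f (y.1, workloadStep (x, a, y))
        ∂(mixture q (Measure.dirac true) (Measure.dirac false)).prod (expMeasure m)
      = ENNReal.ofReal q * ∫⁻ s, f (true, max (x - a) 0 + s) ∂expMeasure m
        + ENNReal.ofReal (1 - q) * f (false, max (x - a) 0) := by
    rw [lintegral_prod _ (by fun_prop), lintegral_mixture, lintegral_dirac, lintegral_dirac]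
    simp [workloadStep]
  have hfound : ∫⁻ z, f (z.2.2.1, workloadStep z) ∂ν.prod (slotMeasure L q m)
      = ∫⁻ v, ENNReal.ofReal q * (∫⁻ s, f (true, v + s) ∂expMeasure m)
        + ENNReal.ofReal (1 - q) * f (false, v) ∂workloadFound ν (expMeasure L) := by
    rw [workloadFound, lintegral_map (by fun_prop) (by fun_prop), lintegral_prod _ (by fun_prop),
      lintegral_prod _ (by fun_prop)]
    refine lintegral_congr fun x => ?_
    rw [slotMeasure, lintegral_prod _ (by fun_prop)]
    exact lintegral_congr fun a => hslice x a
  rw [lintegral_map hf (by fun_prop), hfound, lintegral_mixture, lintegral_map hf (by fun_prop),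
    lintegral_map hf (by fun_prop), Measure.lintegral_conv (by fun_prop),
    lintegral_add_right _ (by fun_prop), lintegral_const_mul' _ _ ENNReal.ofReal_ne_top,
    lintegral_const_mul' _ _ ENNReal.ofReal_ne_top]

lemma map_workloadStep (q : ℝ) (ν : Measure ℝ) [IsFiniteMeasure ν] :
    (ν.prod (slotMeasure L q m)).map workloadStep
      = mixture q (workloadFound ν (expMeasure L) ∗ expMeasure m)
          (workloadFound ν (expMeasure L)) := by
  have h := congrArg (Measure.map Prod.snd) (map_mark_workloadStep hL hm q ν)
  rw [map_mixture measurable_snd, Measure.map_map measurable_snd (by fun_prop),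
    Measure.map_map measurable_snd (by fun_prop), Measure.map_map measurable_snd (by fun_prop)] at h
  simpa only [Function.comp_def, Measure.map_id'] using h

lemma integral_workloadStep_of_mark (hq₀ : 0 ≤ q) (hq₁ : q ≤ 1) (ν : Measure ℝ)
    [IsFiniteMeasure ν] {f : ℝ → ℝ} (hf : Measurable f) {B : ℝ} (hB : ∀ x, |f x| ≤ B) :
    ∫ z, (if z.2.2.1 then f (workloadStep z) else 0) ∂ν.prod (slotMeasure L q m)
      = q * ∫ x, f x ∂(workloadFound ν (expMeasure L) ∗ expMeasure m) := by
  have := isProbabilityMeasure_expMeasure hL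
  have := isProbabilityMeasure_expMeasure hm
  have : IsFiniteMeasure (workloadFound ν (expMeasure L)) := by rw [workloadFound]; infer_instance
  have hF : Measurable fun y : Bool × ℝ => if y.1 then f y.2 else 0 :=
    .ite ((measurableSet_singleton true).preimage measurable_fst) (by fun_prop) measurable_const
  have hF_le (y : Bool × ℝ) : |if y.1 then f y.2 else 0| ≤ B := by
    split_ifs
    exacts [hB _, abs_zero.trans_le ((abs_nonneg _).trans (hB 0))]
  calc ∫ z, (if z.2.2.1 then f (workloadStep z) else 0) ∂ν.prod (slotMeasure L q m)
      = ∫ y, (if y.1 then f y.2 else 0)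
          ∂(ν.prod (slotMeasure L q m)).map fun z => (z.2.2.1, workloadStep z) := by
        rw [integral_map (by fun_prop) hF.aestronglyMeasurable]
    _ = q * ∫ x, f x ∂(workloadFound ν (expMeasure L) ∗ expMeasure m) := by
        rw [map_mark_workloadStep hL hm, integral_mixture hq₀ hq₁ (integrable_of_abs_le hF hF_le)
          (integrable_of_abs_le hF hF_le), integral_map (by fun_prop) hF.aestronglyMeasurable,
          integral_map (by fun_prop) hF.aestronglyMeasurable]
        simp

lemma integral_joinedExpectation (ν : Measure ℝ) [IsFiniteMeasure ν] {f : ℝ → ℝ}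
    (hf : Measurable f) {B : ℝ} (hB : ∀ x, |f x| ≤ B) :
    ∫ x, joinedExpectation L m f x ∂ν
      = ∫ x, f x ∂(workloadFound ν (expMeasure L) ∗ expMeasure m) := by
  have := isProbabilityMeasure_expMeasure hL
  have := isProbabilityMeasure_expMeasure hm
  have : IsFiniteMeasure (workloadFound ν (expMeasure L)) := by rw [workloadFound]; infer_instance
  have hint {α : Type} [MeasurableSpace α] (μ : Measure α) [IsFiniteMeasure μ] {φ : α → ℝ}
      (hφ : Measurable φ) : Integrable (fun a => f (φ a)) μ :=
    integrable_of_abs_le (hf.comp hφ) fun _ => hB _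
  have hsum : StronglyMeasurable fun v => ∫ s, f (v + s) ∂expMeasure m :=
    (hf.comp measurable_add).stronglyMeasurable.integral_prod_right'
  have hsum_le (v : ℝ) : |∫ s, f (v + s) ∂expMeasure m| ≤ B := by
    simpa using norm_integral_le_of_norm_le_const (μ := expMeasure m) (f := fun s => f (v + s))
      (ae_of_all _ fun s => hB (v + s))
  rw [integral_conv (f := f) (hint _ measurable_id), workloadFound,
    integral_map (by fun_prop) hsum.aestronglyMeasurable, integral_prod
      (fun z => ∫ s, f (max (z.1 - z.2) 0 + s) ∂expMeasure m)
      (integrable_of_abs_le (hsum.measurable.comp (by fun_prop)) fun _ => hsum_le _)]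
  refine integral_congr_ae (ae_of_all _ fun x => ?_)
  simp only [joinedExpectation]
  rw [integral_prod (fun e : ℝ × ℝ => f (max (x - e.1) 0 + e.2)) (hint _ (by fun_prop))]

lemma abs_joinedExpectation_le {f : ℝ → ℝ} {B : ℝ} (hB : ∀ x, |f x| ≤ B) (x : ℝ) :
    |joinedExpectation L m f x| ≤ B := by
  have := isProbabilityMeasure_expMeasure hL
  have := isProbabilityMeasure_expMeasure hm
  simpa [joinedExpectation] using norm_integral_le_of_norm_le_const
    (μ := (expMeasure L).prod (expMeasure m)) (f := fun e => f (max (x - e.1) 0 + e.2)) (C := B)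
    (ae_of_all _ fun e => hB _)

lemma lipschitzWith_joinedExpectation {f : ℝ → ℝ} {K : ℝ≥0} (hf : LipschitzWith K f) {B : ℝ}
    (hB : ∀ x, |f x| ≤ B) : LipschitzWith K (joinedExpectation L m f) := by
  have := isProbabilityMeasure_expMeasure hL
  have := isProbabilityMeasure_expMeasure hm
  have hint (x : ℝ) : Integrable (fun e : ℝ × ℝ => f (max (x - e.1) 0 + e.2))
      ((expMeasure L).prod (expMeasure m)) :=
    integrable_of_abs_le (hf.continuous.measurable.comp (by fun_prop)) fun _ => hB _
  refine LipschitzWith.of_dist_le_mul fun x y => ?_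
  have hpointwise (e : ℝ × ℝ) :
      ‖f (max (x - e.1) 0 + e.2) - f (max (y - e.1) 0 + e.2)‖ ≤ K * dist x y := by
    refine (hf.norm_sub_le _ _).trans (mul_le_mul_of_nonneg_left ?_ K.2)
    rw [add_sub_add_right_eq_sub, Real.dist_eq, ← sub_sub_sub_cancel_right x y e.1]
    exact abs_max_sub_max_le_abs _ _ _
  rw [dist_eq_norm, joinedExpectation, joinedExpectation, ← integral_sub (hint x) (hint y)]
  simpa using norm_integral_le_of_norm_le_const (μ := (expMeasure L).prod (expMeasure m))
    (ae_of_all _ hpointwise)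

end Slot

/-- The factor by which a slot contracts workloads on the scale `exp (α x)`. -/
def slotWeight (α : ℝ) (e : ℝ × Bool × ℝ) : ℝ :=
  Real.exp (-α * e.1) * if e.2.1 then Real.exp (α * e.2.2) else 1

lemma slotWeight_nonneg (α : ℝ) (e : ℝ × Bool × ℝ) : 0 ≤ slotWeight α e := by
  rw [slotWeight]
  split_ifs <;> positivity

lemma mul_abs_sub_le_abs_exp_sub {α x y : ℝ} (hα : 0 ≤ α) (hx : 0 ≤ x) (hy : 0 ≤ y) :
    α * |x - y| ≤ |Real.exp (α * x) - Real.exp (α * y)| := by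
  wlog hyx : y ≤ x generalizing x y
  · rw [abs_sub_comm x, abs_sub_comm (Real.exp _)]
    exact this hy hx (not_le.1 hyx).le
  have hsplit : Real.exp (α * x) = Real.exp (α * y) * Real.exp (α * (x - y)) := by
    rw [← Real.exp_add]; ring_nf
  have hstep := Real.add_one_le_exp (α * (x - y))
  have hone : 1 ≤ Real.exp (α * y) := Real.one_le_exp (by positivity)
  have hdiff : 0 ≤ α * (x - y) := mul_nonneg hα (sub_nonneg.2 hyx)
  rw [abs_of_nonneg (sub_nonneg.2 hyx)]
  refine le_trans ?_ (le_abs_self _)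
  rw [hsplit]
  nlinarith

lemma abs_exp_workloadStep_sub_le {α : ℝ} (hα : 0 ≤ α) (x y : ℝ) (e : ℝ × Bool × ℝ) :
    |Real.exp (α * workloadStep (x, e)) - Real.exp (α * workloadStep (y, e))|
      ≤ slotWeight α e * |Real.exp (α * x) - Real.exp (α * y)| := by
  obtain ⟨a, mark, s⟩ := e
  have hexp_max (t : ℝ) : Real.exp (α * max t 0) = max (Real.exp (α * t)) 1 := by
    rw [mul_max_of_nonneg _ _ hα, mul_zero, Real.exp_monotone.map_max, Real.exp_zero]
  have hfound : |Real.exp (α * max (x - a) 0) - Real.exp (α * max (y - a) 0)|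
      ≤ Real.exp (-α * a) * |Real.exp (α * x) - Real.exp (α * y)| := by
    rw [hexp_max, hexp_max]
    refine (abs_max_sub_max_le_abs _ _ _).trans_eq ?_
    have hshift (t : ℝ) : Real.exp (α * (t - a)) = Real.exp (-α * a) * Real.exp (α * t) := by
      rw [← Real.exp_add]; ring_nf
    rw [hshift, hshift, ← mul_sub, abs_mul, abs_of_pos (Real.exp_pos _)]
  cases mark with
  | false => simpa [workloadStep, slotWeight] using hfound
  | true =>
    simp only [workloadStep, slotWeight, if_true]
    rw [mul_add, mul_add, Real.exp_add, Real.exp_add, ← sub_mul, abs_mul,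
      abs_of_pos (Real.exp_pos (α * s)), mul_right_comm]
    exact mul_le_mul_of_nonneg_right hfound (Real.exp_pos _).le

section MarkWeight

variable {η : Measure ℝ} [IsProbabilityMeasure η] {g : ℝ → ℝ} (hg : Integrable g η)
include hg

lemma integrable_ite_mark_prod (mark : Bool) :
    Integrable (fun e : Bool × ℝ => if e.1 then g e.2 else 1) ((Measure.dirac mark).prod η) := by
  rw [Measure.dirac_prod, (measurableEmbedding_prodMk_left mark).integrable_map_iff]
  cases mark
  exacts [by simp [Function.comp_def], by simpa [Function.comp_def] using hg]

lemma integrable_ite_mark (q : ℝ) : Integrable (fun e : Bool × ℝ => if e.1 then g e.2 else 1)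
    ((mixture q (Measure.dirac true) (Measure.dirac false)).prod η) := by
  rw [mixture_prod]
  exact integrable_mixture (integrable_ite_mark_prod hg _) (integrable_ite_mark_prod hg _)

lemma integral_ite_mark {q : ℝ} (hq₀ : 0 ≤ q) (hq₁ : q ≤ 1) :
    ∫ e, (if e.1 then g e.2 else 1)
        ∂(mixture q (Measure.dirac true) (Measure.dirac false)).prod η
      = q * ∫ x, g x ∂η + (1 - q) := by
  rw [mixture_prod, integral_mixture hq₀ hq₁ (integrable_ite_mark_prod hg _)
    (integrable_ite_mark_prod hg _), Measure.dirac_prod, Measure.dirac_prod,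
    (measurableEmbedding_prodMk_left true).integral_map,
    (measurableEmbedding_prodMk_left false).integral_map]
  simp

end MarkWeight

section SlotWeight

variable {L q m α : ℝ} (hL : 0 < L) (hm : 0 < m) (hα : 0 < α) (hαm : α < m)
include hL hm hα hαm

lemma integrable_slotWeight (q : ℝ) : Integrable (slotWeight α) (slotMeasure L q m) := by
  have := isProbabilityMeasure_expMeasure hL
  have := isProbabilityMeasure_expMeasure hm
  exact (integrable_exp_mul_expMeasure hL (by linarith)).mul_prod
    (integrable_ite_mark (integrable_exp_mul_expMeasure hm hαm) q)

lemma integral_slotWeight (hq₀ : 0 ≤ q) (hq₁ : q ≤ 1) :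
    ∫ e, slotWeight α e ∂slotMeasure L q m = L / (L + α) * (q * (m / (m - α)) + (1 - q)) := by
  have := isProbabilityMeasure_expMeasure hL
  have := isProbabilityMeasure_expMeasure hm
  have h := integral_prod_mul (μ := expMeasure L)
    (ν := (mixture q (Measure.dirac true) (Measure.dirac false)).prod (expMeasure m))
    (fun a => Real.exp (-α * a)) fun e => if e.1 then Real.exp (α * e.2) else 1
  rwa [integral_exp_mul_expMeasure hL (by linarith), sub_neg_eq_add,
    integral_ite_mark (integrable_exp_mul_expMeasure hm hαm) hq₀ hq₁,
    integral_exp_mul_expMeasure hm hαm] at h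

lemma integral_slotWeight_lt_one (hq₀ : 0 ≤ q) (hq₁ : q ≤ 1) (hstab : α < m - q * L) :
    ∫ e, slotWeight α e ∂slotMeasure L q m < 1 := by
  have hmα : 0 < m - α := sub_pos.2 hαm
  have hmean : q * (m / (m - α)) + (1 - q) = 1 + q * α / (m - α) := by field_simp; ring
  rw [integral_slotWeight hL hm hα hαm hq₀ hq₁, hmean, div_mul_eq_mul_div,
    div_lt_one (by positivity), mul_add, mul_one, add_lt_add_iff_left, mul_div_assoc',
    div_lt_iff₀ hmα]
  nlinarith

end SlotWeight

/-- The stationary law of the workload left behind by an arrival at a server with total arrival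
rate `L`, each arrival joining the queue under consideration with probability `q`, and service
rate `m`. -/
def stationaryWorkload (L q m : ℝ) : Measure ℝ :=
  mixture ((1 - q) * ((m - q * L) / m)) (Measure.dirac 0) (expMeasure (m - q * L))

lemma ae_nonneg_stationaryWorkload (L q m : ℝ) : ∀ᵐ x ∂stationaryWorkload L q m, 0 ≤ x :=
  ae_mixture ((ae_dirac_iff measurableSet_Ici).2 le_rfl)
    ((ae_pos_expMeasure _).mono fun _ => le_of_lt)

lemma stationary_idle_prob_mem {L q m : ℝ} (hL : 0 < L) (hq₀ : 0 ≤ q) (hm : 0 < m)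
    (hstab : q * L < m) : (m - q * L) / m ∈ Set.Icc (0 : ℝ) 1 :=
  ⟨div_nonneg (sub_nonneg.2 hstab.le) hm.le, (div_le_one hm).2 (by nlinarith)⟩

section Stationary

variable {L q m : ℝ} (hL : 0 < L) (hq₀ : 0 ≤ q) (hq₁ : q ≤ 1) (hm : 0 < m) (hstab : q * L < m)
include hL hq₀ hq₁ hm hstab

lemma stationaryWorkload_weight_mem : (1 - q) * ((m - q * L) / m) ∈ Set.Icc (0 : ℝ) 1 := by
  obtain ⟨hρ₀, hρ₁⟩ := stationary_idle_prob_mem hL hq₀ hm hstab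
  exact ⟨mul_nonneg (sub_nonneg.2 hq₁) hρ₀, by nlinarith⟩

lemma isProbabilityMeasure_stationaryWorkload :
    IsProbabilityMeasure (stationaryWorkload L q m) := by
  have := isProbabilityMeasure_expMeasure (sub_pos.2 hstab)
  obtain ⟨hw₀, hw₁⟩ := stationaryWorkload_weight_mem hL hq₀ hq₁ hm hstab
  exact isProbabilityMeasure_mixture hw₀ hw₁

lemma workloadFound_stationaryWorkload :
    workloadFound (stationaryWorkload L q m) (expMeasure L)
      = mixture ((m - q * L) / m) (Measure.dirac 0) (expMeasure (m - q * L)) := by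
  obtain ⟨hw₀, hw₁⟩ := stationaryWorkload_weight_mem hL hq₀ hq₁ hm hstab
  have hη := sub_pos.2 hstab
  rw [stationaryWorkload, workloadFound_mixture_expMeasure hw₀ hw₁ hη hL]
  congr 1
  have : L + (m - q * L) ≠ 0 := by positivity
  field_simp
  ring

lemma workloadFound_stationaryWorkload_conv :
    workloadFound (stationaryWorkload L q m) (expMeasure L) ∗ expMeasure m
      = expMeasure (m - q * L) := by
  rw [workloadFound_stationaryWorkload hL hq₀ hq₁ hm hstab,
    mixture_dirac_zero_conv_expMeasure (sub_pos.2 hstab) (by nlinarith)]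

lemma map_workloadStep_stationaryWorkload :
    ((stationaryWorkload L q m).prod (slotMeasure L q m)).map workloadStep
      = stationaryWorkload L q m := by
  have := isProbabilityMeasure_stationaryWorkload hL hq₀ hq₁ hm hstab
  obtain ⟨-, hρ₁⟩ := stationary_idle_prob_mem hL hq₀ hm hstab
  rw [map_workloadStep hL hm, workloadFound_stationaryWorkload_conv hL hq₀ hq₁ hm hstab,
    workloadFound_stationaryWorkload hL hq₀ hq₁ hm hstab, mixture_comm ((m - q * L) / m),
    mixture_mixture_left (sub_nonneg.2 hρ₁) hq₀ hq₁, mixture_comm, sub_sub_cancel, sub_sub_cancel,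
    stationaryWorkload]

lemma tendsto_integral_workload {ν : ℕ → Measure ℝ} [∀ n, IsProbabilityMeasure (ν n)]
    (hν₀ : ν 0 = Measure.dirac 0)
    (hν : ∀ n, ν (n + 1) = ((ν n).prod (slotMeasure L q m)).map workloadStep)
    {h : ℝ → ℝ} {K : ℝ≥0} (hh : LipschitzWith K h) {B : ℝ} (hB : ∀ x, |h x| ≤ B) :
    Tendsto (fun n => ∫ x, h x ∂ν n) atTop (𝓝 (∫ x, h x ∂stationaryWorkload L q m)) := by
  have := isProbabilityMeasure_slotMeasure hL hm hq₀ hq₁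
  have := isProbabilityMeasure_stationaryWorkload hL hq₀ hq₁ hm hstab
  obtain ⟨α, hα, hα_lt⟩ := exists_between (sub_pos.2 hstab)
  have hαm : α < m := by nlinarith
  have hpos := ae_slotMeasure_service_pos L q hm
  refine tendsto_integral_iterate (A := Set.Ici 0) (g := fun x => Real.exp (α * x)) (C := K / α)
    measurable_workloadStep (integrable_slotWeight hL hm hα hαm q)
    (ae_of_all _ (slotWeight_nonneg α)) (integral_slotWeight_lt_one hL hm hα hαm hq₀ hq₁ hα_lt)
    (hpos.mono fun e he x _ => workloadStep_nonneg he)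
    (ae_of_all _ fun e x _ y _ => abs_exp_workloadStep_sub_le hα.le x y e) Set.self_mem_Ici hν₀ hν
    (ae_nonneg_stationaryWorkload L q m)
    (integrable_mixture (integrable_dirac (by simp))
      (integrable_exp_mul_expMeasure (sub_pos.2 hstab) hα_lt))
    (map_workloadStep_stationaryWorkload hL hq₀ hq₁ hm hstab) hh.continuous.measurable hB
    (by positivity) fun x hx y hy => ?_
  calc |h x - h y| ≤ K * |x - y| := hh.norm_sub_le x y
    _ = K / α * (α * |x - y|) := by field_simp
    _ ≤ K / α * |Real.exp (α * x) - Real.exp (α * y)| :=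
        mul_le_mul_of_nonneg_left (mul_abs_sub_le_abs_exp_sub hα.le hx hy) (by positivity)

lemma tendsto_integral_workload_of_mark {ν : ℕ → Measure ℝ} [∀ n, IsProbabilityMeasure (ν n)]
    (hν₀ : ν 0 = Measure.dirac 0)
    (hν : ∀ n, ν (n + 1) = ((ν n).prod (slotMeasure L q m)).map workloadStep)
    {f : ℝ → ℝ} {K : ℝ≥0} (hf : LipschitzWith K f) {B : ℝ} (hB : ∀ x, |f x| ≤ B) :
    Tendsto (fun n => ∫ z, (if z.2.2.1 then f (workloadStep z) else 0)
        ∂(ν n).prod (slotMeasure L q m)) atTop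
      (𝓝 (q * ∫ x, f x ∂expMeasure (m - q * L))) := by
  have := isProbabilityMeasure_stationaryWorkload hL hq₀ hq₁ hm hstab
  have hfm := hf.continuous.measurable
  simp_rw [integral_workloadStep_of_mark hL hm hq₀ hq₁ _ hfm hB,
    ← workloadFound_stationaryWorkload_conv hL hq₀ hq₁ hm hstab,
    ← integral_joinedExpectation hL hm _ hfm hB]
  exact (tendsto_integral_workload hL hq₀ hq₁ hm hstab hν₀ hν
    (lipschitzWith_joinedExpectation hL hm hf hB) (abs_joinedExpectation_le hL hm hB)).const_mul q

end Stationary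

section Grouping

variable {Ω ι β : Type*} [mΩ : MeasurableSpace Ω] {P : Measure Ω}

lemma iIndep_iSup_fiber {m : ι → MeasurableSpace Ω} (h_le : ∀ i, m i ≤ mΩ) (h : iIndep m P)
    (g : ι → β) : iIndep (fun b => ⨆ i ∈ {i | g i = b}, m i) P := by
  classical
  rw [iIndep_iff]
  intro s
  induction s using Finset.induction_on with
  | empty => exact fun _ => by simpa using (iIndep_iff m P).1 h ∅ (f := fun _ => ∅)
  | insert b s hb ih =>
    intro f hf
    have hdisj : Disjoint {i | g i = b} {i | g i ∈ s} :=
      Set.disjoint_left.2 fun i (hi : g i = b) (his : g i ∈ s) => hb (hi ▸ his)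
    have hle : ∀ c ∈ s, ⨆ i ∈ {i | g i = c}, m i ≤ ⨆ i ∈ {i | g i ∈ s}, m i :=
      fun c hc => biSup_mono fun i (hi : g i = c) => show g i ∈ s from hi ▸ hc
    have hmeas : MeasurableSet[⨆ i ∈ {i | g i ∈ s}, m i] (⋂ c ∈ s, f c) :=
      Finset.measurableSet_biInter _ fun c hc => hle c hc _ (hf c (Finset.mem_insert_of_mem hc))
    rw [Finset.set_biInter_insert, Finset.prod_insert hb,
      (Indep_iff _ _ _).1 (indep_iSup_of_disjoint h_le h hdisj) _ _
        (hf b (Finset.mem_insert_self b s)) hmeas,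
      ih fun c hc => hf c (Finset.mem_insert_of_mem hc)]

lemma iIndep_sumElim {m : ι → MeasurableSpace Ω} {n : β → MeasurableSpace Ω}
    (hm : iIndep m P) (hn : iIndep n P) (hmn : Indep (⨆ i, m i) (⨆ b, n b) P) :
    iIndep (Sum.elim m n) P := by
  rw [iIndep_iff]
  intro s f hf
  have hfm : ∀ i ∈ s.toLeft, MeasurableSet[m i] (f (.inl i)) :=
    fun i hi => hf _ (Finset.mem_toLeft.1 hi)
  have hfn : ∀ b ∈ s.toRight, MeasurableSet[n b] (f (.inr b)) :=
    fun b hb => hf _ (Finset.mem_toRight.1 hb)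
  calc P (⋂ i ∈ s, f i)
      = P ((⋂ i ∈ s.toLeft, f (.inl i)) ∩ ⋂ b ∈ s.toRight, f (.inr b)) := by
        congr 1
        ext ω
        simp
    _ = P (⋂ i ∈ s.toLeft, f (.inl i)) * P (⋂ b ∈ s.toRight, f (.inr b)) :=
        (Indep_iff _ _ _).1 hmn _ _
          (Finset.measurableSet_biInter _ fun i hi => le_iSup m i _ (hfm i hi))
          (Finset.measurableSet_biInter _ fun b hb => le_iSup n b _ (hfn b hb))
    _ = (∏ i ∈ s.toLeft, P (f (.inl i))) * ∏ b ∈ s.toRight, P (f (.inr b)) := by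
        rw [hm.meas_biInter hfm, hn.meas_biInter hfn]
    _ = ∏ i ∈ s, P (f i) := by
        rw [← Finset.prod_disjSum s.toLeft s.toRight fun i => P (f i),
          Finset.toLeft_disjSum_toRight]

lemma iIndep_sup {m n : ι → MeasurableSpace Ω} (hm_le : ∀ i, m i ≤ mΩ) (hn_le : ∀ i, n i ≤ mΩ)
    (hm : iIndep m P) (hn : iIndep n P) (hmn : Indep (⨆ i, m i) (⨆ i, n i) P) :
    iIndep (fun i => m i ⊔ n i) P :=
  iIndep_of_iIndep_of_le
    (iIndep_iSup_fiber (Sum.rec hm_le hn_le) (iIndep_sumElim hm hn hmn) (Sum.elim id id))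
    fun i => sup_le (le_iSup₂_of_le (Sum.inl i) rfl le_rfl) (le_iSup₂_of_le (Sum.inr i) rfl le_rfl)

end Grouping

/-! ### Marking the points of a Poisson process -/

section Marking

variable {Ω Θ : Type*}

/-- The product, over the blocks `[n l, n (l + 1))` with `l < k`, of the values of `z l` at the
marks `y m` of the points of the block. Its expectation is the joint generating function of the
numbers of points of each mark in each block. -/
def blockProd (z : ℕ → Θ → ℂ) (k : ℕ) (n : ℕ → ℕ) (y : ℕ → Θ) : ℂ :=
  ∏ l ∈ Finset.range k, ∏ m ∈ Finset.Ico (n l) (n (l + 1)), z l (y m)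

lemma norm_blockProd_le {z : ℕ → Θ → ℂ} (hz : ∀ l θ, ‖z l θ‖ ≤ 1) (k : ℕ) (n : ℕ → ℕ)
    (y : ℕ → Θ) : ‖blockProd z k n y‖ ≤ 1 := by
  simp only [blockProd, norm_prod]
  exact Finset.prod_le_one (fun _ _ => Finset.prod_nonneg fun _ _ => norm_nonneg _) fun l _ =>
    Finset.prod_le_one (fun _ _ => norm_nonneg _) fun m _ => hz _ _

lemma prod_blocks_eq_prod_sigma (n : ℕ → ℕ) (k : ℕ) (f : ℕ → ℕ → ℂ) :
    ∏ l ∈ Finset.range k, ∏ m ∈ Finset.Ico (n l) (n (l + 1)), f l m =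
      ∏ i : (l : Finset.range k) × Finset.Ico (n l) (n (l + 1)), f i.1 i.2 := by
  rw [Fintype.prod_sigma, ← Finset.prod_coe_sort]
  exact Finset.prod_congr rfl fun l _ => (Finset.prod_coe_sort _ _).symm

lemma injective_blocks {n : ℕ → ℕ} (hn : Monotone n) (k : ℕ) :
    Function.Injective
      fun i : (l : Finset.range k) × Finset.Ico (n l) (n (l + 1)) => (i.2 : ℕ) := by
  rintro ⟨⟨a, ha⟩, b, hb⟩ ⟨⟨c, hc⟩, d, hd⟩ (rfl : b = d)
  obtain rfl : a = c := by
    by_contra hac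
    exact Set.disjoint_left.1 (hn.pairwise_disjoint_on_Ico_succ hac)
      (Finset.mem_Ico.1 hb) (Finset.mem_Ico.1 hd)
  rfl

variable [MeasurableSpace Ω] {P : Measure Ω}

lemma integral_pow_of_hasLaw_poissonMeasure {D : Ω → ℕ} {r : ℝ≥0}
    (hD : HasLaw D (poissonMeasure r) P) (φ : ℂ) :
    ∫ ω, φ ^ D ω ∂P = Complex.exp (r * (φ - 1)) := by
  calc ∫ ω, φ ^ D ω ∂P
      = ∫ n, φ ^ n ∂poissonMeasure r := hD.integral_comp (f := fun n : ℕ => φ ^ n) (by fun_prop)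
    _ = ∑' n : ℕ, (Real.exp (-r) : ℂ) * ((r * φ) ^ n / n.factorial) := by
        rw [integral_poissonMeasure]
        congr with n
        rw [Complex.real_smul]
        push_cast
        ring
    _ = (Real.exp (-r) : ℂ) * Complex.exp (r * φ) := by
        rw [tsum_mul_left, (NormedSpace.expSeries_div_hasSum_exp (r * φ : ℂ)).tsum_eq,
          ← Complex.exp_eq_exp_ℂ]
    _ = Complex.exp (r * (φ - 1)) := by
        rw [Complex.ofReal_exp, ← Complex.exp_add]
        push_cast
        ring_nf

lemma integral_prod_pow_increments {N : ℝ≥0 → Ω → ℕ} {r : ℝ} (hN : IsPoissonProcess N r P)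
    {t : ℕ → ℝ≥0} (ht : Monotone t) (φ : ℕ → ℂ) (k : ℕ) :
    ∫ ω, ∏ l ∈ Finset.range k, φ l ^ (N (t (l + 1)) ω - N (t l) ω) ∂P =
      ∏ l ∈ Finset.range k, Complex.exp (r * (t (l + 1) - t l : ℝ) * (φ l - 1)) := by
  have hindep := (hN.indep.nat ht).precomp (g := fun l : Fin k => (l : ℕ)) Fin.val_injective
  simp_rw [Finset.prod_range]
  refine (hindep.integral_fun_prod_comp (f := fun (l : Fin k) (d : ℕ) => φ l ^ d)
    (fun l => ((hN.measurable _).sub (hN.measurable _)).aemeasurable)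
    (fun l => by fun_prop)).trans (Finset.prod_congr rfl fun l _ => ?_)
  have hle : t l ≤ t (l + 1) := ht (Nat.le_succ l)
  rw [integral_pow_of_hasLaw_poissonMeasure (hN.law _ _ hle), NNReal.coe_mul, NNReal.coe_sub hle,
    Real.coe_toNNReal _ hN.rate_nonneg]
  push_cast
  ring_nf

variable [MeasurableSpace Θ] [DiscreteMeasurableSpace Θ]

lemma measurable_blockProd (z : ℕ → Θ → ℂ) (k : ℕ) :
    Measurable fun q : (ℕ → ℕ) × (ℕ → Θ) => blockProd z k q.1 q.2 := by
  refine Finset.measurable_fun_prod _ fun l _ => ?_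
  have hblock : Measurable fun q : (ℕ × ℕ) × (ℕ → Θ) =>
      ∏ m ∈ Finset.Ico q.1.1 q.1.2, z l (q.2 m) :=
    measurable_from_prod_countable_right fun c =>
      Finset.measurable_fun_prod (Finset.Ico c.1 c.2) (f := fun m (y : ℕ → Θ) => z l (y m))
        fun m _ => Measurable.of_discrete.comp (measurable_pi_apply m)
  have hends : Measurable fun q : (ℕ → ℕ) × (ℕ → Θ) => ((q.1 l, q.1 (l + 1)), q.2) := by fun_prop
  exact hblock.comp hends

variable [Fintype Θ] [IsProbabilityMeasure P] {Y : ℕ → Ω → Θ} {p : Θ → ℝ}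

lemma integral_comp_mark (hYm : ∀ n, Measurable (Y n)) (hp : ∀ θ, 0 ≤ p θ)
    (hYp : ∀ n θ, P {ω | Y n ω = θ} = ENNReal.ofReal (p θ)) (n : ℕ) (z : Θ → ℂ) :
    ∫ ω, z (Y n ω) ∂P = ∑ θ, p θ * z θ := by
  rw [← integral_map (φ := Y n) (f := z) (hYm n).aemeasurable (by fun_prop),
    integral_fintype Integrable.of_finite]
  refine Finset.sum_congr rfl fun θ _ => ?_
  have hθ : P (Y n ⁻¹' {θ}) = ENNReal.ofReal (p θ) := hYp n θ
  rw [Measure.real, Measure.map_apply (hYm n) (measurableSet_singleton θ), hθ,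
    ENNReal.toReal_ofReal (hp θ), Complex.real_smul]

lemma integral_blockProd_const (hYm : ∀ n, Measurable (Y n)) (hp : ∀ θ, 0 ≤ p θ)
    (hYp : ∀ n θ, P {ω | Y n ω = θ} = ENNReal.ofReal (p θ)) (hYi : iIndepFun Y P)
    (z : ℕ → Θ → ℂ) (k : ℕ) {n : ℕ → ℕ} (hn : Monotone n) :
    ∫ ω, blockProd z k n (fun m => Y m ω) ∂P =
      ∏ l ∈ Finset.range k, (∑ θ, p θ * z l θ) ^ (n (l + 1) - n l) := by
  calc ∫ ω, blockProd z k n (fun m => Y m ω) ∂P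
      = ∫ ω, ∏ i : (l : Finset.range k) × Finset.Ico (n l) (n (l + 1)), z i.1 (Y i.2 ω) ∂P :=
        integral_congr_ae <| ae_of_all _ fun ω =>
          prod_blocks_eq_prod_sigma n k fun l m => z l (Y m ω)
    _ = ∏ i : (l : Finset.range k) × Finset.Ico (n l) (n (l + 1)), ∫ ω, z i.1 (Y i.2 ω) ∂P :=
        (hYi.precomp (injective_blocks hn k)).integral_fun_prod_comp
          (f := fun i : (l : Finset.range k) × Finset.Ico (n l) (n (l + 1)) => z i.1)
          (fun i => (hYm _).aemeasurable) (fun i => by fun_prop)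
    _ = ∏ i : (l : Finset.range k) × Finset.Ico (n l) (n (l + 1)), ∑ θ, p θ * z i.1 θ :=
        Finset.prod_congr rfl fun i _ => integral_comp_mark hYm hp hYp _ _
    _ = ∏ l ∈ Finset.range k, (∑ θ, p θ * z l θ) ^ (n (l + 1) - n l) := by
        rw [← prod_blocks_eq_prod_sigma n k fun l _ => ∑ θ, p θ * z l θ]
        simp only [Finset.prod_const, Nat.card_Ico]

lemma integral_blockProd_of_indepFun (hYm : ∀ n, Measurable (Y n)) (hp : ∀ θ, 0 ≤ p θ)
    (hYp : ∀ n θ, P {ω | Y n ω = θ} = ENNReal.ofReal (p θ)) (hYi : iIndepFun Y P)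
    {z : ℕ → Θ → ℂ} (hz : ∀ l θ, ‖z l θ‖ ≤ 1) (k : ℕ) {M : ℕ → Ω → ℕ}
    (hMm : ∀ l, Measurable (M l)) (hM : ∀ᵐ ω ∂P, Monotone fun l => M l ω)
    (hMY : IndepFun (fun ω l => M l ω) (fun ω m => Y m ω) P) :
    ∫ ω, blockProd z k (fun l => M l ω) (fun m => Y m ω) ∂P =
      ∫ ω, ∏ l ∈ Finset.range k, (∑ θ, p θ * z l θ) ^ (M (l + 1) ω - M l ω) ∂P := by
  have hM' : Measurable fun ω l => M l ω := measurable_pi_lambda _ hMm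
  have hY' : Measurable fun ω m => Y m ω := measurable_pi_lambda _ hYm
  have := Measure.isProbabilityMeasure_map (μ := P) hM'.aemeasurable
  have := Measure.isProbabilityMeasure_map (μ := P) hY'.aemeasurable
  have hmeas := measurable_blockProd z k
  have hint : Integrable (fun q : (ℕ → ℕ) × (ℕ → Θ) => blockProd z k q.1 q.2)
      ((P.map fun ω l => M l ω).prod (P.map fun ω m => Y m ω)) :=
    Integrable.of_bound hmeas.aestronglyMeasurable 1
      (ae_of_all _ fun q => norm_blockProd_le hz k _ _)
  calc ∫ ω, blockProd z k (fun l => M l ω) (fun m => Y m ω) ∂P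
      = ∫ q, blockProd z k q.1 q.2
          ∂((P.map fun ω l => M l ω).prod (P.map fun ω m => Y m ω)) := by
        rw [← (indepFun_iff_map_prod_eq_prod_map_map hM'.aemeasurable hY'.aemeasurable).1 hMY,
          integral_map (hM'.prodMk hY').aemeasurable hmeas.aestronglyMeasurable]
    _ = ∫ ω, (∫ y, blockProd z k (fun l => M l ω) y ∂(P.map fun ω m => Y m ω)) ∂P := by
        rw [integral_prod _ hint, integral_map hM'.aemeasurable
          hmeas.stronglyMeasurable.integral_prod_right'.aestronglyMeasurable]
    _ = ∫ ω, ∏ l ∈ Finset.range k, (∑ θ, p θ * z l θ) ^ (M (l + 1) ω - M l ω) ∂P := by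
        refine integral_congr_ae ?_
        filter_upwards [hM] with ω hω
        rw [← integral_blockProd_const hYm hp hYp hYi z k hω]
        exact integral_map hY'.aemeasurable
          (hmeas.comp measurable_prodMk_left).aestronglyMeasurable

theorem integral_blockProd_poisson (hYm : ∀ n, Measurable (Y n)) (hp : ∀ θ, 0 ≤ p θ)
    (hYp : ∀ n θ, P {ω | Y n ω = θ} = ENNReal.ofReal (p θ)) (hYi : iIndepFun Y P)
    {z : ℕ → Θ → ℂ} (hz : ∀ l θ, ‖z l θ‖ ≤ 1) (k : ℕ) {N : ℝ≥0 → Ω → ℕ} {r : ℝ}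
    (hN : IsPoissonProcess N r P) (hNY : IndepFun (fun ω t => N t ω) (fun ω m => Y m ω) P)
    {t : ℕ → ℝ≥0} (ht : Monotone t) :
    ∫ ω, blockProd z k (fun l => N (t l) ω) (fun m => Y m ω) ∂P =
      ∏ l ∈ Finset.range k,
        Complex.exp (r * (t (l + 1) - t l : ℝ) * (∑ θ, p θ * z l θ - 1)) := by
  have hmono : ∀ᵐ ω ∂P, Monotone fun l => N (t l) ω := by
    filter_upwards [hN.mono] with ω hω using hω.comp ht
  have hindep : IndepFun (fun ω l => N (t l) ω) (fun ω m => Y m ω) P :=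
    hNY.comp (φ := fun x l => x (t l)) (ψ := id)
      (measurable_pi_lambda _ fun l => measurable_pi_apply _) measurable_id
  rw [integral_blockProd_of_indepFun hYm hp hYp hYi hz k (fun l => hN.measurable (t l)) hmono
    hindep, integral_prod_pow_increments hN ht fun l => ∑ θ, p θ * z l θ]

end Marking

/-! ### The type counts as marked Poisson processes -/

namespace Network

lemma sum_p_mul_sub_one {I J K Θ : Type*} [Fintype Θ] (C : Network I J K Θ) (i : I) (z : Θ → ℂ) :
    ∑ θ, (C.p i θ : ℂ) * z θ - 1 = ∑ θ, (C.p i θ : ℂ) * (z θ - 1) := by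
  have hone : ∑ θ, (C.p i θ : ℂ) = 1 := by exact_mod_cast C.p_sum i
  simp_rw [mul_sub, Finset.sum_sub_distrib, mul_one, hone]

open Classical in
lemma prod_cexp_eq_prod_cexp_typeRate {I J K Θ : Type*} [Fintype I] [Fintype Θ]
    (C : Network I J K Θ) (j : J) (a : ℂ) (z : Θ → ℂ) :
    ∏ i with C.edge i = j, Complex.exp (C.ξ i * a * (∑ θ, C.p i θ * z θ - 1)) =
      ∏ θ, Complex.exp (C.typeRate j θ * a * (z θ - 1)) := by
  rw [← Complex.exp_sum, ← Complex.exp_sum]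
  congr 1
  simp_rw [C.sum_p_mul_sub_one, typeRate, Complex.ofReal_sum, Complex.ofReal_mul, Finset.mul_sum,
    Finset.sum_mul]
  rw [Finset.sum_comm]
  refine Finset.sum_congr rfl fun θ _ => Finset.sum_congr (by congr) fun i _ => by ring

end Network

lemma IsPoissonProcess.ae_path {Ω : Type*} [MeasurableSpace Ω] {P : Measure Ω}
    {N : ℝ≥0 → Ω → ℕ} {r : ℝ} (hN : IsPoissonProcess N r P) :
    ∀ᵐ ω ∂P, N 0 ω = 0 ∧ (Monotone fun t => N t ω) ∧
      ∀ t, ∀ᶠ s in 𝓝[≥] t, N s ω = N t ω := by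
  filter_upwards [hN.start, hN.mono, hN.rightCont] with ω hstart hmono hcont
  exact ⟨hstart, hmono, fun t =>
    (hcont t).eventually_mem (mem_nhds_discrete.2 (Set.mem_singleton _))⟩

namespace Primitives

variable {I J K Θ Ω : Type*} {X : Primitives I J Θ Ω}

/-- The σ-algebra generated by the request process of a demand point and the types of its
requests. -/
@[reducible] def demandSigma (X : Primitives I J Θ Ω) (i : I) : MeasurableSpace Ω :=
  X.sigma (.inl i) ⊔ ⨆ n, X.sigma (.inr (.inl (i, n)))

/-- The σ-algebra generated by the service times of one type at an edge server. -/
@[reducible] def serviceSigma (X : Primitives I J Θ Ω) (j : J) (θ : Θ) : MeasurableSpace Ω :=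
  ⨆ m, X.sigma (.inr (.inr (j, θ, m)))

lemma measurable_req_demandSigma (i : I) (t : ℝ≥0) :
    Measurable[X.demandSigma i] (X.req i t) := by
  have hpath : Measurable[X.sigma (.inl i)] (fun ω t => X.req i t ω) := comap_measurable _
  exact ((measurable_pi_apply t).comp hpath).mono le_sup_left le_rfl

lemma measurable_type_iSup_sigma (i : I) (n : ℕ) :
    @Measurable _ _ (⨆ n, X.sigma (.inr (.inl (i, n)))) ⊤ (X.type i n) := by
  have htype : @Measurable _ _ (X.sigma (.inr (.inl (i, n)))) ⊤ (X.type i n) := comap_measurable _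
  exact htype.mono (le_iSup (fun n => X.sigma (.inr (.inl (i, n)))) n) le_rfl

lemma measurable_type_demandSigma (i : I) (n : ℕ) :
    @Measurable _ _ (X.demandSigma i) ⊤ (X.type i n) :=
  (measurable_type_iSup_sigma i n).mono le_sup_right le_rfl

lemma measurable_service_serviceSigma (j : J) (θ : Θ) (m : ℕ) :
    Measurable[X.serviceSigma j θ] (X.service j θ m) := by
  have hserv : Measurable[X.sigma (.inr (.inr (j, θ, m)))] (X.service j θ m) := comap_measurable _
  exact hserv.mono (le_iSup (fun n => X.sigma (.inr (.inr (j, θ, n)))) m) le_rfl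

lemma measurable_type_of_forall [Countable Θ] {m : MeasurableSpace Ω} {i : I} {n : ℕ}
    (h : ∀ θ, MeasurableSet[m] {ω | X.type i n ω = θ}) :
    @Measurable _ _ m ⊤ (X.type i n) :=
  let _ : MeasurableSpace Θ := ⊤
  measurable_to_countable' h

lemma measurable_typeCount_of_forall [Fintype I] [Fintype Θ]
    {C : Network I J K Θ} {m : MeasurableSpace Ω} {j : J}
    (hreq : ∀ i, C.edge i = j → ∀ t, Measurable[m] (X.req i t))
    (htype : ∀ i, C.edge i = j → ∀ n, @Measurable _ _ m ⊤ (X.type i n))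
    (θ : Θ) (t : ℝ≥0) : Measurable[m] (X.typeCount C j θ t) := by
  classical
  refine Finset.measurable_fun_sum _ fun i hi => ?_
  have hi : C.edge i = j := (Finset.mem_filter.1 hi).2
  have hcard : ∀ k : ℕ, Measurable[m] fun ω =>
      ((Finset.range k).filter fun n => X.type i n ω = θ).card := by
    intro k
    simp_rw [Finset.card_filter]
    exact Finset.measurable_fun_sum _ fun n _ =>
      Measurable.ite (htype i hi n (t := {θ}) trivial) measurable_const measurable_const
  have hcard' : Measurable fun q : ℕ × Ω =>
      ((Finset.range q.1).filter fun n => X.type i n q.2 = θ).card :=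
    measurable_from_prod_countable_right hcard
  convert! hcard'.comp ((hreq i hi t).prodMk measurable_id)

lemma measurable_blockProd_demandSigma (i : I) (t : ℕ → ℝ≥0) (z : ℕ → Θ → ℂ) (k : ℕ) :
    Measurable[X.demandSigma i] fun ω =>
      blockProd z k (fun l => X.req i (t l) ω) (fun m => X.type i m ω) := by
  let _ : MeasurableSpace Θ := ⊤
  have : DiscreteMeasurableSpace Θ := ⟨fun _ => trivial⟩
  refine (measurable_blockProd z k).comp (Measurable.prodMk ?_ ?_)
  · exact @measurable_pi_lambda _ _ _ (X.demandSigma i) _ _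
      fun l => measurable_req_demandSigma i _
  · exact @measurable_pi_lambda _ _ _ (X.demandSigma i) _ _
      fun m => measurable_type_demandSigma i _

section Paths

variable [Fintype I] [Fintype Θ] {C : Network I J K Θ} {ω : Ω}

lemma monotone_typeCount (hω : ∀ i, Monotone fun t => X.req i t ω) (j : J) (θ : Θ) :
    Monotone fun t => X.typeCount C j θ t ω := by
  classical
  exact fun s t hst => Finset.sum_le_sum fun i _ => Finset.card_le_card <|
    Finset.filter_subset_filter _ (Finset.range_mono (hω i hst))

open Classical in
lemma typeCount_sub_typeCount (hω : ∀ i, Monotone fun t => X.req i t ω) (j : J) (θ : Θ)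
    {s t : ℝ≥0} (hst : s ≤ t) :
    X.typeCount C j θ t ω - X.typeCount C j θ s ω = ∑ i with C.edge i = j,
      ((Finset.Ico (X.req i s ω) (X.req i t ω)).filter fun n => X.type i n ω = θ).card := by
  rw [Nat.sub_eq_iff_eq_add (monotone_typeCount hω j θ hst)]
  simp only [typeCount]
  rw [← Finset.sum_add_distrib]
  refine Finset.sum_congr (by congr) fun i _ => ?_
  have hle : X.req i s ω ≤ X.req i t ω := hω i hst
  have hdisj : Disjoint (Finset.Ico (X.req i s ω) (X.req i t ω)) (Finset.range (X.req i s ω)) :=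
    Finset.disjoint_left.2 fun n hn hn' =>
      (Finset.mem_Ico.1 hn).1.not_gt (Finset.mem_range.1 hn')
  rw [← Finset.card_union_of_disjoint (Finset.disjoint_filter_filter hdisj),
    ← Finset.filter_union, Finset.union_comm, Finset.range_eq_Ico, Finset.range_eq_Ico,
    Finset.Ico_union_Ico_eq_Ico (Nat.zero_le _) hle]

lemma prod_comp_eq_prod_pow_card [DecidableEq Θ] (s : Finset ℕ) (y : ℕ → Θ) (z : Θ → ℂ) :
    ∏ m ∈ s, z (y m) = ∏ θ, z θ ^ (s.filter fun m => y m = θ).card := by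
  rw [← Finset.prod_fiberwise' _ y z]
  simp only [Finset.prod_const]

open Classical in
lemma prod_pow_typeCount_sub {j : J} (hω : ∀ i, Monotone fun t => X.req i t ω)
    {t : ℕ → ℝ≥0} (ht : Monotone t) (z : ℕ → Θ → ℂ) (k : ℕ) :
    ∏ l ∈ Finset.range k, ∏ θ,
        z l θ ^ (X.typeCount C j θ (t (l + 1)) ω - X.typeCount C j θ (t l) ω) =
      ∏ i, if C.edge i = j then
        blockProd z k (fun l => X.req i (t l) ω) (fun m => X.type i m ω) else 1 := by
  rw [← Finset.prod_filter]
  simp_rw [blockProd, prod_comp_eq_prod_pow_card]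
  refine Eq.trans (Finset.prod_congr rfl fun l _ => ?_) Finset.prod_comm
  refine Eq.trans (Finset.prod_congr rfl fun θ _ => ?_) Finset.prod_comm
  rw [Finset.prod_pow_eq_pow_sum, typeCount_sub_typeCount hω j θ (ht (Nat.le_succ l))]

end Paths

variable [Fintype Θ] [MeasurableSpace Ω] {P : Measure Ω} {C : Network I J K Θ}

lemma Satisfies.sigma_le (hX : X.Satisfies C P) (a) : X.sigma a ≤ ‹MeasurableSpace Ω› := by
  rcases a with i | ⟨i, n⟩ | ⟨j, θ, m⟩
  · exact (measurable_pi_lambda _ (hX.req_poisson i).measurable).comap_le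
  · exact (measurable_type_of_forall (hX.type_measurable i n)).comap_le
  · exact (hX.service_measurable j θ m).comap_le

lemma Satisfies.demandSigma_le (hX : X.Satisfies C P) (i : I) :
    X.demandSigma i ≤ ‹MeasurableSpace Ω› :=
  sup_le (hX.sigma_le _) (iSup_le fun _ => hX.sigma_le _)

lemma Satisfies.serviceSigma_le (hX : X.Satisfies C P) (j : J) (θ : Θ) :
    X.serviceSigma j θ ≤ ‹MeasurableSpace Ω› :=
  iSup_le fun _ => hX.sigma_le _

lemma Satisfies.iIndep_demandSigma_serviceSigma (hX : X.Satisfies C P) :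
    iIndep (Sum.elim X.demandSigma fun q : J × Θ => X.serviceSigma q.1 q.2) P := by
  refine iIndep_of_iIndep_of_le (iIndep_iSup_fiber hX.sigma_le hX.indep
    (β := I ⊕ (J × Θ)) (fun a => Sum.elim .inl (Sum.elim (fun q => .inl q.1)
      fun q => .inr (q.1, q.2.1)) a)) ?_
  rintro (i | ⟨j, θ⟩)
  · exact sup_le (le_iSup₂_of_le (.inl i) rfl le_rfl)
      (iSup_le fun n => le_iSup₂_of_le (.inr (.inl (i, n))) rfl le_rfl)
  · exact iSup_le fun m => le_iSup₂_of_le (.inr (.inr (j, θ, m))) rfl le_rfl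

lemma Satisfies.iIndepFun_type (hX : X.Satisfies C P) (i : I) :
    @iIndepFun _ _ _ _ (fun _ => ⊤) (X.type i) P :=
  let _ : MeasurableSpace Θ := ⊤
  (iIndepFun_iff_iIndep _ _ _).2 (hX.indep.precomp
    (g := fun n : ℕ => (.inr (.inl (i, n)) : I ⊕ (I × ℕ) ⊕ (J × Θ × ℕ)))
    fun a b h => by simpa using h)

lemma Satisfies.indepFun_req_type (hX : X.Satisfies C P) (i : I) :
    let _ : MeasurableSpace Θ := ⊤
    IndepFun (fun ω t => X.req i t ω) (fun ω n => X.type i n ω) P := by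
  intro _
  rw [IndepFun_iff_Indep]
  refine indep_of_indep_of_le (indep_iSup_of_disjoint hX.sigma_le hX.indep (S := {.inl i})
    (T := Set.range fun n => .inr (.inl (i, n))) (by simp)) (by simp) ?_
  rw [iSup_range]
  exact (@measurable_pi_lambda _ _ _ (⨆ n, X.sigma (.inr (.inl (i, n)))) _ _
    fun n => measurable_type_iSup_sigma i n).comap_le

lemma Satisfies.ae_req [Countable I] (hX : X.Satisfies C P) :
    ∀ᵐ ω ∂P, ∀ i, X.req i 0 ω = 0 ∧ (Monotone fun t => X.req i t ω) ∧
      ∀ t, ∀ᶠ s in 𝓝[≥] t, X.req i s ω = X.req i t ω :=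
  ae_all_iff.2 fun i => (hX.req_poisson i).ae_path

lemma Satisfies.integral_blockProd [IsProbabilityMeasure P] (hX : X.Satisfies C P) (i : I)
    {t : ℕ → ℝ≥0} (ht : Monotone t) {z : ℕ → Θ → ℂ} (hz : ∀ l θ, ‖z l θ‖ ≤ 1) (k : ℕ) :
    ∫ ω, blockProd z k (fun l => X.req i (t l) ω) (fun m => X.type i m ω) ∂P =
      ∏ l ∈ Finset.range k,
        Complex.exp (C.ξ i * (t (l + 1) - t l : ℝ) * (∑ θ, C.p i θ * z l θ - 1)) := by
  let _ : MeasurableSpace Θ := ⊤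
  have : DiscreteMeasurableSpace Θ := ⟨fun _ => trivial⟩
  exact integral_blockProd_poisson (fun n => measurable_type_of_forall (hX.type_measurable i n))
    (fun θ => (C.p_mem i θ).1) (hX.type_law i) (hX.iIndepFun_type i) hz k
    (hX.req_poisson i) (hX.indepFun_req_type i) ht

variable [Fintype I]

lemma Satisfies.measurable_typeCount (hX : X.Satisfies C P) (j : J) (θ : Θ) (t : ℝ≥0) :
    Measurable (X.typeCount C j θ t) :=
  measurable_typeCount_of_forall (fun i _ => (hX.req_poisson i).measurable)
    (fun i _ n => measurable_type_of_forall (hX.type_measurable i n)) θ t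

lemma Satisfies.ae_typeCount (hX : X.Satisfies C P) (j : J) :
    ∀ᵐ ω ∂P, ∀ θ, X.typeCount C j θ 0 ω = 0 ∧ (Monotone fun t => X.typeCount C j θ t ω) ∧
      ∀ t, ∀ᶠ s in 𝓝[≥] t, X.typeCount C j θ s ω = X.typeCount C j θ t ω := by
  filter_upwards [hX.ae_req] with ω hω θ
  refine ⟨?_, monotone_typeCount (fun i => (hω i).2.1) j θ, fun t => ?_⟩
  · simp only [typeCount, (hω _).1, Finset.range_zero, Finset.filter_empty, Finset.card_empty,
      Finset.sum_const_zero]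
  · filter_upwards [eventually_all.2 fun i => (hω i).2.2 t] with s hs
    simp only [typeCount, hs]

variable [IsProbabilityMeasure P]

theorem Satisfies.integral_prod_pow_typeCount_sub (hX : X.Satisfies C P) (j : J)
    {t : ℕ → ℝ≥0} (ht : Monotone t) {z : ℕ → Θ → ℂ} (hz : ∀ l θ, ‖z l θ‖ ≤ 1) (k : ℕ) :
    ∫ ω, ∏ l ∈ Finset.range k, ∏ θ,
        z l θ ^ (X.typeCount C j θ (t (l + 1)) ω - X.typeCount C j θ (t l) ω) ∂P =
      ∏ l ∈ Finset.range k, ∏ θ,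
        Complex.exp (C.typeRate j θ * (t (l + 1) - t l : ℝ) * (z l θ - 1)) := by
  classical
  set G : I → Ω → ℂ := fun i ω => if C.edge i = j then
    blockProd z k (fun l => X.req i (t l) ω) (fun m => X.type i m ω) else 1 with hG
  have hGm : ∀ i, Measurable[X.demandSigma i] (G i) := by
    intro i
    by_cases hi : C.edge i = j
    · simpa only [hG, hi, if_true] using measurable_blockProd_demandSigma i t z k
    · simpa only [hG, hi, if_false] using measurable_const
  have hGi : iIndepFun G P :=
    iIndep_of_iIndep_of_le (hX.iIndep_demandSigma_serviceSigma.precomp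
      (g := Sum.inl) Sum.inl_injective) fun i => (hGm i).comap_le
  calc ∫ ω, ∏ l ∈ Finset.range k, ∏ θ,
        z l θ ^ (X.typeCount C j θ (t (l + 1)) ω - X.typeCount C j θ (t l) ω) ∂P
      = ∫ ω, ∏ i, G i ω ∂P := by
        refine integral_congr_ae ?_
        filter_upwards [hX.ae_req] with ω hω
        exact prod_pow_typeCount_sub (fun i => (hω i).2.1) ht z k
    _ = ∏ i, ∫ ω, G i ω ∂P := hGi.integral_fun_prod_eq_prod_integral fun i =>
        ((hGm i).mono (hX.demandSigma_le i) le_rfl).aestronglyMeasurable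
    _ = ∏ i, if C.edge i = j then ∏ l ∈ Finset.range k,
          Complex.exp (C.ξ i * (t (l + 1) - t l : ℝ) * (∑ θ, C.p i θ * z l θ - 1)) else 1 := by
        refine Finset.prod_congr rfl fun i _ => ?_
        by_cases hi : C.edge i = j
        · simp only [hG, hi, if_true, hX.integral_blockProd i ht hz k]
        · simp only [hG, hi, if_false, integral_const, probReal_univ, one_smul]
    _ = ∏ l ∈ Finset.range k, ∏ θ,
          Complex.exp (C.typeRate j θ * (t (l + 1) - t l : ℝ) * (z l θ - 1)) := by
        rw [← Finset.prod_filter, Finset.prod_comm]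
        refine Finset.prod_congr rfl fun l _ => ?_
        rw [← C.prod_cexp_eq_prod_cexp_typeRate]

end Primitives

/-! ### Independence of the arrival processes of different types -/

section Counting

variable {Ω ι : Type*} [MeasurableSpace Ω] {P : Measure Ω}

lemma charFun_map_toLp [Fintype ι] {D : Ω → ι → ℝ} (hD : Measurable D) (u : EuclideanSpace ℝ ι) :
    charFun ((P.map D).map (WithLp.toLp 2)) u =
      ∫ ω, ∏ i, Complex.exp (D ω i * (u i * Complex.I)) ∂P := by
  have hcont : Continuous fun x : EuclideanSpace ℝ ι =>
      Complex.exp (inner ℝ x u * Complex.I) := by fun_prop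
  rw [charFun_apply, integral_map (WithLp.measurable_toLp 2 _).aemeasurable
    hcont.aestronglyMeasurable]
  refine (integral_map hD.aemeasurable
    (hcont.measurable.comp (WithLp.measurable_toLp 2 _)).aestronglyMeasurable).trans ?_
  refine integral_congr_ae (ae_of_all _ fun ω => ?_)
  simp only [PiLp.inner_apply, Function.comp_apply, RCLike.inner_apply, conj_trivial]
  rw [← Complex.exp_sum, Complex.ofReal_sum, Finset.sum_mul]
  congr 1
  refine Finset.sum_congr rfl fun i _ => ?_
  push_cast
  ring

lemma charFun_map_natCast (ν : Measure ℕ) (u : ℝ) :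
    charFun (ν.map (Nat.cast : ℕ → ℝ)) u = ∫ n, Complex.exp (u * Complex.I) ^ n ∂ν := by
  rw [charFun_apply_real, integral_map measurable_from_nat.aemeasurable
    (Continuous.aestronglyMeasurable (by fun_prop))]
  congr with n
  rw [← Complex.exp_nat_mul]
  push_cast
  ring_nf

lemma map_natCast_injective [Countable ι] :
    Function.Injective fun ρ : Measure (ι → ℕ) => ρ.map fun n i => (n i : ℝ) := by
  intro ρ ρ' h
  have hcast : Measurable fun (n : ι → ℕ) i => (n i : ℝ) := by fun_prop
  have hfloor : Measurable fun (x : ι → ℝ) i => ⌊x i⌋₊ := by fun_prop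
  simpa [Measure.map_map hfloor hcast, Function.comp_def] using
    congrArg (Measure.map fun (x : ι → ℝ) i => ⌊x i⌋₊) h

theorem map_eq_pi_of_integral_prod_pow [Fintype ι] [IsProbabilityMeasure P] {D : ι → Ω → ℕ}
    (hD : ∀ i, Measurable (D i)) {ν : ι → Measure ℕ} [∀ i, IsProbabilityMeasure (ν i)]
    (h : ∀ z : ι → ℂ, (∀ i, ‖z i‖ ≤ 1) →
      ∫ ω, ∏ i, z i ^ D i ω ∂P = ∏ i, ∫ n, z i ^ n ∂ν i) :
    P.map (fun ω i => D i ω) = Measure.pi ν := by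
  have hcast : Measurable fun ω i => (D i ω : ℝ) := by fun_prop
  have := Measure.isProbabilityMeasure_map (μ := P) hcast.aemeasurable
  have (i : ι) : IsProbabilityMeasure ((ν i).map (Nat.cast : ℕ → ℝ)) :=
    Measure.isProbabilityMeasure_map measurable_from_nat.aemeasurable
  apply map_natCast_injective
  dsimp only
  rw [Measure.map_map (by fun_prop) (by fun_prop),
    Measure.pi_map_pi fun _ => measurable_from_nat.aemeasurable]
  refine charFun_eq_pi_iff.1 fun u => ?_
  simp_rw [charFun_map_natCast]
  rw [← h _ fun i => (Complex.norm_exp_ofReal_mul_I _).le]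
  refine (charFun_map_toLp hcast u).trans ?_
  simp_rw [← Complex.exp_nat_mul, Complex.ofReal_natCast]

lemma exists_monotone_enum (F : Finset ℝ≥0) :
    ∃ t : ℕ → ℝ≥0, Monotone t ∧ t 0 = 0 ∧ ∀ x ∈ F, ∃ n, t n = x := by
  classical
  set S := insert 0 F
  have hcard : 0 < S.card := Finset.card_pos.2 ⟨0, Finset.mem_insert_self 0 F⟩
  have hlt : ∀ n, min n (S.card - 1) < S.card := fun n => by omega
  refine ⟨fun n => S.orderEmbOfFin rfl ⟨min n (S.card - 1), hlt n⟩, fun m n hmn => ?_, ?_,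
    fun x hx => ?_⟩
  · exact (S.orderEmbOfFin rfl).monotone (Fin.mk_le_mk.2 (min_le_min_right _ hmn))
  · have hmin : S.min' (Finset.card_pos.1 hcard) ≤ 0 :=
      Finset.min'_le _ _ (Finset.mem_insert_self 0 F)
    simpa [Finset.orderEmbOfFin_zero rfl hcard] using hmin
  · have hxS : x ∈ Set.range (S.orderEmbOfFin rfl) := by
      rw [Finset.range_orderEmbOfFin]
      exact Finset.mem_insert_of_mem hx
    obtain ⟨a, rfl⟩ := hxS
    have ha : min (a : ℕ) (S.card - 1) = a := min_eq_left (by omega)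
    exact ⟨a, by simp only [ha, Fin.eta]⟩

lemma iIndepFun_process_of_increments [Countable ι] {N : ι → ℝ≥0 → Ω → ℕ}
    (hN : ∀ i t, Measurable (N i t)) (hzero : ∀ᵐ ω ∂P, ∀ i, N i 0 ω = 0)
    (hmono : ∀ᵐ ω ∂P, ∀ i, Monotone fun t => N i t ω)
    (hinc : ∀ t : ℕ → ℝ≥0, Monotone t →
      iIndepFun (fun (q : ℕ × ι) ω => N q.2 (t (q.1 + 1)) ω - N q.2 (t q.1) ω) P) :
    iIndepFun (fun i ω t => N i t ω) P := by
  classical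
  refine iIndepFun.iIndepFun_process hN fun A F => ?_
  obtain ⟨t, htm, ht0, htF⟩ := exists_monotone_enum (A.attach.biUnion F)
  choose! n hn using htF
  have hDm : ∀ q : ℕ × ι, Measurable fun ω => N q.2 (t (q.1 + 1)) ω - N q.2 (t q.1) ω :=
    fun q => (hN _ _).sub (hN _ _)
  have hgroup := (iIndep_iSup_fiber (fun q => (hDm q).comap_le) (hinc t htm).iIndep
    Prod.snd).precomp (g := fun a : A => (a : ι)) Subtype.val_injective
  have hsum : iIndepFun (fun (a : A) ω (x : F a) => ∑ l ∈ Finset.range (n x),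
      (N a (t (l + 1)) ω - N a (t l) ω)) P := by
    refine iIndep_of_iIndep_of_le hgroup fun a => Measurable.comap_le ?_
    refine @measurable_pi_lambda _ _ _ (_) _ _ fun x => Finset.measurable_fun_sum _ fun l _ => ?_
    have hcell : Measurable[MeasurableSpace.comap
        (fun ω => N (a : ι) (t (l + 1)) ω - N a (t l) ω) inferInstance]
        fun ω => N a (t (l + 1)) ω - N a (t l) ω := comap_measurable _
    refine hcell.mono ?_ le_rfl
    exact le_iSup₂_of_le (f := fun (q : ℕ × ι) (_ : q ∈ {q | q.2 = (a : ι)}) =>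
      MeasurableSpace.comap (fun ω => N q.2 (t (q.1 + 1)) ω - N q.2 (t q.1) ω) inferInstance)
      (l, (a : ι)) rfl le_rfl
  refine (iIndepFun_congr fun a => ?_).1 hsum
  filter_upwards [hzero, hmono] with ω hω₀ hω
  ext x
  have hx : t (n x) = x := hn x (Finset.mem_biUnion.2 ⟨a, Finset.mem_attach _ _, x.2⟩)
  rw [Finset.sum_range_tsub (f := fun l => N a (t l) ω) fun k l hkl => hω a (htm hkl), ht0, hω₀, hx,
    Nat.sub_zero]

end Counting

namespace Network

variable {I J K Θ : Type*} [Fintype I] [Fintype Θ]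

lemma typeRate_nonneg (C : Network I J K Θ) (j : J) (θ : Θ) : 0 ≤ C.typeRate j θ :=
  Finset.sum_nonneg fun i _ => mul_nonneg (C.ξ_pos i).le (C.p_mem i θ).1

end Network

namespace Primitives

variable {I J K Θ Ω : Type*} {X : Primitives I J Θ Ω}

lemma measurable_service_pi_serviceSigma (j : J) (θ : Θ) :
    Measurable[X.serviceSigma j θ] fun ω m => X.service j θ m ω :=
  @measurable_pi_lambda _ _ _ (_) _ _ fun m => measurable_service_serviceSigma j θ m

lemma measurable_typeCount_demandSigma [Fintype I] [Fintype Θ] {C : Network I J K Θ} (j : J)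
    (θ : Θ) : Measurable[⨆ i, X.demandSigma i] fun ω t => X.typeCount C j θ t ω := by
  refine @measurable_pi_lambda _ _ _ (_) _ _ fun t => ?_
  refine measurable_typeCount_of_forall (fun i _ t => ?_) (fun i _ n => ?_) θ t
  · exact (measurable_req_demandSigma i t).mono (le_iSup _ i) le_rfl
  · exact (measurable_type_demandSigma i n).mono (le_iSup _ i) le_rfl

variable [Fintype Θ] [MeasurableSpace Ω] {P : Measure Ω} {C : Network I J K Θ}

lemma Satisfies.indep_demandSigma_serviceSigma (hX : X.Satisfies C P) (j : J) :
    Indep (⨆ i, X.demandSigma i) (⨆ θ, X.serviceSigma j θ) P := by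
  have hdisj : Disjoint (Set.range (Sum.inl : I → I ⊕ J × Θ))
      (Set.range fun θ => Sum.inr (j, θ)) := by
    rw [Set.disjoint_left]
    rintro _ ⟨i, rfl⟩ ⟨θ, h⟩
    cases h
  simpa only [iSup_range, Sum.elim_inl, Sum.elim_inr] using indep_iSup_of_disjoint
    (Sum.rec hX.demandSigma_le fun q => hX.serviceSigma_le q.1 q.2)
    hX.iIndep_demandSigma_serviceSigma hdisj

lemma Satisfies.iIndepFun_service (hX : X.Satisfies C P) (j : J) (θ : Θ) :
    iIndepFun (X.service j θ) P :=
  (iIndepFun_iff_iIndep _ _ _).2 (hX.indep.precomp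
    (g := fun n : ℕ => (.inr (.inr (j, θ, n)) : I ⊕ (I × ℕ) ⊕ (J × Θ × ℕ)))
    fun _ _ h => by simpa using h)

variable [Fintype I]

lemma Satisfies.indepFun_typeCount_service (hX : X.Satisfies C P) (j : J) :
    IndepFun (fun ω θ t => X.typeCount C j θ t ω) (fun ω θ m => X.service j θ m ω) P :=
  indep_of_indep_of_le (hX.indep_demandSigma_serviceSigma j)
    (@measurable_pi_lambda _ _ _ (_) _ _ fun θ =>
      measurable_typeCount_demandSigma j θ).comap_le
    (@measurable_pi_lambda _ _ _ (_) _ _ fun θ =>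
      (measurable_service_pi_serviceSigma j θ).mono (le_iSup _ θ) le_rfl).comap_le

variable [IsProbabilityMeasure P]

theorem Satisfies.map_typeCount_sub_eq_pi (hX : X.Satisfies C P) (j : J) {t : ℕ → ℝ≥0}
    (ht : Monotone t) (k : ℕ) :
    P.map (fun ω (q : Fin k × Θ) =>
        X.typeCount C j q.2 (t (q.1 + 1)) ω - X.typeCount C j q.2 (t q.1) ω) =
      Measure.pi fun q : Fin k × Θ =>
        poissonMeasure ((C.typeRate j q.2).toNNReal * (t (q.1 + 1) - t q.1)) := by
  refine map_eq_pi_of_integral_prod_pow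
    (fun q => (hX.measurable_typeCount j _ _).sub (hX.measurable_typeCount j _ _)) fun z hz => ?_
  set z' : ℕ → Θ → ℂ := fun l θ => if h : l < k then z (⟨l, h⟩, θ) else 1 with hz'
  have hz'_le : ∀ l θ, ‖z' l θ‖ ≤ 1 := by
    intro l θ
    by_cases h : l < k
    · simpa only [hz', h, dif_pos] using hz _
    · simp only [hz', h, dif_neg, not_false_iff, norm_one, le_refl]
  have hz'_fin : ∀ (l : Fin k) θ, z' l θ = z (l, θ) := fun l θ => dif_pos l.2
  have hgen := hX.integral_prod_pow_typeCount_sub j ht hz'_le k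
  simp_rw [Finset.prod_range, hz'_fin] at hgen
  simp_rw [Fintype.prod_prod_type]
  refine hgen.trans (Finset.prod_congr rfl fun l _ => Finset.prod_congr rfl fun θ _ => ?_)
  refine Eq.trans ?_
    (integral_pow_of_hasLaw_poissonMeasure (D := fun n : ℕ => n) HasLaw.id _).symm
  rw [NNReal.coe_mul,
    NNReal.coe_sub (ht (Nat.le_succ l)), Real.coe_toNNReal _ (C.typeRate_nonneg j θ)]
  push_cast
  rfl

lemma Satisfies.hasLaw_typeCount_sub (hX : X.Satisfies C P) (j : J) (θ : Θ) {s t : ℝ≥0}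
    (hst : s ≤ t) :
    HasLaw (fun ω => X.typeCount C j θ t ω - X.typeCount C j θ s ω)
      (poissonMeasure ((C.typeRate j θ).toNNReal * (t - s))) P := by
  have hmono : Monotone fun n : ℕ => if n = 0 then s else t :=
    monotone_nat_of_le_succ fun n => by by_cases hn : n = 0 <;> simp [hn, hst]
  have hincr : Measurable fun ω (q : Fin 1 × Θ) => X.typeCount C j q.2
      (if (q.1 : ℕ) + 1 = 0 then s else t) ω -
        X.typeCount C j q.2 (if (q.1 : ℕ) = 0 then s else t) ω :=
    measurable_pi_lambda _ fun q =>
      (hX.measurable_typeCount j _ _).sub (hX.measurable_typeCount j _ _)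
  have hpi := (measurePreserving_eval _ ((0, θ) : Fin 1 × Θ)).hasLaw.comp
    ⟨hincr.aemeasurable, hX.map_typeCount_sub_eq_pi j hmono 1⟩
  simpa [Function.comp_def] using hpi

lemma Satisfies.iIndepFun_typeCount_sub_fin (hX : X.Satisfies C P) (j : J) {t : ℕ → ℝ≥0}
    (ht : Monotone t) (k : ℕ) :
    iIndepFun (fun (q : Fin k × Θ) ω =>
      X.typeCount C j q.2 (t (q.1 + 1)) ω - X.typeCount C j q.2 (t q.1) ω) P := by
  have hm : ∀ q : Fin k × Θ, Measurable fun ω =>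
      X.typeCount C j q.2 (t (q.1 + 1)) ω - X.typeCount C j q.2 (t q.1) ω := fun q =>
    (hX.measurable_typeCount j _ _).sub (hX.measurable_typeCount j _ _)
  rw [iIndepFun_iff_map_fun_eq_pi_map fun q => (hm q).aemeasurable,
    hX.map_typeCount_sub_eq_pi j ht k]
  congr with q : 1
  exact (hX.hasLaw_typeCount_sub j q.2 (ht (Nat.le_succ q.1))).map_eq.symm

theorem Satisfies.iIndepFun_typeCount_sub (hX : X.Satisfies C P) (j : J) {t : ℕ → ℝ≥0}
    (ht : Monotone t) :
    iIndepFun (fun (q : ℕ × Θ) ω =>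
      X.typeCount C j q.2 (t (q.1 + 1)) ω - X.typeCount C j q.2 (t q.1) ω) P := by
  refine iIndepFun_iff_finset.2 fun s => ?_
  set k := s.sup Prod.fst + 1
  have hs : ∀ q ∈ s, q.1 < k := fun q hq => Nat.lt_succ_of_le (Finset.le_sup (f := Prod.fst) hq)
  refine (hX.iIndepFun_typeCount_sub_fin j ht k).precomp
    (g := fun q : s => ((⟨q.1.1, hs q.1 q.2⟩, q.1.2) : Fin k × Θ)) ?_
  rintro ⟨⟨a, b⟩, h⟩ ⟨⟨c, d⟩, h'⟩ hq
  simpa using hq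

theorem Satisfies.isPoissonProcess_typeCount (hX : X.Satisfies C P) (j : J) (θ : Θ) :
    IsPoissonProcess (X.typeCount C j θ) (C.typeRate j θ) P where
  rate_nonneg := C.typeRate_nonneg j θ
  measurable := hX.measurable_typeCount j θ
  start := (hX.ae_typeCount j).mono fun ω h => (h θ).1
  mono := (hX.ae_typeCount j).mono fun ω h => (h θ).2.1
  rightCont := (hX.ae_typeCount j).mono fun ω h t =>
    tendsto_nhds_of_eventually_eq ((h θ).2.2 t)
  indep := hasIndepIncrements_iff_nat.2 fun t ht =>
    (hX.iIndepFun_typeCount_sub j ht).precomp (g := fun l => (l, θ)) fun a b h => by simpa using h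
  law s t hst := hX.hasLaw_typeCount_sub j θ hst

theorem Satisfies.iIndepFun_typeCount (hX : X.Satisfies C P) (j : J) :
    iIndepFun (fun θ ω t => X.typeCount C j θ t ω) P :=
  iIndepFun_process_of_increments (hX.measurable_typeCount j)
    ((hX.ae_typeCount j).mono fun _ h θ => (h θ).1)
    ((hX.ae_typeCount j).mono fun _ h θ => (h θ).2.1)
    fun _ ht => hX.iIndepFun_typeCount_sub j ht

theorem Satisfies.isMM1_dsrQueue (hX : X.Satisfies C P) (j : J) (θ : Θ) :
    (X.dsrQueue C j θ).IsMM1 (C.typeRate j θ) (C.μ j θ) P where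
  rate_pos := C.μ_pos j θ
  arrivals_poisson := hX.isPoissonProcess_typeCount j θ
  service_law n := hX.service_law j θ n
  service_indep := hX.iIndepFun_service j θ
  arrivals_indep_service := (hX.indepFun_typeCount_service j).comp
    (measurable_pi_apply θ) (measurable_pi_apply θ)

theorem Satisfies.iIndepFun_input (hX : X.Satisfies C P) (j : J) :
    iIndepFun (fun θ => (X.dsrQueue C j θ).input) P := by
  have hservice : iIndep (fun θ => X.serviceSigma j θ) P :=
    hX.iIndep_demandSigma_serviceSigma.precomp (g := fun θ => Sum.inr (j, θ))
      fun a b h => by simpa using h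
  have hle : ∀ θ, MeasurableSpace.comap (fun ω t => X.typeCount C j θ t ω) inferInstance ≤
      ⨆ i, X.demandSigma i := fun θ => (measurable_typeCount_demandSigma j θ).comap_le
  refine iIndep_of_iIndep_of_le (iIndep_sup
    (fun θ => (hle θ).trans (iSup_le hX.demandSigma_le)) (hX.serviceSigma_le j)
    (hX.iIndepFun_typeCount j).iIndep hservice
    (indep_of_indep_of_le_left (hX.indep_demandSigma_serviceSigma j) (iSup_le hle))) fun θ => ?_
  exact (Measurable.prodMk ((comap_measurable _).mono le_sup_left le_rfl)
    ((measurable_service_pi_serviceSigma j θ).mono le_sup_right le_rfl)).comap_le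

end Primitives

/-! ### Paths of multivariate counting processes -/

/-- The paths of a multivariate counting process: started at `0`, nondecreasing, and locally
constant to the right. Being a path space rather than a class of random processes, it makes
"restart at the first jump" a deterministic map. -/
structure IsJumpPath {Θ : Type*} (x : ℝ≥0 → Θ → ℕ) : Prop where
  zero : x 0 = 0
  mono : Monotone x
  right : ∀ t, ∀ᶠ s in 𝓝[≥] t, x s = x t

/-- The space of paths of multivariate counting processes, with the σ-algebra generated by the
evaluations. -/
abbrev JumpPath (Θ : Type*) := {x : ℝ≥0 → Θ → ℕ // IsJumpPath x}

namespace JumpPath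

variable {Θ : Type*}

lemma tendsto_add_left_nhdsGE (s t : ℝ≥0) :
    Tendsto (fun h => s + h) (𝓝[≥] t) (𝓝[≥] (s + t)) :=
  tendsto_nhdsWithin_iff.2 ⟨tendsto_nhdsWithin_of_tendsto_nhds (tendsto_id.const_add s),
    eventually_mem_nhdsWithin.mono fun _ hh => add_le_add_right hh s⟩

/-- The path after time `s`, restarted at `0`. -/
def shift (s : ℝ≥0) (x : JumpPath Θ) : JumpPath Θ :=
  ⟨fun h => x.1 (s + h) - x.1 s, by simp only [add_zero, tsub_self],
    fun _ _ hab => tsub_le_tsub_right (x.2.mono (add_le_add_right hab s)) _, fun t => by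
      filter_upwards [(tendsto_add_left_nhdsGE s t).eventually (x.2.right (s + t))] with h hh
      rw [hh]⟩

lemma shift_apply (s h : ℝ≥0) (x : JumpPath Θ) : (shift s x).1 h = x.1 (s + h) - x.1 s := rfl

/-- The time of the first jump, with the junk value `0` for the zero path. -/
def jumpTime (x : JumpPath Θ) : ℝ≥0 := sInf {t | x.1 t ≠ 0}

/-- The path after the first jump, restarted at `0`. -/
def next (x : JumpPath Θ) : JumpPath Θ := shift (jumpTime x) x

/-- The value of the path at its first jump; it is `0` exactly for the zero path. -/
def jump (x : JumpPath Θ) : Θ → ℕ := x.1 (jumpTime x)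

lemma apply_eq_zero_iff_lt_jumpTime {x : JumpPath Θ} (hx : ∃ t, x.1 t ≠ 0) {t : ℝ≥0} :
    x.1 t = 0 ↔ t < jumpTime x := by
  refine ⟨fun ht => ?_,
    fun ht => by_contra fun h => notMem_of_lt_csInf ht (OrderBot.bddBelow _) h⟩
  by_contra! hle
  have hzero : x.1 (jumpTime x) = 0 := le_antisymm (ht ▸ x.2.mono hle) zero_le
  have hright : ∀ᶠ s in 𝓝[>] jumpTime x, x.1 s = 0 := by
    filter_upwards [nhdsWithin_mono _ Set.Ioi_subset_Ici_self (x.2.right (jumpTime x))] with s hs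
    exact hs.trans hzero
  obtain ⟨s, hs, hlt⟩ := (hright.and self_mem_nhdsWithin).exists
  refine absurd (le_csInf hx fun u hu => ?_ : s ≤ jumpTime x) (not_le.2 hlt)
  by_contra! hus
  exact hu (le_antisymm (hs ▸ x.2.mono hus.le) zero_le)

lemma exists_ne_zero_of_jump_ne_zero {x : JumpPath Θ} (h : jump x ≠ 0) : ∃ t, x.1 t ≠ 0 := ⟨_, h⟩

lemma jumpTime_pos {x : JumpPath Θ} (hx : ∃ t, x.1 t ≠ 0) : 0 < jumpTime x :=
  (apply_eq_zero_iff_lt_jumpTime hx).1 x.2.zero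

lemma jumpTime_eq_zero {x : JumpPath Θ} (hx : ¬ ∃ t, x.1 t ≠ 0) : jumpTime x = 0 := by
  have hempty : {t | x.1 t ≠ 0} = ∅ := Set.eq_empty_of_forall_notMem fun t ht => hx ⟨t, ht⟩
  rw [jumpTime, hempty, NNReal.sInf_empty]

lemma measurable_eval (t : ℝ≥0) : Measurable fun x : JumpPath Θ => x.1 t :=
  (measurable_pi_apply t).comp measurable_subtype_coe

lemma tendsto_ceil_grid {u t : ℝ≥0} (hut : u ≤ t) :
    Tendsto (fun n : ℕ => u + (⌈(t - u) * (n + 1)⌉₊ : ℝ≥0) * (1 / ((n : ℝ≥0) + 1))) atTop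
      (𝓝[≥] t) := by
  have hle (n : ℕ) : t - u ≤ (⌈(t - u) * (n + 1)⌉₊ : ℝ≥0) * (1 / ((n : ℝ≥0) + 1)) := by
    rw [mul_one_div, le_div_iff₀ (by positivity)]
    exact Nat.le_ceil _
  have hge (n : ℕ) : (⌈(t - u) * (n + 1)⌉₊ : ℝ≥0) * (1 / ((n : ℝ≥0) + 1)) ≤
      t - u + 1 / ((n : ℝ≥0) + 1) := by
    rw [mul_one_div, div_le_iff₀ (by positivity), add_mul, one_div,
      inv_mul_cancel₀ (by positivity)]
    exact (Nat.ceil_lt_add_one zero_le).le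
  have hlim : Tendsto (fun n : ℕ => t - u + 1 / ((n : ℝ≥0) + 1)) atTop (𝓝 (t - u)) := by
    simpa only [add_zero] using tendsto_one_div_add_atTop_nhds_zero_nat.const_add (t - u)
  have hgrid := (tendsto_add_left_nhdsGE u (t - u)).comp (tendsto_nhdsWithin_iff.2
    ⟨tendsto_of_tendsto_of_tendsto_of_le_of_le tendsto_const_nhds hlim hle hge, .of_forall hle⟩)
  rwa [add_tsub_cancel_of_le hut] at hgrid

section Measurability

variable [Countable Θ] {α : Type*} [MeasurableSpace α]

lemma measurableSet_eval_eq (t : ℝ≥0) (c : Θ → ℕ) :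
    MeasurableSet {x : JumpPath Θ | x.1 t = c} :=
  measurable_eval t (measurableSet_singleton c)

lemma measurable_jumpTime : Measurable (jumpTime : JumpPath Θ → ℝ≥0) := by
  refine measurable_of_Ioi fun u => ?_
  have hpre : jumpTime ⁻¹' Set.Ioi u =
      {x : JumpPath Θ | x.1 u = 0} ∩ ⋃ n : ℕ, {x : JumpPath Θ | x.1 n = 0}ᶜ := by
    ext x
    simp only [Set.mem_preimage, Set.mem_Ioi, Set.mem_inter_iff, Set.mem_ofPred_eq, Set.mem_iUnion,
      Set.mem_compl_iff]
    by_cases hx : ∃ t, x.1 t ≠ 0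
    · obtain ⟨n, hn⟩ := exists_nat_ge (jumpTime x)
      rw [apply_eq_zero_iff_lt_jumpTime hx, and_iff_left]
      exact ⟨n, (apply_eq_zero_iff_lt_jumpTime hx).not.2 hn.not_gt⟩
    · rw [jumpTime_eq_zero hx]
      exact ⟨fun h => absurd h not_lt_zero, fun ⟨_, n, hn⟩ => absurd ⟨_, hn⟩ hx⟩
  rw [hpre]
  exact (measurableSet_eval_eq u 0).inter
    (MeasurableSet.iUnion fun n => (measurableSet_eval_eq _ 0).compl)

lemma measurable_eval_comp {f : α → JumpPath Θ} (hf : Measurable f) {T : α → ℝ≥0}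
    (hT : Measurable T) : Measurable fun a => (f a).1 (T a) := by
  refine measurable_of_tendsto_metrizable
    (f := fun (n : ℕ) a => (f a).1 (⌈T a * (n + 1)⌉₊ * (1 / ((n : ℝ≥0) + 1)))) (fun n => ?_)
    (tendsto_pi_nhds.2 fun a => ?_)
  · have hgrid : Measurable fun q : ℕ × α => (f q.2).1 (q.1 * (1 / ((n : ℝ≥0) + 1))) :=
      measurable_from_prod_countable_right fun m =>
        (measurable_eval ((m : ℝ≥0) * (1 / ((n : ℝ≥0) + 1)))).comp hf
    exact hgrid.comp ((Nat.measurable_ceil.comp (hT.mul_const _)).prodMk measurable_id)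
  · have hgrid := tendsto_ceil_grid (zero_le (a := T a))
    simp only [zero_add, tsub_zero] at hgrid
    exact tendsto_nhds_of_eventually_eq (hgrid.eventually ((f a).2.right (T a)))

lemma measurable_shift_comp {f : α → JumpPath Θ} (hf : Measurable f) {T : α → ℝ≥0}
    (hT : Measurable T) : Measurable fun a => shift (T a) (f a) := by
  refine Measurable.subtype_mk (measurable_pi_lambda _ fun h => measurable_pi_lambda _ fun θ => ?_)
  exact ((measurable_pi_apply θ).comp (measurable_eval_comp hf (hT.add_const h))).sub
    ((measurable_pi_apply θ).comp (measurable_eval_comp hf hT))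

lemma measurable_shift (s : ℝ≥0) : Measurable (shift s : JumpPath Θ → JumpPath Θ) :=
  measurable_shift_comp measurable_id measurable_const

lemma measurable_next : Measurable (next : JumpPath Θ → JumpPath Θ) :=
  measurable_shift_comp measurable_id measurable_jumpTime

lemma measurable_jump : Measurable (jump : JumpPath Θ → Θ → ℕ) :=
  measurable_eval_comp measurable_id measurable_jumpTime

end Measurability

/-- The time of the `n`-th jump, with `jumpEpoch x 0 = 0`. -/
def jumpEpoch (x : JumpPath Θ) (n : ℕ) : ℝ≥0 :=
  ∑ k ∈ Finset.range n, jumpTime (next^[k] x)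

lemma jumpEpoch_succ (x : JumpPath Θ) (n : ℕ) :
    jumpEpoch x (n + 1) = jumpEpoch x n + jumpTime (next^[n] x) :=
  Finset.sum_range_succ _ n

lemma iterate_next_apply (x : JumpPath Θ) (n : ℕ) (h : ℝ≥0) :
    (next^[n] x).1 h = x.1 (jumpEpoch x n + h) - x.1 (jumpEpoch x n) := by
  induction n generalizing h with
  | zero => simp [jumpEpoch, x.2.zero]
  | succ n ih =>
    have hmono : x.1 (jumpEpoch x n) ≤ x.1 (jumpEpoch x n + jumpTime (next^[n] x)) :=
      x.2.mono le_self_add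
    rw [Function.iterate_succ_apply', next, shift_apply, ih, ih, jumpEpoch_succ, ← add_assoc,
      tsub_tsub_tsub_cancel_right hmono]

lemma apply_jumpEpoch_succ (x : JumpPath Θ) (n : ℕ) :
    x.1 (jumpEpoch x (n + 1)) = x.1 (jumpEpoch x n) + jump (next^[n] x) := by
  rw [jump, iterate_next_apply, ← jumpEpoch_succ, add_tsub_cancel_of_le]
  exact x.2.mono (by rw [jumpEpoch_succ]; exact le_self_add)

lemma apply_le_of_lt_jumpEpoch_succ {x : JumpPath Θ} {n : ℕ} (hn : jump (next^[n] x) ≠ 0)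
    {s : ℝ≥0} (hs : s < jumpEpoch x (n + 1)) : x.1 s ≤ x.1 (jumpEpoch x n) := by
  rcases le_total s (jumpEpoch x n) with h | h
  · exact x.2.mono h
  · obtain ⟨r, rfl⟩ := exists_add_of_le h
    rw [jumpEpoch_succ, add_lt_add_iff_left] at hs
    have hzero := (apply_eq_zero_iff_lt_jumpTime (exists_ne_zero_of_jump_ne_zero hn)).2 hs
    rwa [iterate_next_apply, tsub_eq_zero_iff_le] at hzero

end JumpPath

/-! ### The law of a multivariate Poisson process -/

lemma map_restrict_apply {α β : Type*} [MeasurableSpace α] [MeasurableSpace β] {μ : Measure α}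
    {f : α → β} (hf : Measurable f) (A : Set α) {E : Set β} (hE : MeasurableSet E) :
    (μ.restrict A).map f E = μ {x | x ∈ A ∧ f x ∈ E} := by
  rw [Measure.map_apply hf hE, Measure.restrict_apply (hf hE), Set.inter_comm]
  rfl

namespace JumpPath

variable {Θ : Type*}

lemma shift_shift (s h : ℝ≥0) (x : JumpPath Θ) : shift h (shift s x) = shift (s + h) x := by
  ext1
  funext r
  have hmono : x.1 s ≤ x.1 (s + h) := x.2.mono le_self_add
  simp only [shift_apply, ← add_assoc, tsub_tsub_tsub_cancel_right hmono]

/-- The increments of a path over the first `k` cells of a partition of time. -/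
def increments (t : ℕ → ℝ≥0) (k : ℕ) (x : JumpPath Θ) : Fin k → Θ → ℕ :=
  fun i => x.1 (t (i + 1)) - x.1 (t i)

lemma measurable_increments (t : ℕ → ℝ≥0) (k : ℕ) :
    Measurable (increments t k : JumpPath Θ → Fin k → Θ → ℕ) :=
  measurable_pi_lambda _ fun _ => measurable_pi_lambda _ fun θ =>
    ((measurable_pi_apply θ).comp (measurable_eval _)).sub
      ((measurable_pi_apply θ).comp (measurable_eval _))

lemma increments_cons {t : ℕ → ℝ≥0} (ht : t 0 = 0) (k : ℕ) (s : ℝ≥0) (x : JumpPath Θ) :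
    increments (fun n => Nat.casesOn n 0 fun i => s + t i) (k + 1) x =
      Fin.cons (x.1 s) (increments t k (shift s x)) := by
  funext i
  cases i using Fin.cases with
  | zero => simp [increments, ht, x.2.zero]
  | succ i =>
    have hmono : x.1 s ≤ x.1 (s + t i) := x.2.mono le_self_add
    simp [increments, shift_apply, tsub_tsub_tsub_cancel_right hmono]

lemma sum_increments {t : ℕ → ℝ≥0} (htm : Monotone t) (ht₀ : t 0 = 0) {n k : ℕ} (hnk : n ≤ k)
    (x : JumpPath Θ) :
    ∑ i : Fin k, (if (i : ℕ) < n then increments t k x i else 0) = x.1 (t n) := by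
  have hfilter : {i ∈ Finset.range k | i < n} = Finset.range n := by
    ext i
    simp only [Finset.mem_filter, Finset.mem_range]
    omega
  simp only [increments]
  rw [← Finset.sum_range fun i => if i < n then x.1 (t (i + 1)) - x.1 (t i) else 0,
    ← Finset.sum_filter, hfilter,
    Finset.sum_range_tsub (f := fun i => x.1 (t i)) fun a b hab => x.2.mono (htm hab), ht₀,
    x.2.zero, tsub_zero]

lemma exists_restrict_eq_comp_increments (F : Finset ℝ≥0) :
    ∃ t : ℕ → ℝ≥0, Monotone t ∧ t 0 = 0 ∧ ∃ (k : ℕ) (g : (Fin k → Θ → ℕ) → F → Θ → ℕ),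
      Measurable g ∧ ∀ x : JumpPath Θ, F.restrict x.1 = g (increments t k x) := by
  obtain ⟨t, htm, ht₀, htF⟩ := exists_monotone_enum F
  choose! n hn using htF
  refine ⟨t, htm, ht₀, F.sup n,
    fun c s => ∑ i : Fin (F.sup n), if (i : ℕ) < n s then c i else 0, ?_, fun x => ?_⟩
  · refine measurable_pi_lambda _ fun s => Finset.measurable_fun_sum _ fun i _ => ?_
    split_ifs
    exacts [measurable_pi_apply i, measurable_const]
  · funext s
    refine Eq.trans ?_ (sum_increments htm ht₀ (Finset.le_sup s.2) x).symm
    rw [hn s s.2, Finset.restrict_def]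

theorem ext_of_map_increments {μ ν : Measure (JumpPath Θ)} [IsFiniteMeasure μ]
    (h : ∀ t : ℕ → ℝ≥0, Monotone t → t 0 = 0 → ∀ k,
      μ.map (increments t k) = ν.map (increments t k)) : μ = ν := by
  have hval : μ.map Subtype.val = ν.map Subtype.val := by
    refine IsProjectiveLimit.unique (P := fun F => (μ.map Subtype.val).map F.restrict)
      (fun _ => rfl) fun F => ?_
    obtain ⟨t, htm, ht₀, k, g, hg, hrestrict⟩ := exists_restrict_eq_comp_increments (Θ := Θ) F
    have hmap (m : Measure (JumpPath Θ)) :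
        (m.map Subtype.val).map F.restrict = (m.map (increments t k)).map g := by
      rw [Measure.map_map (by fun_prop) measurable_subtype_coe,
        Measure.map_map hg (measurable_increments t k)]
      exact congrArg m.map (funext hrestrict)
    dsimp only
    rw [hmap, hmap, h t htm ht₀ k]
  ext s hs
  obtain ⟨s, hs, rfl⟩ := hs
  rw [← Measure.map_apply measurable_subtype_coe hs, hval,
    Measure.map_apply measurable_subtype_coe hs]

/-- The law of a family of independent Poisson processes of rates `l θ`, described through its
finite-dimensional distributions. -/
def IsPoissonLaw [Fintype Θ] (l : Θ → ℝ≥0) (ρ : Measure (JumpPath Θ)) : Prop :=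
  ∀ t : ℕ → ℝ≥0, Monotone t → t 0 = 0 → ∀ k, ρ.map (increments t k) =
    Measure.pi fun i : Fin k => Measure.pi fun θ => poissonMeasure (l θ * (t (i + 1) - t i))

namespace IsPoissonLaw

variable [Fintype Θ] {l : Θ → ℝ≥0} {ρ : Measure (JumpPath Θ)}

lemma isProbabilityMeasure (h : IsPoissonLaw l ρ) : IsProbabilityMeasure ρ := by
  have hincr := h (fun _ => 0) monotone_const rfl 0
  have hprob : IsProbabilityMeasure (ρ.map (increments (fun _ => 0) 0)) := by
    rw [hincr]
    infer_instance
  exact Measure.isProbabilityMeasure_of_map (increments (fun _ => 0) 0)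

lemma measure_increments_eq (h : IsPoissonLaw l ρ) {t : ℕ → ℝ≥0} (htm : Monotone t)
    (ht₀ : t 0 = 0) (k : ℕ) (c : Fin k → Θ → ℕ) :
    ρ {x | increments t k x = c} =
      ∏ i : Fin k, ∏ θ, poissonMeasure (l θ * (t (i + 1) - t i)) {c i θ} := by
  have hpi := congrArg (fun m => m {c}) (h t htm ht₀ k)
  simp only [Measure.map_apply (measurable_increments t k) (measurableSet_singleton c),
    Measure.pi_singleton] at hpi
  exact hpi

lemma measure_eval_eq (h : IsPoissonLaw l ρ) (s : ℝ≥0) (c : Θ → ℕ) :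
    ρ {x | x.1 s = c} = ∏ θ, poissonMeasure (l θ * s) {c θ} := by
  have hmono : Monotone fun n : ℕ => if n = 0 then 0 else s :=
    monotone_nat_of_le_succ fun n => by by_cases hn : n = 0 <;> simp [hn]
  have hincr := h.measure_increments_eq hmono rfl 1 fun _ => c
  simpa [increments, funext_iff (f := fun _ : Fin 1 => _), (Subtype.prop _ : IsJumpPath _).zero]
    using hincr

theorem map_shift_restrict_eval_eq (h : IsPoissonLaw l ρ) (s : ℝ≥0) (c : Θ → ℕ) :
    (ρ.restrict {x | x.1 s = c}).map (shift s) = ρ {x | x.1 s = c} • ρ := by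
  have := h.isProbabilityMeasure
  refine ext_of_map_increments fun t htm ht₀ k => Measure.ext_of_singleton fun d => ?_
  have hmono : Monotone fun n => (Nat.casesOn n 0 fun i => s + t i : ℝ≥0) :=
    monotone_nat_of_le_succ fun n => by
      cases n with
      | zero => exact zero_le
      | succ n => exact add_le_add_right (htm (Nat.le_succ n)) s
  have hincr := h.measure_increments_eq hmono rfl (k + 1) (Fin.cons c d)
  simp only [increments_cons ht₀, Fin.cons_inj, Fin.prod_univ_succ] at hincr
  have hd := measurableSet_singleton d
  have hmeas := measurable_increments (Θ := Θ) t k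
  rw [Measure.map_apply hmeas hd, map_restrict_apply (measurable_shift s) _ (hmeas hd),
    Measure.map_apply hmeas hd, Measure.smul_apply, smul_eq_mul]
  refine hincr.trans (congrArg₂ (· * ·) ?_ ?_)
  · simp [h.measure_eval_eq, ht₀]
  · refine Eq.trans ?_ (h.measure_increments_eq htm ht₀ k d).symm
    simp [add_tsub_add_eq_tsub_left]

theorem measure_shift_mem (h : IsPoissonLaw l ρ) (s : ℝ≥0) (c : Θ → ℕ) {E : Set (JumpPath Θ)}
    (hE : MeasurableSet E) :
    ρ {x | x.1 s = c ∧ shift s x ∈ E} = ρ {x | x.1 s = c} * ρ E := by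
  refine (map_restrict_apply (measurable_shift s) {x | x.1 s = c} hE).symm.trans ?_
  rw [h.map_shift_restrict_eval_eq, Measure.smul_apply, smul_eq_mul]

lemma measure_eval_eq_zero (h : IsPoissonLaw l ρ) (s : ℝ≥0) :
    ρ {x | x.1 s = 0} = ENNReal.ofReal (Real.exp (-(∑ θ, l θ : ℝ≥0) * s)) := by
  rw [h.measure_eval_eq]
  simp only [Pi.zero_apply, poissonMeasure_singleton, pow_zero, Nat.factorial_zero, Nat.cast_one,
    mul_one, div_one]
  rw [← ENNReal.ofReal_prod_of_nonneg fun _ _ => (Real.exp_pos _).le, ← Real.exp_sum]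
  congr 2
  push_cast
  rw [neg_mul, Finset.sum_mul, Finset.sum_neg_distrib]

lemma measure_eval_eq_single [DecidableEq Θ] (h : IsPoissonLaw l ρ) (s : ℝ≥0) (θ : Θ) :
    ρ {x | x.1 s = Pi.single θ 1} =
      ENNReal.ofReal (l θ * (s * Real.exp (-(∑ θ, l θ : ℝ≥0) * s))) := by
  have hmass (θ' : Θ) : poissonMeasure (l θ' * s) {(Pi.single θ 1 : Θ → ℕ) θ'} =
      ENNReal.ofReal (Real.exp (-(l θ' * s : ℝ≥0)) * if θ' = θ then (l θ * s : ℝ) else 1) := by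
    rw [poissonMeasure_singleton]
    by_cases hθ : θ' = θ
    · subst hθ
      simp
    · simp [hθ]
  simp_rw [h.measure_eval_eq, hmass]
  rw [← ENNReal.ofReal_prod_of_nonneg fun _ _ => by positivity, Finset.prod_mul_distrib,
    ← Real.exp_sum, Finset.prod_ite_eq' Finset.univ θ, if_pos (Finset.mem_univ θ)]
  congr 1
  push_cast
  rw [neg_mul, Finset.sum_mul, Finset.sum_neg_distrib]
  ring

lemma ae_exists_ne_zero (h : IsPoissonLaw l ρ) (hl : 0 < ∑ θ, l θ) :
    ∀ᵐ x ∂ρ, ∃ t, x.1 t ≠ 0 := by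
  have hrate : Tendsto (fun n : ℕ => (∑ θ, l θ : ℝ≥0) * (n : ℝ)) atTop atTop :=
    tendsto_natCast_atTop_atTop.const_mul_atTop (by exact_mod_cast hl)
  have hlim : Tendsto (fun n : ℕ => ρ {x | x.1 (n : ℝ≥0) = 0}) atTop (𝓝 0) := by
    simp_rw [h.measure_eval_eq_zero, neg_mul]
    rw [← ENNReal.ofReal_zero]
    exact (ENNReal.continuous_ofReal.tendsto 0).comp
      (Real.tendsto_exp_atBot.comp (tendsto_neg_atTop_atBot.comp hrate))
  rw [ae_iff]
  refine le_antisymm (ge_of_tendsto' hlim fun n => measure_mono fun x hx => ?_) zero_le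
  simp only [not_exists, not_not, Set.mem_ofPred_eq] at hx ⊢
  exact hx _

end IsPoissonLaw

end JumpPath

/-! ### The first jump of a multivariate Poisson process -/

lemma tendsto_mul_exp_div_one_sub_exp {L : ℝ} (hL : 0 < L) :
    Tendsto (fun h : ℝ => h * Real.exp (-L * h) * (1 - Real.exp (-L * h))⁻¹) (𝓝[>] 0)
      (𝓝 (1 / L)) := by
  have hderiv : HasDerivAt (fun h : ℝ => 1 - Real.exp (-L * h)) L 0 := by
    simpa using (((hasDerivAt_id (0 : ℝ)).const_mul (-L)).exp).const_sub 1
  have hexp : Tendsto (fun h : ℝ => Real.exp (-L * h)) (𝓝[>] 0) (𝓝 1) := by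
    have hcont : Continuous fun h : ℝ => Real.exp (-L * h) := by fun_prop
    simpa using (hcont.tendsto 0).mono_left nhdsWithin_le_nhds
  refine (hexp.div hderiv.tendsto_slope_zero_right hL.ne').congr' ?_
  filter_upwards [self_mem_nhdsWithin] with h hh
  have hh : (0 : ℝ) < h := hh
  simp only [zero_add, mul_zero, Real.exp_zero, sub_self, sub_zero, smul_eq_mul, Pi.div_apply]
  field_simp

lemma tsum_ofReal_exp_mul {L h : ℝ} (hL : 0 < L) (hh : 0 < h) (u : ℝ) :
    ∑' m : ℕ, ENNReal.ofReal (Real.exp (-L * (u + m * h))) =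
      ENNReal.ofReal (Real.exp (-L * u) * (1 - Real.exp (-L * h))⁻¹) := by
  have hlt : Real.exp (-L * h) < 1 := Real.exp_lt_one_iff.2 (by nlinarith)
  have hterm (m : ℕ) : ENNReal.ofReal (Real.exp (-L * (u + m * h))) =
      ENNReal.ofReal (Real.exp (-L * u)) * ENNReal.ofReal (Real.exp (-L * h)) ^ m := by
    rw [← ENNReal.ofReal_pow (Real.exp_pos _).le, ← ENNReal.ofReal_mul (Real.exp_pos _).le,
      ← Real.exp_nat_mul, ← Real.exp_add]
    congr 2
    ring
  simp_rw [hterm]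
  rw [ENNReal.tsum_mul_left, ENNReal.tsum_geometric, ENNReal.ofReal_mul (Real.exp_pos _).le,
    ENNReal.ofReal_inv_of_pos (by linarith), ENNReal.ofReal_sub _ (Real.exp_pos _).le,
    ENNReal.ofReal_one]

lemma single_one_inj {Θ : Type*} [DecidableEq Θ] {θ θ' : Θ} :
    (Pi.single θ 1 : Θ → ℕ) = Pi.single θ' 1 ↔ θ = θ' := by
  refine ⟨fun h => ?_, fun h => h ▸ rfl⟩
  by_contra hne
  simpa [hne] using congrFun h θ

namespace JumpPath

variable {Θ : Type*} [DecidableEq Θ]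

/-- The discretization with mesh `h` of the event that the first jump occurs after time `u`, is a
unit jump of type `θ`, and is followed by a path in `E`: the first point of the grid `u + ℕ h` at
which the path is nonzero takes the place of the jump time. -/
def gridSet (θ : Θ) (u h : ℝ≥0) (E : Set (JumpPath Θ)) : Set (JumpPath Θ) :=
  ⋃ m : ℕ, {x | x.1 (u + m * h) = 0 ∧
    shift (u + m * h) x ∈ {y : JumpPath Θ | y.1 h = Pi.single θ 1 ∧ shift h y ∈ E}}

lemma mem_gridSet_iff {θ : Θ} {u h : ℝ≥0} {E : Set (JumpPath Θ)} {x : JumpPath Θ} :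
    x ∈ gridSet θ u h E ↔ ∃ m : ℕ, x.1 (u + m * h) = 0 ∧
      x.1 (u + (m + 1 : ℕ) * h) = Pi.single θ 1 ∧ shift (u + (m + 1 : ℕ) * h) x ∈ E := by
  simp only [gridSet, Set.mem_iUnion, Set.mem_ofPred_eq, shift_shift, shift_apply]
  refine exists_congr fun m => and_congr_right fun hzero => ?_
  have hsucc : u + (m + 1 : ℕ) * h = u + m * h + h := by
    push_cast
    ring
  rw [hzero, tsub_zero, hsucc]

lemma pairwise_disjoint_gridSet (θ : Θ) (u h : ℝ≥0) (E : Set (JumpPath Θ)) :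
    Pairwise (Function.onFun Disjoint fun m : ℕ => {x : JumpPath Θ | x.1 (u + m * h) = 0 ∧
      shift (u + m * h) x ∈ {y : JumpPath Θ | y.1 h = Pi.single θ 1 ∧ shift h y ∈ E}}) := by
  refine (pairwise_disjoint_on _).2 fun m n hmn => Set.disjoint_left.2 ?_
  rintro x ⟨hm, hjump, -⟩ ⟨hn, -⟩
  rw [shift_apply, hm, tsub_zero] at hjump
  have hle : x.1 (u + m * h + h) ≤ x.1 (u + n * h) := by
    refine x.2.mono ?_
    rw [add_assoc, ← add_one_mul]
    gcongr
    exact_mod_cast hmn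
  rw [hjump, hn] at hle
  simpa using hle θ

section Grid

variable {x : JumpPath Θ} (hx : ∃ t, x.1 t ≠ 0)
include hx

omit [DecidableEq Θ] in
lemma apply_grid_eq_zero_iff (u : ℝ≥0) (n m : ℕ) :
    x.1 (u + m * (1 / ((n : ℝ≥0) + 1))) = 0 ↔ m < ⌈(jumpTime x - u) * (n + 1)⌉₊ := by
  rw [apply_eq_zero_iff_lt_jumpTime hx, Nat.lt_ceil, ← lt_tsub_iff_left, mul_one_div,
    div_lt_iff₀ (by positivity)]

lemma mem_gridSet_iff_of_lt_jumpTime {u : ℝ≥0} (hu : u < jumpTime x) (θ : Θ) (n : ℕ)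
    (E : Set (JumpPath Θ)) :
    x ∈ gridSet θ u (1 / ((n : ℝ≥0) + 1)) E ↔
      x.1 (u + ⌈(jumpTime x - u) * (n + 1)⌉₊ * (1 / ((n : ℝ≥0) + 1))) = Pi.single θ 1 ∧
        shift (u + ⌈(jumpTime x - u) * (n + 1)⌉₊ * (1 / ((n : ℝ≥0) + 1))) x ∈ E := by
  have hzero := apply_grid_eq_zero_iff hx u n
  have hpos : 0 < ⌈(jumpTime x - u) * (n + 1)⌉₊ :=
    Nat.ceil_pos.2 (mul_pos (tsub_pos_of_lt hu) (by positivity))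
  rw [mem_gridSet_iff]
  constructor
  · rintro ⟨m, hm, hjump, hE⟩
    have hceil : m + 1 = ⌈(jumpTime x - u) * (n + 1)⌉₊ := by
      refine le_antisymm ((hzero m).1 hm) (not_lt.1 fun hlt => ?_)
      rw [(hzero _).2 hlt] at hjump
      simpa using congrFun hjump θ
    exact hceil ▸ ⟨hjump, hE⟩
  · refine fun h => ⟨⌈(jumpTime x - u) * (n + 1)⌉₊ - 1, (hzero _).2 (by omega), ?_⟩
    rwa [Nat.sub_add_cancel hpos]

lemma eventually_mem_gridSet_iff (θ : Θ) (u : ℝ≥0) (t : ℕ → ℝ≥0) (k : ℕ)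
    (A : Set (Fin k → Θ → ℕ)) :
    ∀ᶠ n : ℕ in atTop, x ∈ gridSet θ u (1 / ((n : ℝ≥0) + 1)) (increments t k ⁻¹' A) ↔
      u < jumpTime x ∧ jump x = Pi.single θ 1 ∧ next x ∈ increments t k ⁻¹' A := by
  rcases le_or_gt (jumpTime x) u with hu | hu
  · refine Eventually.of_forall fun n => iff_of_false ?_ fun h => absurd h.1 (not_lt.2 hu)
    rw [mem_gridSet_iff]
    rintro ⟨m, hm, -⟩
    exact absurd ((apply_eq_zero_iff_lt_jumpTime hx).1 hm) (not_lt.2 (hu.trans le_self_add))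
  have hright (s : ℝ≥0) : ∀ᶠ n : ℕ in atTop,
      x.1 (u + (⌈(jumpTime x - u) * (n + 1)⌉₊ : ℝ≥0) * (1 / ((n : ℝ≥0) + 1)) + s) =
        x.1 (jumpTime x + s) := by
    have hgrid := ((tendsto_add_left_nhdsGE s (jumpTime x)).comp
      (tendsto_ceil_grid hu.le)).eventually (x.2.right (s + jumpTime x))
    simpa only [Function.comp_apply, add_comm s] using hgrid
  have hcells : ∀ᶠ n : ℕ in atTop, ∀ i ∈ Set.Iio (k + 1),
      x.1 (u + (⌈(jumpTime x - u) * (n + 1)⌉₊ : ℝ≥0) * (1 / ((n : ℝ≥0) + 1)) + t i) =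
        x.1 (jumpTime x + t i) :=
    (Set.finite_Iio (k + 1)).eventually_all.2 fun i _ => hright (t i)
  filter_upwards [hright 0, hcells] with n hjump hcells
  rw [add_zero, add_zero] at hjump
  have hincr : increments t k (shift (u + (⌈(jumpTime x - u) * (n + 1)⌉₊ : ℝ≥0) *
      (1 / ((n : ℝ≥0) + 1))) x) = increments t k (next x) := by
    funext i
    simp only [increments, next, shift_apply]
    rw [hcells _ (Nat.lt_succ_of_lt i.2), hcells _ (Nat.succ_lt_succ i.2), hjump]
  rw [mem_gridSet_iff_of_lt_jumpTime hx hu, Set.mem_preimage, hincr, hjump]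
  exact (and_iff_right hu).symm

end Grid

lemma pairwise_disjoint_jump_eq_single :
    Pairwise (Function.onFun Disjoint fun θ => {x : JumpPath Θ | jump x = Pi.single θ 1}) := by
  refine fun θ θ' hne => Set.disjoint_left.2 fun x (hθ : jump x = _) (hθ' : jump x = _) => ?_
  exact hne (single_one_inj.1 (hθ.symm.trans hθ'))

omit [DecidableEq Θ] in
lemma measurableSet_shift_mem [Countable Θ] (s : ℝ≥0) (c : Θ → ℕ) {E : Set (JumpPath Θ)}
    (hE : MeasurableSet E) : MeasurableSet {x : JumpPath Θ | x.1 s = c ∧ shift s x ∈ E} :=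
  (measurableSet_eval_eq s c).inter (measurable_shift s hE)

lemma measurableSet_gridSet [Countable Θ] (θ : Θ) (u h : ℝ≥0) {E : Set (JumpPath Θ)}
    (hE : MeasurableSet E) : MeasurableSet (gridSet θ u h E) :=
  MeasurableSet.iUnion fun _ => measurableSet_shift_mem _ _ (measurableSet_shift_mem _ _ hE)

omit [DecidableEq Θ] in
lemma measurableSet_jump_eq [Countable Θ] (c : Θ → ℕ) :
    MeasurableSet {x : JumpPath Θ | jump x = c} :=
  measurable_jump (measurableSet_singleton c)

lemma measurableSet_jump_next [Countable Θ] (θ : Θ) (u : ℝ≥0) {E : Set (JumpPath Θ)}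
    (hE : MeasurableSet E) :
    MeasurableSet {x : JumpPath Θ | u < jumpTime x ∧ jump x = Pi.single θ 1 ∧ next x ∈ E} :=
  (measurable_jumpTime measurableSet_Ioi).inter
    ((measurableSet_jump_eq _).inter (measurable_next hE))

namespace IsPoissonLaw

variable [Fintype Θ] {l : Θ → ℝ≥0} {ρ : Measure (JumpPath Θ)}

theorem measure_gridSet (hρ : IsPoissonLaw l ρ) (hl : 0 < ∑ θ, l θ) (θ : Θ) (u : ℝ≥0) {h : ℝ≥0}
    (hh : 0 < h) {E : Set (JumpPath Θ)} (hE : MeasurableSet E) :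
    ρ (gridSet θ u h E) = ENNReal.ofReal (Real.exp (-(∑ θ, l θ : ℝ≥0) * u) * l θ *
      (h * Real.exp (-(∑ θ, l θ : ℝ≥0) * h) * (1 - Real.exp (-(∑ θ, l θ : ℝ≥0) * h))⁻¹)) *
        ρ E := by
  have hL : (0 : ℝ) < (∑ θ, l θ : ℝ≥0) := by exact_mod_cast hl
  have hh : (0 : ℝ) < h := by exact_mod_cast hh
  have hlt : Real.exp (-(∑ θ, l θ : ℝ≥0) * h) < 1 :=
    Real.exp_lt_one_iff.2 (by linarith [mul_pos hL hh])
  have : 0 ≤ (1 - Real.exp (-(∑ θ, l θ : ℝ≥0) * h))⁻¹ := inv_nonneg.2 (by linarith)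
  rw [gridSet, measure_iUnion (pairwise_disjoint_gridSet θ u h E) fun _ =>
    measurableSet_shift_mem _ _ (measurableSet_shift_mem _ _ hE)]
  simp_rw [hρ.measure_shift_mem _ _ (measurableSet_shift_mem h _ hE), hρ.measure_shift_mem h _ hE,
    hρ.measure_eval_eq_zero, hρ.measure_eval_eq_single]
  rw [ENNReal.tsum_mul_right]
  simp only [NNReal.coe_add, NNReal.coe_mul, NNReal.coe_natCast]
  rw [tsum_ofReal_exp_mul hL hh, ← mul_assoc, ← ENNReal.ofReal_mul (by positivity)]
  congr 2
  ring

lemma measure_jump_next_increments (hρ : IsPoissonLaw l ρ) (hl : 0 < ∑ θ, l θ) (θ : Θ)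
    (u : ℝ≥0) (t : ℕ → ℝ≥0) (k : ℕ) {A : Set (Fin k → Θ → ℕ)} (hA : MeasurableSet A) :
    ρ {x | u < jumpTime x ∧ jump x = Pi.single θ 1 ∧ next x ∈ increments t k ⁻¹' A} =
      ENNReal.ofReal (l θ / (∑ θ, l θ : ℝ≥0) * Real.exp (-(∑ θ, l θ : ℝ≥0) * u)) *
        ρ (increments t k ⁻¹' A) := by
  have := hρ.isProbabilityMeasure
  have hE := measurable_increments t k hA
  have hmesh (n : ℕ) : 0 < 1 / ((n : ℝ≥0) + 1) := by positivity
  have hmesh_lim : Tendsto (fun n : ℕ => ((1 / ((n : ℝ≥0) + 1) : ℝ≥0) : ℝ)) atTop (𝓝[>] 0) := by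
    refine tendsto_nhdsWithin_iff.2 ⟨?_, Eventually.of_forall fun n => by exact_mod_cast hmesh n⟩
    push_cast
    exact tendsto_one_div_add_atTop_nhds_zero_nat
  have hrate : (l θ / (∑ θ, l θ : ℝ≥0) * Real.exp (-(∑ θ, l θ : ℝ≥0) * u) : ℝ) =
      Real.exp (-(∑ θ, l θ : ℝ≥0) * u) * l θ * (1 / (∑ θ, l θ : ℝ≥0)) := by ring
  refine tendsto_nhds_unique (tendsto_measure_of_ae_tendsto_indicator atTop
    (measurableSet_jump_next θ u hE) (fun n : ℕ => measurableSet_gridSet θ u _ hE)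
    MeasurableSet.univ (measure_ne_top _ _) (Eventually.of_forall fun _ => Set.subset_univ _)
    ((hρ.ae_exists_ne_zero hl).mono fun x hx => eventually_mem_gridSet_iff hx θ u t k A)) ?_
  simp_rw [fun n => hρ.measure_gridSet hl θ u (hmesh n) hE]
  refine ENNReal.Tendsto.mul_const ((ENNReal.continuous_ofReal.tendsto _).comp ?_)
    (Or.inr (measure_ne_top _ _))
  rw [hrate]
  exact ((tendsto_mul_exp_div_one_sub_exp (by exact_mod_cast hl)).comp hmesh_lim).const_mul _

theorem map_next_restrict (hρ : IsPoissonLaw l ρ) (hl : 0 < ∑ θ, l θ) (θ : Θ) (u : ℝ≥0) :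
    (ρ.restrict {x | u < jumpTime x ∧ jump x = Pi.single θ 1}).map next =
      ENNReal.ofReal (l θ / (∑ θ, l θ : ℝ≥0) * Real.exp (-(∑ θ, l θ : ℝ≥0) * u)) • ρ := by
  have := hρ.isProbabilityMeasure
  refine ext_of_map_increments fun t _ _ k => Measure.ext fun A hA => ?_
  have hE := measurable_increments t k hA
  rw [Measure.map_apply (measurable_increments t k) hA, map_restrict_apply measurable_next _ hE,
    Measure.map_apply (measurable_increments t k) hA, Measure.smul_apply, smul_eq_mul,
    ← hρ.measure_jump_next_increments hl θ u t k hA]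
  simp only [Set.mem_ofPred_eq, and_assoc]

lemma map_jumpTime_restrict (hρ : IsPoissonLaw l ρ) (hl : 0 < ∑ θ, l θ) (θ : Θ)
    {E : Set (JumpPath Θ)} (hE : MeasurableSet E) :
    (ρ.restrict {x | jump x = Pi.single θ 1 ∧ next x ∈ E}).map (fun x => (jumpTime x : ℝ)) =
      (ENNReal.ofReal (l θ / (∑ θ, l θ : ℝ≥0)) * ρ E) • expMeasure (∑ θ, l θ : ℝ≥0) := by
  have := hρ.isProbabilityMeasure
  have hL : (0 : ℝ) < (∑ θ, l θ : ℝ≥0) := by exact_mod_cast hl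
  refine measure_ext_of_Ioi fun u => ?_
  have hset : {x : JumpPath Θ | x ∈ {x | jump x = Pi.single θ 1 ∧ next x ∈ E} ∧
        (jumpTime x : ℝ) ∈ Set.Ioi u} =
      {x | x ∈ {x | u.toNNReal < jumpTime x ∧ jump x = Pi.single θ 1} ∧ next x ∈ E} := by
    ext x
    simp only [Set.mem_ofPred_eq, Set.mem_Ioi]
    rw [and_comm, and_assoc]
    refine and_congr_left fun hx => ?_
    have hpos : 0 < jumpTime x :=
      jumpTime_pos (exists_ne_zero_of_jump_ne_zero (by simp [hx.1]))
    rw [← NNReal.coe_lt_coe, Real.coe_toNNReal', max_lt_iff]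
    exact (and_iff_left (by exact_mod_cast hpos)).symm
  rw [map_restrict_apply measurable_jumpTime.coe_nnreal_real _ measurableSet_Ioi, hset,
    ← map_restrict_apply measurable_next _ hE, hρ.map_next_restrict hl, Measure.smul_apply,
    Measure.smul_apply, smul_eq_mul, smul_eq_mul, ENNReal.ofReal_mul (by positivity)]
  rcases lt_or_ge u 0 with hu | hu
  · rw [expMeasure_Ioi_of_neg hL hu, Real.toNNReal_of_nonpos hu.le]
    simp
  · rw [expMeasure_Ioi hL hu, Real.coe_toNNReal _ hu, neg_mul]
    ring

theorem map_jumpTime_next (hρ : IsPoissonLaw l ρ) (hl : 0 < ∑ θ, l θ) (θ : Θ) :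
    (ρ.restrict {x | jump x = Pi.single θ 1}).map (fun x => ((jumpTime x : ℝ), next x)) =
      ENNReal.ofReal (l θ / (∑ θ, l θ : ℝ≥0)) • (expMeasure (∑ θ, l θ : ℝ≥0)).prod ρ := by
  have := hρ.isProbabilityMeasure
  refine Measure.ext_prod fun {s E} hs hE => ?_
  have hmarg := congrArg (fun m => m s) (hρ.map_jumpTime_restrict hl θ hE)
  rw [map_restrict_apply measurable_jumpTime.coe_nnreal_real _ hs, Measure.smul_apply,
    smul_eq_mul] at hmarg
  rw [map_restrict_apply (measurable_jumpTime.coe_nnreal_real.prodMk measurable_next) _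
    (hs.prod hE), Measure.smul_apply, smul_eq_mul, Measure.prod_prod, mul_comm (expMeasure _ s),
    ← mul_assoc, ← hmarg]
  congr 1
  ext x
  simp only [Set.mem_ofPred_eq, Set.mem_prod]
  tauto

lemma measure_jump_eq_single (hρ : IsPoissonLaw l ρ) (hl : 0 < ∑ θ, l θ) (θ : Θ) :
    ρ {x | jump x = Pi.single θ 1} = ENNReal.ofReal (l θ / (∑ θ, l θ : ℝ≥0)) := by
  have := hρ.isProbabilityMeasure
  have := isProbabilityMeasure_expMeasure (r := (∑ θ, l θ : ℝ≥0)) (by exact_mod_cast hl)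
  have huniv := congrArg (fun m => m Set.univ) (hρ.map_jumpTime_next hl θ)
  simpa only [map_restrict_apply (measurable_jumpTime.coe_nnreal_real.prodMk measurable_next) _
    MeasurableSet.univ, Measure.smul_apply, measure_univ, smul_eq_mul, mul_one, Set.mem_univ,
    and_true, Set.mem_ofPred_eq] using huniv

lemma ae_exists_jump_eq_single (hρ : IsPoissonLaw l ρ) (hl : 0 < ∑ θ, l θ) :
    ∀ᵐ x ∂ρ, ∃ θ, jump x = Pi.single θ 1 := by
  have := hρ.isProbabilityMeasure
  have hL : (∑ θ, l θ : ℝ≥0) ≠ (0 : ℝ) := by exact_mod_cast hl.ne'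
  have hmeas (θ : Θ) := measurableSet_jump_eq (Pi.single θ 1)
  have hprob : ρ (⋃ θ, {x | jump x = Pi.single θ 1}) = 1 := by
    rw [measure_iUnion pairwise_disjoint_jump_eq_single hmeas, tsum_fintype]
    simp_rw [hρ.measure_jump_eq_single hl]
    rw [← ENNReal.ofReal_sum_of_nonneg fun _ _ => by positivity, ← Finset.sum_div,
      ← NNReal.coe_sum, div_self hL, ENNReal.ofReal_one]
  filter_upwards [(mem_ae_iff_prob_eq_one (MeasurableSet.iUnion hmeas)).2 hprob] with x hx
  exact Set.mem_iUnion.1 hx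

theorem lintegral_jump (hρ : IsPoissonLaw l ρ) (hl : 0 < ∑ θ, l θ)
    {G : ℝ → (Θ → ℕ) → JumpPath Θ → ℝ≥0∞}
    (hG : ∀ c, Measurable fun q : ℝ × JumpPath Θ => G q.1 c q.2) :
    ∫⁻ x, G (jumpTime x) (jump x) (next x) ∂ρ = ∑ θ, ENNReal.ofReal (l θ / (∑ θ, l θ : ℝ≥0)) *
      ∫⁻ q, G q.1 (Pi.single θ 1) q.2 ∂(expMeasure (∑ θ, l θ : ℝ≥0)).prod ρ := by
  have hmeas (θ : Θ) := measurableSet_jump_eq (Pi.single θ 1)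
  have hrestrict : ρ.restrict (⋃ θ, {x | jump x = Pi.single θ 1}) = ρ :=
    Measure.restrict_eq_self_of_ae_mem
      ((hρ.ae_exists_jump_eq_single hl).mono fun _ hx => Set.mem_iUnion.2 hx)
  conv_lhs => rw [← hrestrict]
  rw [lintegral_iUnion hmeas pairwise_disjoint_jump_eq_single, tsum_fintype]
  refine Finset.sum_congr rfl fun θ _ => ?_
  rw [setLIntegral_congr_fun (g := fun x => G (jumpTime x) (Pi.single θ 1) (next x)) (hmeas θ)
    fun x (hx : jump x = _) => by simp only [hx], ← smul_eq_mul, ← lintegral_smul_measure,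
    ← hρ.map_jumpTime_next hl, lintegral_map (hG _)
      (measurable_jumpTime.coe_nnreal_real.prodMk measurable_next)]

end IsPoissonLaw

end JumpPath

/-! ### The workload seen by successive arrivals -/

lemma measurePreserving_prod_left_comm {α β γ : Type*} [MeasurableSpace α] [MeasurableSpace β]
    [MeasurableSpace γ] (μ : Measure α) (ν : Measure β) (κ : Measure γ) [SFinite μ] [SFinite ν]
    [SFinite κ] :
    MeasurePreserving (fun p : α × β × γ => (p.2.1, p.1, p.2.2)) (μ.prod (ν.prod κ))
      (ν.prod (μ.prod κ)) :=
  ((measurePreserving_prodAssoc ν μ κ).comp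
    (Measure.measurePreserving_swap.prod (.id κ))).comp (measurePreserving_prodAssoc μ ν κ).symm

lemma measurePreserving_prod_regroup {α β γ δ ε : Type*} [MeasurableSpace α] [MeasurableSpace β]
    [MeasurableSpace γ] [MeasurableSpace δ] [MeasurableSpace ε] (μ : Measure α) (ν : Measure β)
    (κ : Measure γ) (τ : Measure δ) (ξ : Measure ε) [SFinite μ] [SFinite ν] [SFinite κ]
    [SFinite τ] [SFinite ξ] :
    MeasurePreserving (fun p : (α × β × γ) × δ × ε =>
        ((p.1.2.1, p.1.1, p.2.1), (p.1.2.2, p.2.2)))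
      ((μ.prod (ν.prod κ)).prod (τ.prod ξ)) ((ν.prod (μ.prod τ)).prod (κ.prod ξ)) := by
  have hflatten := ((MeasurePreserving.id ν).prod (measurePreserving_prodAssoc μ κ _)).comp
    ((measurePreserving_prodAssoc ν (μ.prod κ) (τ.prod ξ)).comp
      ((measurePreserving_prod_left_comm μ ν κ).prod (.id (τ.prod ξ))))
  have hswap := (MeasurePreserving.id ν).prod
    ((MeasurePreserving.id μ).prod (measurePreserving_prod_left_comm κ τ ξ))
  have hgroup := (measurePreserving_prodAssoc ν (μ.prod τ) (κ.prod ξ)).symm.comp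
    ((MeasurePreserving.id ν).prod (measurePreserving_prodAssoc μ τ (κ.prod ξ)).symm)
  exact hgroup.comp (hswap.comp hflatten)

lemma sum_ofReal_mul_decide_eq {Θ : Type*} [Fintype Θ] [DecidableEq Θ] {w : Θ → ℝ}
    (hw₀ : ∀ θ, 0 ≤ w θ) (hw₁ : ∑ θ, w θ = 1) (θ : Θ) (g : Bool → ℝ≥0∞) :
    ∑ θ', ENNReal.ofReal (w θ') * g (decide (θ' = θ)) =
      ENNReal.ofReal (w θ) * g true + ENNReal.ofReal (1 - w θ) * g false := by
  have hrest : ∑ θ' ∈ Finset.univ.erase θ, w θ' = 1 - w θ := by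
    rw [eq_sub_iff_add_eq', Finset.add_sum_erase _ _ (Finset.mem_univ θ), hw₁]
  rw [← Finset.add_sum_erase _ _ (Finset.mem_univ θ), decide_eq_true rfl, ← hrest,
    ENNReal.ofReal_sum_of_nonneg fun _ _ => hw₀ _, Finset.sum_mul]
  congr 1
  exact Finset.sum_congr rfl fun θ' hθ' => by rw [decide_eq_false (Finset.ne_of_mem_erase hθ')]

lemma sum_div_sum_eq_one {Θ : Type*} [Fintype Θ] {l : Θ → ℝ≥0} (hl : 0 < ∑ θ, l θ) :
    ∑ θ, (l θ : ℝ) / (∑ θ, l θ : ℝ≥0) = 1 := by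
  rw [← Finset.sum_div, ← NNReal.coe_sum]
  exact div_self (by exact_mod_cast hl.ne')

lemma div_sum_le_one {Θ : Type*} [Fintype Θ] (l : Θ → ℝ≥0) (θ : Θ) :
    (l θ : ℝ) / (∑ θ, l θ : ℝ≥0) ≤ 1 := by
  refine div_le_one_of_le₀ ?_ (NNReal.coe_nonneg _)
  exact_mod_cast Finset.single_le_sum (fun _ _ => zero_le) (Finset.mem_univ θ)

/-- A sequence split into its first term and the remaining ones. -/
def headTail {α : Type*} (s : ℕ → α) : α × (ℕ → α) := (s 0, fun n => s (n + 1))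

@[fun_prop]
lemma measurable_headTail {α : Type*} [MeasurableSpace α] :
    Measurable (headTail : (ℕ → α) → α × (ℕ → α)) := by
  unfold headTail
  fun_prop

lemma measurePreserving_headTail {α Ω : Type*} [MeasurableSpace α] [MeasurableSpace Ω]
    {P : Measure Ω} {μ : Measure α} [IsProbabilityMeasure μ]
    {Y : ℕ → Ω → α} (hY : iIndepFun Y P) (hm : ∀ n, Measurable (Y n))
    (hlaw : ∀ n, HasLaw (Y n) μ P) :
    MeasurePreserving headTail (P.map fun ω n => Y n ω) (μ.prod (P.map fun ω n => Y n ω)) := by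
  have := hY.isProbabilityMeasure
  have htail : Measurable fun ω n => Y (n + 1) ω := measurable_pi_lambda _ fun n => hm (n + 1)
  have hshift : iIndepFun (fun n => Y (n + 1)) P := hY.precomp (add_left_injective 1)
  have hindep : IndepFun (Y 0) (fun ω n => Y (n + 1) ω) P := by
    refine indep_of_indep_of_le (indep_iSup_of_disjoint (fun n => (hm n).comap_le) hY.iIndep
      (S := {0}) (T := Set.range fun n => n + 1) (by simp)) (by simp) ?_
    rw [iSup_range]
    refine Measurable.comap_le (@measurable_pi_lambda _ _ _ (_) _ _ fun n => ?_)
    exact (comap_measurable (Y (n + 1))).mono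
      (le_iSup (fun n => MeasurableSpace.comap (Y (n + 1)) inferInstance) n) le_rfl
  refine ⟨measurable_headTail, ?_⟩
  rw [Measure.map_map measurable_headTail (measurable_pi_lambda _ hm)]
  refine ((indepFun_iff_map_prod_eq_prod_map_map (hm 0).aemeasurable htail.aemeasurable).1
    hindep).trans ?_
  rw [(hlaw 0).map_eq,
    (hshift.hasLaw_infinitePi (fun n => hlaw (n + 1)) htail.aemeasurable).map_eq,
    (hY.hasLaw_infinitePi hlaw (measurable_pi_lambda _ hm).aemeasurable).map_eq]

namespace JumpPath

variable {Θ : Type*} [Fintype Θ] [DecidableEq Θ]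

/-- Whether the first jump of the path is a unit jump of type `θ`. -/
def mark (θ : Θ) (x : JumpPath Θ) : Bool := decide (jump x = Pi.single θ 1)

/-- The slot of the next arrival at the server, as seen by the queue of type `θ`: the time until
the arrival, whether it is of type `θ`, and the next unused service time of that type. -/
def slot (θ : Θ) (y : JumpPath Θ × (ℕ → ℝ)) : ℝ × Bool × ℝ :=
  (jumpTime y.1, mark θ y.1, y.2 0)

/-- The future arrivals and the unused service times of type `θ` after the next arrival. -/
def advance (θ : Θ) (y : JumpPath Θ × (ℕ → ℝ)) : JumpPath Θ × (ℕ → ℝ) :=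
  (next y.1, if mark θ y.1 then (headTail y.2).2 else y.2)

/-- The workload of the queue of type `θ` just after the first `n` arrivals at the server. -/
def workload (θ : Θ) (y : JumpPath Θ × (ℕ → ℝ)) : ℕ → ℝ
  | 0 => 0
  | n + 1 => workloadStep (workload θ y n, slot θ ((advance θ)^[n] y))

lemma fst_iterate_advance (θ : Θ) (y : JumpPath Θ × (ℕ → ℝ)) (n : ℕ) :
    ((advance θ)^[n] y).1 = next^[n] y.1 :=
  (Function.Semiconj.iterate_right (f := Prod.fst) (ga := advance θ) (gb := next)
    (fun _ => rfl) n) y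

@[fun_prop]
lemma measurable_mark (θ : Θ) : Measurable (mark θ) :=
  (measurable_of_countable fun c : Θ → ℕ => decide (c = Pi.single θ 1)).comp measurable_jump

lemma measurableSet_setOf_mark {α : Type*} [MeasurableSpace α] (θ : Θ) {f : α → JumpPath Θ}
    (hf : Measurable f) : MeasurableSet {a | mark θ (f a) = true} :=
  (measurable_mark θ).comp hf (measurableSet_singleton true)

@[fun_prop]
lemma measurable_slot (θ : Θ) : Measurable (slot θ) :=
  (measurable_jumpTime.comp measurable_fst).coe_nnreal_real.prodMk (by fun_prop)

@[fun_prop]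
lemma measurable_advance (θ : Θ) : Measurable (advance θ) :=
  (measurable_next.comp measurable_fst).prodMk
    (.ite (measurableSet_setOf_mark θ measurable_fst) (by fun_prop) measurable_snd)

@[fun_prop]
lemma measurable_workload (θ : Θ) (n : ℕ) : Measurable fun y => workload θ y n := by
  induction n with
  | zero => exact measurable_const
  | succ n ih =>
    exact measurable_workloadStep.comp
      (ih.prodMk ((measurable_slot θ).comp ((measurable_advance θ).iterate n)))

namespace IsPoissonLaw

variable {l : Θ → ℝ≥0} {ρ : Measure (JumpPath Θ)}

theorem measurePreserving_mark_jump (hρ : IsPoissonLaw l ρ) (hl : 0 < ∑ θ, l θ) (θ : Θ) :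
    MeasurePreserving (fun x => (mark θ x, (jumpTime x : ℝ), next x)) ρ
      ((mixture (l θ / (∑ θ, l θ : ℝ≥0)) (Measure.dirac true) (Measure.dirac false)).prod
        ((expMeasure (∑ θ, l θ : ℝ≥0)).prod ρ)) := by
  have := hρ.isProbabilityMeasure
  have := isProbabilityMeasure_expMeasure (r := (∑ θ, l θ : ℝ≥0)) (by exact_mod_cast hl)
  have hmeas : Measurable fun x : JumpPath Θ => (mark θ x, (jumpTime x : ℝ), next x) :=
    (measurable_mark θ).prodMk (measurable_jumpTime.coe_nnreal_real.prodMk measurable_next)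
  refine ⟨hmeas, Measure.ext_of_lintegral _ fun F hF => ?_⟩
  rw [lintegral_map hF hmeas, lintegral_prod _ hF.aemeasurable, lintegral_mixture, lintegral_dirac,
    lintegral_dirac, ← sum_ofReal_mul_decide_eq (fun _ => by positivity) (sum_div_sum_eq_one hl) θ
      fun b => ∫⁻ q, F (b, q) ∂(expMeasure (∑ θ, l θ : ℝ≥0)).prod ρ]
  refine (hρ.lintegral_jump hl (G := fun a c x => F (decide (c = Pi.single θ 1), a, x))
    fun _ => by fun_prop).trans ?_
  simp only [single_one_inj]

omit [DecidableEq Θ] in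
lemma measurePreserving_next (hρ : IsPoissonLaw l ρ) (hl : 0 < ∑ θ, l θ) :
    MeasurePreserving next ρ ρ := by
  classical
  have := hρ.isProbabilityMeasure
  have := isProbabilityMeasure_expMeasure (r := (∑ θ, l θ : ℝ≥0)) (by exact_mod_cast hl)
  obtain ⟨θ, -, -⟩ := Finset.exists_ne_zero_of_sum_ne_zero hl.ne'
  have := isProbabilityMeasure_mixture (μ := Measure.dirac true) (ν := Measure.dirac false)
    (w := l θ / (∑ θ, l θ : ℝ≥0)) (by positivity) (div_sum_le_one l θ)
  exact (measurePreserving_snd.comp measurePreserving_snd).comp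
    (hρ.measurePreserving_mark_jump hl θ)

lemma ae_forall_exists_jump (hρ : IsPoissonLaw l ρ) (hl : 0 < ∑ θ, l θ) :
    ∀ᵐ x ∂ρ, ∀ n, ∃ θ, jump (next^[n] x) = Pi.single θ 1 :=
  ae_all_iff.2 fun n => ((hρ.measurePreserving_next hl).iterate n).quasiMeasurePreserving.ae
    (hρ.ae_exists_jump_eq_single hl)

section Queue

variable {σ : Measure (ℕ → ℝ)} [IsProbabilityMeasure σ] {m : ℝ} (hρ : IsPoissonLaw l ρ)
  (hl : 0 < ∑ θ, l θ) (θ : Θ) (hm : 0 < m)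
  (hσ : MeasurePreserving headTail σ ((expMeasure m).prod σ))
include hρ hl hm hσ

lemma measurePreserving_slot : MeasurePreserving (slot θ) (ρ.prod σ)
    (slotMeasure (∑ θ, l θ : ℝ≥0) (l θ / (∑ θ, l θ : ℝ≥0)) m) := by
  have := hρ.isProbabilityMeasure
  have := isProbabilityMeasure_expMeasure (r := (∑ θ, l θ : ℝ≥0)) (by exact_mod_cast hl)
  have := isProbabilityMeasure_expMeasure hm
  exact (measurePreserving_fst.comp (measurePreserving_prod_regroup _ _ ρ _ σ)).comp
    ((hρ.measurePreserving_mark_jump hl θ).prod hσ)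

/-- An arrival of another type uses no service time of type `θ`. Letting it discard a spare one,
drawn independently of everything else, makes the slot independent of the future. -/
lemma measurePreserving_spareSlot_advance :
    MeasurePreserving (fun p : JumpPath Θ × ℝ × (ℕ → ℝ) =>
        (((jumpTime p.1 : ℝ), mark θ p.1, if mark θ p.1 then p.2.2 0 else p.2.1),
          advance θ (p.1, p.2.2)))
      (ρ.prod ((expMeasure m).prod σ))
      ((slotMeasure (∑ θ, l θ : ℝ≥0) (l θ / (∑ θ, l θ : ℝ≥0)) m).prod (ρ.prod σ)) := by
  have := hρ.isProbabilityMeasure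
  have := isProbabilityMeasure_expMeasure (r := (∑ θ, l θ : ℝ≥0)) (by exact_mod_cast hl)
  have := isProbabilityMeasure_expMeasure hm
  have huse (b : Bool) : ((expMeasure m).prod σ).map (fun q => if b then headTail q.2 else q) =
      (expMeasure m).prod σ := by
    cases b
    · simp
    · simp only [if_true]
      exact (hσ.comp measurePreserving_snd).map_eq
  have hmeas : Measurable (Function.uncurry fun (x : JumpPath Θ) (q : ℝ × (ℕ → ℝ)) =>
      if mark θ x then headTail q.2 else q) :=
    .ite (measurableSet_setOf_mark θ measurable_fst) (by fun_prop) measurable_snd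
  have hskew := (hρ.measurePreserving_mark_jump hl θ).skew_product hmeas
    (ae_of_all _ fun x => huse (mark θ x))
  convert (measurePreserving_prod_regroup _ _ ρ _ σ).comp hskew using 1
  · ext1 p
    cases hmark : mark θ p.1 <;> simp [hmark, advance, headTail]
  · rfl

theorem measurePreserving_workloadStep_advance (ν : Measure ℝ) [IsProbabilityMeasure ν] :
    MeasurePreserving (fun p => (workloadStep (p.1, slot θ p.2), advance θ p.2))
      (ν.prod (ρ.prod σ))
      (((ν.prod (slotMeasure (∑ θ, l θ : ℝ≥0) (l θ / (∑ θ, l θ : ℝ≥0)) m)).map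
        workloadStep).prod (ρ.prod σ)) := by
  have hL : (0 : ℝ) < (∑ θ, l θ : ℝ≥0) := by exact_mod_cast hl
  have := hρ.isProbabilityMeasure
  have := isProbabilityMeasure_expMeasure hm
  have := isProbabilityMeasure_slotMeasure hL hm (by positivity) (div_sum_le_one l θ)
  have hdrop : MeasurePreserving (Prod.map id (Prod.map id Prod.snd))
      (ν.prod (ρ.prod ((expMeasure m).prod σ))) (ν.prod (ρ.prod σ)) :=
    (MeasurePreserving.id ν).prod ((MeasurePreserving.id ρ).prod measurePreserving_snd)
  have hstep := ((measurable_workloadStep.measurePreserving _).prod (.id (ρ.prod σ))).comp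
    ((measurePreserving_prodAssoc ν _ _).symm.comp
      ((MeasurePreserving.id ν).prod (hρ.measurePreserving_spareSlot_advance hl θ hm hσ)))
  rw [← hdrop.map_eq]
  refine MeasurePreserving.map_of_comp ?_ (by fun_prop) hdrop.measurable
  convert hstep using 1
  ext1 ⟨z, x, t, s⟩
  cases hmark : mark θ x <;> simp [hmark, workloadStep, slot, MeasurableEquiv.prodAssoc]

theorem measurePreserving_workload_advance (n : ℕ) :
    MeasurePreserving (fun y => (workload θ y n, (advance θ)^[n] y)) (ρ.prod σ)
      (((ρ.prod σ).map fun y => workload θ y n).prod (ρ.prod σ)) := by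
  have hL : (0 : ℝ) < (∑ θ, l θ : ℝ≥0) := by exact_mod_cast hl
  have := hρ.isProbabilityMeasure
  induction n with
  | zero => exact ⟨by fun_prop, by simp [workload, Measure.dirac_prod]⟩
  | succ n ih =>
    have := isProbabilityMeasure_slotMeasure hL hm (by positivity) (div_sum_le_one l θ)
    have hν := Measure.isProbabilityMeasure_map (μ := ρ.prod σ)
      (measurable_workload θ n).aemeasurable
    have hstep := (hρ.measurePreserving_workloadStep_advance hl θ hm hσ _).comp ih
    have hsucc : (fun p : ℝ × JumpPath Θ × (ℕ → ℝ) =>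
        (workloadStep (p.1, slot θ p.2), advance θ p.2)) ∘
        (fun y => (workload θ y n, (advance θ)^[n] y)) =
          fun y => (workload θ y (n + 1), (advance θ)^[n + 1] y) := by
      ext1 y
      simp only [Function.comp_apply, workload, Function.iterate_succ_apply']
    rw [hsucc] at hstep
    have hfst := (measurePreserving_fst.comp hstep).map_eq
    rwa [← hfst] at hstep

lemma measurePreserving_workload_slot (n : ℕ) :
    MeasurePreserving (fun y => (workload θ y n, slot θ ((advance θ)^[n] y))) (ρ.prod σ)
      (((ρ.prod σ).map fun y => workload θ y n).prod
        (slotMeasure (∑ θ, l θ : ℝ≥0) (l θ / (∑ θ, l θ : ℝ≥0)) m)) := by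
  have := hρ.isProbabilityMeasure
  exact ((MeasurePreserving.id _).prod (hρ.measurePreserving_slot hl θ hm hσ)).comp
    (hρ.measurePreserving_workload_advance hl θ hm hσ n)

omit hm in
theorem tendsto_integral_workload_mark (hstab : l θ < m) {f : ℝ → ℝ} {K : ℝ≥0}
    (hf : LipschitzWith K f) {B : ℝ} (hB : ∀ x, |f x| ≤ B) :
    Tendsto (fun n => ∫ y, (if mark θ (next^[n] y.1) then f (workload θ y (n + 1)) else 0)
        ∂ρ.prod σ) atTop
      (𝓝 (l θ / (∑ θ, l θ : ℝ≥0) * ∫ x, f x ∂expMeasure (m - l θ))) := by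
  have hL : (0 : ℝ) < (∑ θ, l θ : ℝ≥0) := by exact_mod_cast hl
  have hm : 0 < m := (NNReal.coe_nonneg _).trans_lt hstab
  have := hρ.isProbabilityMeasure
  have hcancel : (l θ / (∑ θ, l θ : ℝ≥0) * (∑ θ, l θ : ℝ≥0) : ℝ) = l θ :=
    div_mul_cancel₀ _ hL.ne'
  have hprob (n : ℕ) : IsProbabilityMeasure ((ρ.prod σ).map fun y => workload θ y n) :=
    Measure.isProbabilityMeasure_map (measurable_workload θ n).aemeasurable
  have hslot := hρ.measurePreserving_workload_slot hl θ hm hσ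
  have hrec (n : ℕ) : (ρ.prod σ).map (fun y => workload θ y (n + 1)) =
      (((ρ.prod σ).map fun y => workload θ y n).prod
        (slotMeasure (∑ θ, l θ : ℝ≥0) (l θ / (∑ θ, l θ : ℝ≥0)) m)).map workloadStep := by
    rw [← (hslot n).map_eq, Measure.map_map measurable_workloadStep (hslot n).measurable]
    rfl
  have hlim := tendsto_integral_workload_of_mark hL (by positivity) (div_sum_le_one l θ) hm
    (hcancel.trans_lt hstab) (ν := fun n => (ρ.prod σ).map fun y => workload θ y n)
    (by simp [workload]) hrec hf hB
  rw [hcancel] at hlim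
  have hmeas : Measurable fun z : ℝ × ℝ × Bool × ℝ => if z.2.2.1 then f (workloadStep z) else 0 :=
    .ite measurableSet_mark (hf.continuous.measurable.comp measurable_workloadStep) measurable_const
  refine hlim.congr fun n => ?_
  rw [← (hslot n).map_eq, integral_map (hslot n).aemeasurable hmeas.aestronglyMeasurable]
  simp only [slot, workload, fst_iterate_advance]

end Queue

end IsPoissonLaw

end JumpPath

/-! ### Sojourn times in terms of the workload -/

namespace Queue

variable {Ω : Type*}

/-- The departure epoch of the last of the first `m` customers, with the value `0` for `m = 0`:
the time from which the server is available to customer number `m`. -/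
def lastDeparture (Q : Queue Ω) : ℕ → Ω → ℝ
  | 0, _ => 0
  | m + 1, ω => Q.departure m ω

lemma departure_eq_max_lastDeparture_add (Q : Queue Ω) (m : ℕ) (ω : Ω) :
    Q.departure m ω = max (epoch Q.arrivals m ω : ℝ) (Q.lastDeparture m ω) + Q.service m ω := by
  cases m with
  | zero => rw [lastDeparture, max_eq_left (NNReal.coe_nonneg _), departure]
  | succ m => rw [lastDeparture, departure]

end Queue

namespace JumpPath

variable {Θ : Type*} [DecidableEq Θ] {x : JumpPath Θ} {J : ℕ → Θ}

section UnitJumps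

variable (hJ : ∀ n, jump (next^[n] x) = Pi.single (J n) 1)
include hJ

lemma jump_iterate_next_ne_zero (n : ℕ) : jump (next^[n] x) ≠ 0 := by
  rw [hJ]
  exact Pi.single_ne_zero_iff.2 one_ne_zero

lemma jumpEpoch_lt_succ (n : ℕ) : jumpEpoch x n < jumpEpoch x (n + 1) := by
  rw [jumpEpoch_succ]
  exact lt_add_of_pos_right _
    (jumpTime_pos (exists_ne_zero_of_jump_ne_zero (jump_iterate_next_ne_zero hJ n)))

lemma apply_jumpEpoch_succ_eq_add_ite (n : ℕ) (θ : Θ) :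
    x.1 (jumpEpoch x (n + 1)) θ = x.1 (jumpEpoch x n) θ + if J n = θ then 1 else 0 := by
  simp only [apply_jumpEpoch_succ, hJ, Pi.add_apply, Pi.single_apply, eq_comm]

lemma forall_lt_jumpEpoch_succ_iff (n : ℕ) (θ : Θ) :
    (∀ s < jumpEpoch x (n + 1), x.1 s θ < x.1 (jumpEpoch x (n + 1)) θ) ↔ J n = θ := by
  rw [apply_jumpEpoch_succ_eq_add_ite hJ]
  refine ⟨fun h => ?_, fun h s hs => ?_⟩
  · by_contra hne
    simpa [hne] using h _ (jumpEpoch_lt_succ hJ n)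
  · rw [if_pos h]
    exact Nat.lt_succ_of_le
      (apply_le_of_lt_jumpEpoch_succ (jump_iterate_next_ne_zero hJ n) hs θ)

lemma csInf_setOf_lt_apply {n : ℕ} {θ : Θ} (hθ : J n = θ) :
    sInf {t | x.1 (jumpEpoch x n) θ < x.1 t θ} = jumpEpoch x (n + 1) := by
  refine IsLeast.csInf_eq ⟨(forall_lt_jumpEpoch_succ_iff hJ n θ).2 hθ _ (jumpEpoch_lt_succ hJ n),
    fun t ht => ?_⟩
  by_contra! hlt
  exact ht.not_ge (apply_le_of_lt_jumpEpoch_succ (jump_iterate_next_ne_zero hJ n) hlt θ)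

variable [Fintype Θ]

lemma sum_apply_jumpEpoch (n : ℕ) :
    ∑ θ, x.1 (jumpEpoch x n) θ = n := by
  induction n with
  | zero => simp [jumpEpoch, x.2.zero]
  | succ n ih => simp [apply_jumpEpoch_succ_eq_add_ite hJ, Finset.sum_add_distrib, ih]

lemma csInf_setOf_lt_sum_apply (n : ℕ) :
    sInf {t | n < ∑ θ, x.1 t θ} = jumpEpoch x (n + 1) := by
  refine IsLeast.csInf_eq ⟨?_, fun t ht => ?_⟩
  · exact (Nat.lt_succ_self n).trans_eq (sum_apply_jumpEpoch hJ (n + 1)).symm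
  · by_contra! hlt
    refine ht.not_ge (le_of_le_of_eq (Finset.sum_le_sum fun θ _ => ?_) (sum_apply_jumpEpoch hJ n))
    exact apply_le_of_lt_jumpEpoch_succ (jump_iterate_next_ne_zero hJ n) hlt θ

lemma mark_iterate_next_iff (n : ℕ) (θ : Θ) : mark θ (next^[n] x) ↔ J n = θ := by
  rw [mark, decide_eq_true_iff, hJ, single_one_inj]

lemma iterate_advance (θ : Θ) (s : ℕ → ℝ) (n : ℕ) :
    (advance θ)^[n] (x, s) = (next^[n] x, fun i => s (i + x.1 (jumpEpoch x n) θ)) := by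
  induction n with
  | zero => simp [jumpEpoch, x.2.zero]
  | succ n ih =>
    rw [Function.iterate_succ_apply', ih, advance, Function.iterate_succ_apply',
      apply_jumpEpoch_succ_eq_add_ite hJ]
    by_cases h : J n = θ <;> simp [h, mark_iterate_next_iff hJ, headTail, add_assoc, add_comm]

lemma workload_succ (θ : Θ) (s : ℕ → ℝ) (n : ℕ) :
    workload θ (x, s) (n + 1) = max (workload θ (x, s) n -
      ((jumpEpoch x (n + 1) : ℝ) - jumpEpoch x n)) 0 +
      if J n = θ then s (x.1 (jumpEpoch x n) θ) else 0 := by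
  rw [workload, iterate_advance hJ, jumpEpoch_succ, NNReal.coe_add, add_sub_cancel_left]
  simp only [workloadStep, slot, mark_iterate_next_iff hJ, zero_add]

variable {Ω : Type*} {Q : Queue Ω} {ω : Ω} {θ : Θ} (hQ : ∀ t, Q.arrivals t ω = x.1 t θ)
  (hs : ∀ m, 0 ≤ Q.service m ω)
include hQ

omit [Fintype Θ] in
lemma epoch_apply_jumpEpoch {n : ℕ} (hθ : J n = θ) :
    epoch Q.arrivals (x.1 (jumpEpoch x n) θ) ω = jumpEpoch x (n + 1) := by
  simp only [epoch, hQ]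
  exact csInf_setOf_lt_apply hJ hθ

include hs

theorem workload_eq_lastDeparture_sub (n : ℕ) :
    workload θ (x, fun m => Q.service m ω) n =
      max (Q.lastDeparture (x.1 (jumpEpoch x n) θ) ω - jumpEpoch x n) 0 := by
  induction n with
  | zero => simp [jumpEpoch, x.2.zero, workload, Queue.lastDeparture]
  | succ n ih =>
    have hlt : (jumpEpoch x n : ℝ) < jumpEpoch x (n + 1) := by
      exact_mod_cast jumpEpoch_lt_succ hJ n
    have hdrain (d : ℝ) : max (max (d - jumpEpoch x n) 0 -
        ((jumpEpoch x (n + 1) : ℝ) - jumpEpoch x n)) 0 = max (d - jumpEpoch x (n + 1)) 0 := by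
      grind
    rw [workload_succ hJ, ih, hdrain, apply_jumpEpoch_succ_eq_add_ite hJ]
    by_cases h : J n = θ
    · have hservice := hs (x.1 (jumpEpoch x n) θ)
      rw [if_pos h, if_pos h, Queue.lastDeparture, Q.departure_eq_max_lastDeparture_add,
        epoch_apply_jumpEpoch hJ hQ h]
      grind
    · rw [if_neg h, if_neg h, add_zero, add_zero]

theorem queue_sojourn_eq_workload {n : ℕ} (hθ : J n = θ) :
    Q.sojourn (x.1 (jumpEpoch x n) θ) ω = workload θ (x, fun m => Q.service m ω) (n + 1) := by
  have hservice := hs (x.1 (jumpEpoch x n) θ)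
  rw [workload_eq_lastDeparture_sub hJ hQ hs, apply_jumpEpoch_succ_eq_add_ite hJ, if_pos hθ,
    Queue.lastDeparture, Queue.sojourn, epoch_apply_jumpEpoch hJ hQ hθ,
    Q.departure_eq_max_lastDeparture_add, epoch_apply_jumpEpoch hJ hQ hθ]
  grind

end UnitJumps

end JumpPath

namespace Primitives

variable {I J K Θ Ω : Type*} [Fintype I] [Fintype Θ] {C : Network I J K Θ} {X : Primitives I J Θ Ω}

lemma total_eq_sum_typeCount (j : J) (t : ℝ≥0) (ω : Ω) :
    X.total C j t ω = ∑ θ, X.typeCount C j θ t ω := by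
  classical
  simp only [total, typeCount]
  rw [Finset.sum_comm]
  refine Finset.sum_congr rfl fun i _ => ?_
  rw [← Finset.card_eq_sum_card_fiberwise (f := fun n => X.type i n ω) (t := Finset.univ)
    (by simp), Finset.card_range]

open JumpPath in
/-- A request joins the queue of its type and is served last among those present, so its sojourn
time is the workload of that queue just after its arrival. -/
theorem sojourn_eq_workload [DecidableEq Θ] {j : J} {ω : Ω} {x : JumpPath Θ} {A : ℕ → Θ}
    (hA : ∀ n, jump (next^[n] x) = Pi.single (A n) 1)
    (hx : ∀ t θ, X.typeCount C j θ t ω = x.1 t θ) (hs : ∀ θ m, 0 ≤ X.service j θ m ω) (n : ℕ) :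
    X.sojourn C j n ω = workload (A n) (x, fun m => X.service j (A n) m ω) (n + 1) := by
  have hepoch : epoch (X.total C j) n ω = jumpEpoch x (n + 1) := by
    simp only [epoch, total_eq_sum_typeCount, hx]
    exact csInf_setOf_lt_sum_apply hA n
  simp only [sojourn, hepoch, hx, forall_lt_jumpEpoch_succ_iff hA, Finset.sum_ite_eq,
    Finset.mem_univ, if_true]
  rw [apply_jumpEpoch_succ_eq_add_ite hA, if_pos rfl, Nat.add_sub_cancel]
  exact queue_sojourn_eq_workload (Q := X.dsrQueue C j (A n)) hA (fun t => hx t _) (hs _) rfl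

end Primitives

/-! ### The steady-state sojourn time -/

section SojournLaw

variable {I J K Θ : Type*} [Fintype I] [Fintype Θ] {C : Network I J K Θ} {j : J}

namespace Network

lemma sum_typeRate (C : Network I J K Θ) (j : J) : ∑ θ, C.typeRate j θ = C.rate j := by
  simp only [typeRate, rate]
  rw [Finset.sum_comm]
  simp only [← Finset.mul_sum, C.p_sum, mul_one]

lemma coe_sum_toNNReal_typeRate (C : Network I J K Θ) (j : J) :
    ((∑ θ, (C.typeRate j θ).toNNReal : ℝ≥0) : ℝ) = C.rate j := by
  simp only [NNReal.coe_sum, Real.coe_toNNReal _ (C.typeRate_nonneg j _), sum_typeRate]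

lemma rate_pos (C : Network I J K Θ) (hj : ∃ i, C.edge i = j) : 0 < C.rate j := by
  classical
  obtain ⟨i, hi⟩ := hj
  exact Finset.sum_pos (fun i _ => C.ξ_pos i) ⟨i, by simp [hi]⟩

/-- The hyperexponential distribution which is to be the law of the steady-state sojourn time at
`j`: a request is of type `θ` with probability `Λ_j^θ / Λ_j`, and the sojourn time of an `M/M/1`
queue is exponential. -/
def sojournLaw (C : Network I J K Θ) (j : J) : Measure ℝ :=
  hyperexpMeasure (fun θ => C.typeRate j θ / C.rate j) (fun θ => C.μ j θ - C.typeRate j θ)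

lemma typeRate_div_rate_nonneg (hj : ∃ i, C.edge i = j) (θ : Θ) :
    0 ≤ C.typeRate j θ / C.rate j :=
  div_nonneg (C.typeRate_nonneg j θ) (C.rate_pos hj).le

variable (hstab : ∀ θ, C.typeRate j θ < C.μ j θ)
include hstab

lemma isProbabilityMeasure_sojournLaw (hj : ∃ i, C.edge i = j) :
    IsProbabilityMeasure (C.sojournLaw j) := by
  refine isProbabilityMeasure_hyperexpMeasure (typeRate_div_rate_nonneg hj) ?_
    fun θ => sub_pos.2 (hstab θ)
  rw [← Finset.sum_div, sum_typeRate, div_self (C.rate_pos hj).ne']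

lemma integrable_id_sojournLaw : Integrable (fun x => x) (C.sojournLaw j) :=
  integrable_hyperexpMeasure fun θ => integrable_id_expMeasure (sub_pos.2 (hstab θ))

lemma integral_id_sojournLaw (hj : ∃ i, C.edge i = j) :
    ∫ x, x ∂C.sojournLaw j =
      ∑ θ, C.typeRate j θ / (C.rate j * (C.μ j θ - C.typeRate j θ)) := by
  rw [sojournLaw, integral_hyperexpMeasure (typeRate_div_rate_nonneg hj)
    fun θ => integrable_id_expMeasure (sub_pos.2 (hstab θ))]
  simp only [integral_id_expMeasure (sub_pos.2 (hstab _)), div_mul_div_comm, mul_one]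

end Network

end SojournLaw

namespace Primitives

open JumpPath

variable {I J K Θ Ω : Type*} [Fintype I] [Fintype Θ] [MeasurableSpace Ω]
  {P : Measure Ω} [IsProbabilityMeasure P] {C : Network I J K Θ} {X : Primitives I J Θ Ω}

omit [Fintype I] [IsProbabilityMeasure P] in
lemma Satisfies.measurable_service_pi (hX : X.Satisfies C P) (j : J) (θ : Θ) :
    Measurable fun ω m => X.service j θ m ω :=
  measurable_pi_lambda _ (hX.service_measurable j θ)

omit [Fintype I] [IsProbabilityMeasure P] in
lemma Satisfies.ae_service_nonneg (hX : X.Satisfies C P) (j : J) :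
    ∀ᵐ ω ∂P, ∀ θ m, 0 ≤ X.service j θ m ω := by
  refine ae_all_iff.2 fun θ => ae_all_iff.2 fun m => ?_
  have hpos := ae_pos_expMeasure (C.μ j θ)
  rw [← (hX.service_law j θ m).map_eq] at hpos
  exact (ae_of_ae_map (hX.service_law j θ m).aemeasurable hpos).mono fun _ h => le_of_lt h

omit [Fintype I] [IsProbabilityMeasure P] in
lemma Satisfies.measurePreserving_headTail_service (hX : X.Satisfies C P) (j : J) (θ : Θ) :
    MeasurePreserving headTail (P.map fun ω m => X.service j θ m ω)
      ((expMeasure (C.μ j θ)).prod (P.map fun ω m => X.service j θ m ω)) :=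
  have := isProbabilityMeasure_expMeasure (C.μ_pos j θ)
  measurePreserving_headTail (hX.iIndepFun_service j θ) (hX.service_measurable j θ)
    (hX.service_law j θ)

omit [IsProbabilityMeasure P] in
lemma Satisfies.exists_measurable_path (hX : X.Satisfies C P) (j : J) :
    ∃ φ : Ω → JumpPath Θ, Measurable φ ∧
      ∀ᵐ ω ∂P, ∀ t θ, X.typeCount C j θ t ω = (φ ω).1 t θ := by
  classical
  obtain ⟨G, hG, hGm, hgood⟩ := (hX.ae_typeCount j).exists_measurable_mem
  have hpath : ∀ ω, IsJumpPath fun t θ => if ω ∈ G then X.typeCount C j θ t ω else 0 := by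
    intro ω
    by_cases hω : ω ∈ G
    · simp only [hω, if_true]
      refine ⟨funext fun θ => (hgood ω hω θ).1, fun s t hst θ => (hgood ω hω θ).2.1 hst,
        fun t => ?_⟩
      filter_upwards [eventually_all.2 fun θ => (hgood ω hω θ).2.2 t] with s hs
      exact funext hs
    · simp only [hω, if_false]
      exact ⟨rfl, monotone_const, fun t => Eventually.of_forall fun _ => rfl⟩
  refine ⟨fun ω => ⟨_, hpath ω⟩, Measurable.subtype_mk ?_, ?_⟩
  · exact measurable_pi_lambda _ fun t => measurable_pi_lambda _ fun θ =>
      .ite hGm (hX.measurable_typeCount j θ t) measurable_const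
  · filter_upwards [hG] with ω hω t θ
    exact (if_pos hω).symm

section Path

variable {j : J} {φ : Ω → JumpPath Θ}
  (hφX : ∀ᵐ ω ∂P, ∀ t θ, X.typeCount C j θ t ω = (φ ω).1 t θ)
include hφX

lemma Satisfies.isPoissonLaw_map_path (hX : X.Satisfies C P) (hφ : Measurable φ) :
    IsPoissonLaw (fun θ => (C.typeRate j θ).toNNReal) (P.map φ) := by
  intro t ht _ k
  have hincr : Measurable fun ω (q : Fin k × Θ) =>
      X.typeCount C j q.2 (t (q.1 + 1)) ω - X.typeCount C j q.2 (t q.1) ω :=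
    measurable_pi_lambda _ fun q =>
      (hX.measurable_typeCount j _ _).sub (hX.measurable_typeCount j _ _)
  have hcurry : increments t k ∘ φ =ᵐ[P] MeasurableEquiv.curry (Fin k) Θ ℕ ∘
      fun ω (q : Fin k × Θ) =>
        X.typeCount C j q.2 (t (q.1 + 1)) ω - X.typeCount C j q.2 (t q.1) ω := by
    filter_upwards [hφX] with ω hω
    ext i θ
    simp [increments, hω]
  rw [Measure.map_map (measurable_increments t k) hφ, Measure.map_congr hcurry,
    ← Measure.map_map (MeasurableEquiv.measurable _) hincr, hX.map_typeCount_sub_eq_pi j ht k]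
  simpa only [Measure.infinitePi_eq_pi] using Measure.infinitePi_map_curry (X := ℕ)
    fun (i : Fin k) θ => poissonMeasure ((C.typeRate j θ).toNNReal * (t (i + 1) - t i))

omit [IsProbabilityMeasure P] in
lemma Satisfies.indepFun_path_service (hX : X.Satisfies C P) (θ : Θ) :
    IndepFun φ (fun ω m => X.service j θ m ω) P := by
  have hswap : Measurable fun (x : Θ → ℝ≥0 → ℕ) t θ => x θ t := by fun_prop
  have hcounts : IndepFun (fun ω => (φ ω).1) (fun ω m => X.service j θ m ω) P :=
    ((hX.indepFun_typeCount_service j).comp hswap (measurable_pi_apply θ)).congr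
      (hφX.mono fun ω hω => funext fun t => funext fun θ => hω t θ) (ae_eq_refl _)
  rw [IndepFun_iff_Indep] at hcounts ⊢
  convert hcounts using 1
  exact MeasurableSpace.comap_comp

variable (hφ : Measurable φ) (hj : ∃ i, C.edge i = j)
include hφ hj

lemma Satisfies.ae_comp_sojourn_eq_sum [DecidableEq Θ] (hX : X.Satisfies C P) (f : ℝ → ℝ) :
    ∀ᵐ ω ∂P, ∀ n, f (X.sojourn C j n ω) = ∑ θ, if mark θ (next^[n] (φ ω)) then
      f (workload θ (φ ω, fun m => X.service j θ m ω) (n + 1)) else 0 := by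
  have hjumps := ae_of_ae_map hφ.aemeasurable <|
    (hX.isPoissonLaw_map_path hφX hφ).ae_forall_exists_jump <| by
      rw [← NNReal.coe_pos, C.coe_sum_toNNReal_typeRate]
      exact C.rate_pos hj
  filter_upwards [hφX, hjumps, hX.ae_service_nonneg j] with ω hω hjump hservice n
  choose A hA using hjump
  simp only [sojourn_eq_workload hA hω hservice, mark_iterate_next_iff hA, Finset.sum_ite_eq,
    Finset.mem_univ, if_true]

omit [Fintype I] [IsProbabilityMeasure P] hφX hj in
lemma Satisfies.measurable_ite_mark_workload [DecidableEq Θ] (hX : X.Satisfies C P) {f : ℝ → ℝ}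
    (hf : Measurable f) (θ : Θ) (n : ℕ) :
    Measurable fun ω => if mark θ (next^[n] (φ ω)) then
      f (workload θ (φ ω, fun m => X.service j θ m ω) (n + 1)) else 0 :=
  .ite (measurableSet_setOf_mark θ ((measurable_next.iterate n).comp hφ))
    (hf.comp ((measurable_workload θ (n + 1)).comp (hφ.prodMk (hX.measurable_service_pi j θ))))
    measurable_const

lemma Satisfies.tendsto_integral_ite_mark_workload [DecidableEq Θ] (hX : X.Satisfies C P) (θ : Θ)
    (hstab : C.typeRate j θ < C.μ j θ) {f : ℝ → ℝ} {K : ℝ≥0} (hf : LipschitzWith K f) {B : ℝ}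
    (hB : ∀ x, |f x| ≤ B) :
    Tendsto (fun n => ∫ ω, (if mark θ (next^[n] (φ ω)) then
        f (workload θ (φ ω, fun m => X.service j θ m ω) (n + 1)) else 0) ∂P) atTop
      (𝓝 (C.typeRate j θ / C.rate j * ∫ x, f x ∂expMeasure (C.μ j θ - C.typeRate j θ))) := by
  have hservice := hX.measurable_service_pi j θ
  have := Measure.isProbabilityMeasure_map (μ := P) hservice.aemeasurable
  have hpair := (indepFun_iff_map_prod_eq_prod_map_map hφ.aemeasurable hservice.aemeasurable).1
    (hX.indepFun_path_service hφX θ)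
  have hcoe : ((C.typeRate j θ).toNNReal : ℝ) = C.typeRate j θ :=
    Real.coe_toNNReal _ (C.typeRate_nonneg j θ)
  have hlim := (hX.isPoissonLaw_map_path hφX hφ).tendsto_integral_workload_mark
    (by rw [← NNReal.coe_pos, C.coe_sum_toNNReal_typeRate]; exact C.rate_pos hj) θ
    (hX.measurePreserving_headTail_service j θ) (hcoe.trans_lt hstab) hf hB
  rw [hcoe, C.coe_sum_toNNReal_typeRate] at hlim
  refine hlim.congr fun n => ?_
  rw [← hpair, integral_map (hφ.prodMk hservice).aemeasurable]
  exact (Measurable.ite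
    (measurableSet_setOf_mark θ ((measurable_next.iterate n).comp measurable_fst))
    (hf.continuous.measurable.comp (measurable_workload θ (n + 1)))
    measurable_const).aestronglyMeasurable

end Path

variable {j : J} (hj : ∃ i, C.edge i = j)
include hj

lemma Satisfies.aemeasurable_sojourn (hX : X.Satisfies C P) (n : ℕ) :
    AEMeasurable (X.sojourn C j n) P := by
  classical
  obtain ⟨φ, hφ, hφX⟩ := hX.exists_measurable_path j
  exact ⟨_, Finset.measurable_fun_sum _ fun θ _ =>
    hX.measurable_ite_mark_workload hφ measurable_id θ n,
    (hX.ae_comp_sojourn_eq_sum hφX hφ hj id).mono fun _ h => h n⟩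

variable (hstab : ∀ θ, C.typeRate j θ < C.μ j θ)
include hstab

theorem Satisfies.tendsto_integral_sojourn (hX : X.Satisfies C P) {f : ℝ → ℝ} {K : ℝ≥0}
    (hf : LipschitzWith K f) {B : ℝ} (hB : ∀ x, |f x| ≤ B) :
    Tendsto (fun n => ∫ ω, f (X.sojourn C j n ω) ∂P) atTop
      (𝓝 (∫ x, f x ∂C.sojournLaw j)) := by
  classical
  obtain ⟨φ, hφ, hφX⟩ := hX.exists_measurable_path j
  have hsum (n : ℕ) : ∫ ω, f (X.sojourn C j n ω) ∂P =
      ∑ θ, ∫ ω, (if mark θ (next^[n] (φ ω)) then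
        f (workload θ (φ ω, fun m => X.service j θ m ω) (n + 1)) else 0) ∂P := by
    rw [integral_congr_ae ((hX.ae_comp_sojourn_eq_sum hφX hφ hj f).mono fun _ h => h n)]
    refine integral_finsetSum _ fun θ _ => integrable_of_abs_le (B := B)
      (hX.measurable_ite_mark_workload hφ hf.continuous.measurable θ n) fun ω => ?_
    split_ifs
    · exact hB _
    · simpa using (abs_nonneg _).trans (hB 0)
  have hint (θ : Θ) : Integrable f (expMeasure (C.μ j θ - C.typeRate j θ)) :=
    have := isProbabilityMeasure_expMeasure (sub_pos.2 (hstab θ))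
    integrable_of_abs_le hf.continuous.measurable hB
  rw [Network.sojournLaw, integral_hyperexpMeasure (Network.typeRate_div_rate_nonneg hj) hint]
  simp_rw [hsum]
  exact tendsto_finsetSum _ fun θ _ =>
    hX.tendsto_integral_ite_mark_workload hφX hφ hj θ (hstab θ) hf hB

theorem Satisfies.isSteadyStateSojourn_sojournLaw (hX : X.Satisfies C P)
    [IsProbabilityMeasure (C.sojournLaw j)] :
    X.IsSteadyStateSojourn C P j id (C.sojournLaw j) := by
  refine ⟨hX.aemeasurable_sojourn hj, measurable_id.aemeasurable,
    tendsto_iff_forall_lipschitz_integral_tendsto.2 ?_⟩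
  rintro f ⟨B, hB⟩ ⟨K, hK⟩
  have hbound (x : ℝ) : |f x| ≤ |f 0| + B := by
    have hdist := hB x 0
    rw [Real.dist_eq] at hdist
    linarith [abs_sub_abs_le_abs_sub (f x) (f 0)]
  simp only [ProbabilityMeasure.coe_mk, Measure.map_id]
  refine (hX.tendsto_integral_sojourn hj hstab hK hbound).congr fun n => ?_
  rw [integral_map (hX.aemeasurable_sojourn hj n)
    hK.continuous.measurable.aestronglyMeasurable]

theorem Satisfies.hasLaw_sojournLaw (hX : X.Satisfies C P) {Ω' : Type*} [MeasurableSpace Ω']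
    {P' : Measure Ω'} [IsProbabilityMeasure P'] {T : Ω' → ℝ}
    (hT : X.IsSteadyStateSojourn C P j T P') : HasLaw T (C.sojournLaw j) P' := by
  have := C.isProbabilityMeasure_sojournLaw hstab hj
  refine ⟨hT.aemeasurable_limit, ?_⟩
  rw [tendstoInDistribution_unique _ hT (hX.isSteadyStateSojourn_sojournLaw hj hstab),
    Measure.map_id]

end Primitives

end CDN

end

theorem mainTheorem5_general {I J K Θ : Type*} [Fintype I] [Fintype Θ]
    {Ω : Type*} [MeasurableSpace Ω] (P : Measure Ω) [IsProbabilityMeasure P]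
    (C : CDN.Network I J K Θ) (X : CDN.Primitives I J Θ Ω) (hX : X.Satisfies C P) (j : J) :
    ((∀ θ, (X.dsrQueue C j θ).IsMM1 (C.typeRate j θ) (C.μ j θ) P) ∧
      iIndepFun (fun θ => (X.dsrQueue C j θ).input) P) ∧
    ((∀ θ, C.typeRate j θ < C.μ j θ) → (∃ i, C.edge i = j) →
      (∃ ν : ProbabilityMeasure ℝ, X.IsSteadyStateSojourn C P j id (ν : Measure ℝ)) ∧
      ∀ {Ω' : Type*} [MeasurableSpace Ω'] (P' : Measure Ω') [IsProbabilityMeasure P']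
        (T : Ω' → ℝ), X.IsSteadyStateSojourn C P j T P' →
        HasLaw T (CDN.hyperexpMeasure (fun θ => C.typeRate j θ / C.rate j)
          (fun θ => C.μ j θ - C.typeRate j θ)) P' ∧
        Integrable T P' ∧
        ∫ ω, T ω ∂P' =
          ∑ θ, C.typeRate j θ / (C.rate j * (C.μ j θ - C.typeRate j θ))) := by
  refine ⟨⟨hX.isMM1_dsrQueue j, hX.iIndepFun_input j⟩, fun hstab hj => ⟨?_, ?_⟩⟩
  · have hprob := C.isProbabilityMeasure_sojournLaw hstab hj
    exact ⟨⟨C.sojournLaw j, hprob⟩, hX.isSteadyStateSojourn_sojournLaw hj hstab⟩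
  · intro Ω' _ P' _ T hT
    have hlaw : HasLaw T (C.sojournLaw j) P' := hX.hasLaw_sojournLaw hj hstab hT
    have hint := C.integrable_id_sojournLaw hstab
    rw [← hlaw.map_eq, integrable_map_measure (by fun_prop) hlaw.aemeasurable] at hint
    exact ⟨hlaw, hint, hlaw.integral_eq.trans (C.integral_id_sojournLaw hstab hj)⟩

theorem mainTheorem5 {I J K Θ : Type*} [Fintype I] [Fintype J] [Fintype K] [Fintype Θ]
    {Ω : Type*} [MeasurableSpace Ω] (P : Measure Ω) [IsProbabilityMeasure P]
    (C : CDN.Network I J K Θ) (X : CDN.Primitives I J Θ Ω) (hX : X.Satisfies C P)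
    (j : J) (hstab : ∀ θ, C.typeRate j θ < C.μ j θ) :
    ((∀ θ, (X.dsrQueue C j θ).IsMM1 (C.typeRate j θ) (C.μ j θ) P) ∧
      iIndepFun (fun θ => (X.dsrQueue C j θ).input) P) ∧
    ((∃ i, C.edge i = j) →
      (∃ ν : ProbabilityMeasure ℝ, X.IsSteadyStateSojourn C P j id (ν : Measure ℝ)) ∧
      ∀ {Ω' : Type*} [MeasurableSpace Ω'] (P' : Measure Ω') [IsProbabilityMeasure P']
        (T : Ω' → ℝ), X.IsSteadyStateSojourn C P j T P' →
        HasLaw T (CDN.hyperexpMeasure (fun θ => C.typeRate j θ / C.rate j)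
          (fun θ => C.μ j θ - C.typeRate j θ)) P' ∧
        Integrable T P' ∧
        ∫ ω, T ω ∂P' =
          ∑ θ, C.typeRate j θ / (C.rate j * (C.μ j θ - C.typeRate j θ))) :=
  have h := mainTheorem5_general P C X hX j
  ⟨h.1, h.2 hstab⟩
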